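/- Let $\Bbbk$ be an algebraically closed field and let $\mathcal A$ be a locally finite dimensional (lofd) $\Bbbk$-category: all spaces $\mathcal A(x,y)$ are finite dimensional, $\mathcal A$ is additive with split idempotents, and for every object $x$ there are, up to isomorphism, only finitely many indecomposables $y$ with $\mathcal A(x,y)\neq 0$ or $\mathcal A(y,x)\neq 0$. Assume that the radical of $\mathcal A$ has square zero. Let $\mathcal A$-mod be the category of finite dimensional $\mathcal A$-modules, i.e. $\Bbbk$-linear functors from $\mathcal A$ to finite dimensional vector spaces that are nonzero on only finitely many isomorphism classes of indecomposables, and let $D^b(\mathcal A)$ be its bounded derived category. Put $\mathcal A^x=\mathcal A(x,-)$. Let $Q$ be the quiver of $\mathcal A$: its vertices are representatives of the isomorphism classes of indecomposable objects and its arrows $x\to y$ form a basis of $\mathrm{rad}(x,y)$ (which is $\mathrm{rad}/\mathrm{rad}^2$ here). Let $Q^{\square}$ be the quiver with vertex set $Q_0\times\mathbb Z$ and an arrow $(\alpha,i):(b,i)\to(a,i-1)$ for every arrow $\alpha:a\to b$ of $Q$ and every $i\in\mathbb Z$. For a finite dimensional representation $M$ of $Q^{\square}$ (all spaces finite dimensional,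 almost all zero) let $\mathbf F(M)$ be the complex with $$P_n=\bigoplus_{x\in Q_0}\mathcal A^x\otimes M(x,n),\qquad d_n=\sum_{\alpha:x\to y}\mathcal A^{\alpha}\otimes M(\alpha,n):P_n\to P_{n-1}.$$ Let $\mathcal P^b_{\min}(\mathcal A)$ be the category of bounded complexes $P$ of projective objects of $\mathcal A$-mod that are minimal, i.e. $\operatorname{Im}d_n\subseteq\operatorname{rad}P_{n-1}$ for all $n$. For a nonzero $P$ in it let $t$ be the minimal number with $P_i=0$ for $i>t$, and let $\beta(P)$ be the complex $$0\to\operatorname{Ker}d_t\hookrightarrow P_t\xrightarrow{d_t}P_{t-1}\to\cdots$$ with $\operatorname{Ker}d_t$ in degree $t+1$ and $P_i$ in degree $i\le t$. Let $\overline{\mathcal X}(\mathcal A)$ be the class of all indecomposable $N$ in $\mathcal P^b_{\min}(\mathcal A)$ such that the minimal projective resolution of $\beta(N)$ (a right bounded minimal complex of projectives quasi-isomorphic to $\beta(N)$) is not bounded. Let $\mathcal X(\mathcal A)\subseteq\overline{\mathcal X}(\mathcal A)$ be a set of representatives for the equivalence relation under which $N$ and $N'$ are equivalent if the minimal projective resolutions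 of $\beta(N)$ and $\beta(N')$ are isomorphic in the homotopy category. **Theorem.** The complexes $\mathbf F(M)$, with $M$ running through representatives of the isomorphism classes of indecomposable finite dimensional representations of $Q^{\square}$, and $\beta(N)$, with $N\in\mathcal X(\mathcal A)$, form an exhaustive list of pairwise non-isomorphic indecomposable objects of $D^b(\mathcal A)$: every listed object is indecomposable, every indecomposable object of $D^b(\mathcal A)$ is isomorphic to a listed one, and no two different listed objects are isomorphic. -/

import Mathlib

open CategoryTheory CategoryTheory.Limits
open scoped TensorProduct

universe w v u w₁ w₂ w₃

noncomputable section

namespace RadSq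

section General

variable {C : Type u} [Category.{v} C]

/-- An object is indecomposable if it is nonzero and whenever it is (via some biproduct diagram)
a direct sum of `Y` and `Z`, one of the two is zero. No existence of biproducts is assumed, so the
notion makes sense in full subcategories of additive categories. -/
def IsIndec [HasZeroMorphisms C] (X : C) : Prop :=
  ¬ IsZero X ∧ ∀ (Y Z : C) (b : BinaryBicone Y Z),
    Nonempty b.IsBilimit → Nonempty (X ≅ b.pt) → IsZero Y ∨ IsZero Z

/-- When binary biproducts exist this is Mathlib's notion. -/
theorem isIndec_iff [HasZeroMorphisms C] [HasBinaryBiproducts C] (X : C) :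
    IsIndec X ↔ Indecomposable X := by
  refine and_congr_right fun _ => ⟨fun h Y Z e => ?_, fun h Y Z b hb e => ?_⟩
  · exact h Y Z (BinaryBiproduct.bicone Y Z) ⟨BinaryBiproduct.isBilimit Y Z⟩ ⟨e⟩
  · obtain ⟨hb⟩ := hb
    obtain ⟨e⟩ := e
    exact h Y Z (e ≪≫ biprod.uniqueUpToIso Y Z hb)

/-- Only finitely many isomorphism classes of objects have a representative satisfying `p`. -/
def FinitelyManyUpToIso (p : C → Prop) : Prop :=
  {c : Quotient (isIsomorphicSetoid C) | ∃ y, p y ∧ Quotient.mk _ y = c}.Finite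

theorem FinitelyManyUpToIso.mono {p q : C → Prop} (h : FinitelyManyUpToIso q)
    (hpq : ∀ x, p x → q x) : FinitelyManyUpToIso p :=
  Set.Finite.subset h (by rintro c ⟨y, hy, rfl⟩; exact ⟨y, hpq y hy, rfl⟩)

/-- The radical of a preadditive category: `f : x ⟶ y` is radical if `1 - g ∘ f` is
invertible for every `g : y ⟶ x`. -/
def IsRadical [Preadditive C] {x y : C} (f : x ⟶ y) : Prop :=
  ∀ g : y ⟶ x, IsIso (𝟙 x - f ≫ g)

theorem IsRadical.isIso' [Preadditive C] {x y : C} {f : x ⟶ y} (hf : IsRadical f)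
    {z : C} (g : y ⟶ z) (h : z ⟶ x) : IsIso (𝟙 z - h ≫ f ≫ g) := by
  have := hf (g ≫ h)
  set u := inv (𝟙 x - f ≫ g ≫ h) with hu
  have h1 : (𝟙 x - f ≫ g ≫ h) ≫ u = 𝟙 x := IsIso.hom_inv_id _
  have h2 : u ≫ (𝟙 x - f ≫ g ≫ h) = 𝟙 x := IsIso.inv_hom_id _
  simp only [Preadditive.sub_comp, Preadditive.comp_sub, Category.id_comp, Category.comp_id,
    Category.assoc] at h1 h2
  have h1' : f ≫ g ≫ h ≫ u = u - 𝟙 x := by rw [← h1]; abel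
  have h2' : u ≫ f ≫ g ≫ h = u - 𝟙 x := by rw [← h2]; abel
  refine ⟨𝟙 z + h ≫ u ≫ f ≫ g, ?_, ?_⟩
  · have : h ≫ (f ≫ g ≫ h ≫ u) ≫ f ≫ g = h ≫ u ≫ f ≫ g - h ≫ f ≫ g := by
      rw [h1']; simp
    simp only [Category.assoc] at this
    simp [this]
  · have : h ≫ (u ≫ f ≫ g ≫ h) ≫ f ≫ g = h ≫ u ≫ f ≫ g - h ≫ f ≫ g := by
      rw [h2']; simp
    simp only [Category.assoc] at this
    simp [this]

/-- The radical morphisms `x ⟶ y` form a subspace. -/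
def rad (k : Type w) [Field k] [Preadditive C] [Linear k C] (x y : C) :
    Submodule k (x ⟶ y) where
  carrier := {f | IsRadical f}
  zero_mem' g := by simpa using (inferInstance : IsIso (𝟙 x))
  add_mem' {f₁ f₂} h₁ h₂ g := by
    have i₁ := h₁ g
    have i₂ := h₂.isIso' g (inv (𝟙 x - f₁ ≫ g))
    have : 𝟙 x - (f₁ + f₂) ≫ g =
        (𝟙 x - f₁ ≫ g) ≫ (𝟙 x - inv (𝟙 x - f₁ ≫ g) ≫ f₂ ≫ g) := by
      rw [Preadditive.comp_sub, IsIso.hom_inv_id_assoc]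
      simp only [Preadditive.add_comp, Category.comp_id]
      abel
    rw [this]
    infer_instance
  smul_mem' c f h g := by
    have := h (c • g)
    simpa using this

/-- A product of two matrices of morphisms vanishes if all products of entries do. -/
theorem desc_lift_comp_eq_zero [Preadditive C] {I : Type*} {J : Type*} {K : Type*} [Finite J]
    {f : I → C} {g : J → C} {h : K → C} [HasBiproduct f] [HasBiproduct g] [HasBiproduct h]
    (a : ∀ i j, f i ⟶ g j) (b : ∀ j l, g j ⟶ h l) (hab : ∀ i j l, a i j ≫ b j l = 0) :
    biproduct.desc (fun i => biproduct.lift (a i)) ≫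
      biproduct.desc (fun j => biproduct.lift (b j)) = 0 := by
  let _ := Fintype.ofFinite J
  have tot : ∑ j, biproduct.π g j ≫ biproduct.ι g j = 𝟙 (⨁ g) :=
    IsBilimit.total (biproduct.isBilimit g)
  refine biproduct.hom_ext' _ _ fun i => biproduct.hom_ext _ _ fun l => ?_
  rw [← Category.id_comp (biproduct.desc fun j => biproduct.lift (b j)), ← tot]
  simp [Preadditive.comp_sum, Preadditive.sum_comp, hab]

end General

set_option linter.unusedSectionVars false
set_option linter.checkUnivs false

/-- A locally finite dimensional (lofd) `k`-category: finite dimensional morphism spaces, additive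
with split idempotents, and for every object `x` only finitely many indecomposables `y`, up to
isomorphism, admit a nonzero morphism from or to `x`. -/
class IsLofd (k : Type w) [Field k] (A : Type u) [Category.{v} A] [Preadditive A] [Linear k A] :
    Prop where
  finite_hom : ∀ x y : A, Module.Finite k (x ⟶ y)
  additive : HasFiniteBiproducts A
  split : IsIdempotentComplete A
  finite_neighbours : ∀ x : A,
    FinitelyManyUpToIso fun y : A => IsIndec y ∧ (Nontrivial (x ⟶ y) ∨ Nontrivial (y ⟶ x))

/-- The category has radical square zero: a composite of two radical morphisms vanishes. -/
class HasRadicalSquareZero (A : Type u) [Category.{v} A] [Preadditive A] : Prop where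
  comp_eq_zero : ∀ {x y z : A} (f : x ⟶ y) (g : y ⟶ z), IsRadical f → IsRadical g → f ≫ g = 0

variable (k : Type w) [Field k] (A : Type u) [Category.{v} A] [Preadditive A] [Linear k A]

/-! ### Finite dimensional modules -/

/-- Finite dimensional `A`-modules among all functors from `A` to vector spaces: the functor is
`k`-linear with finite dimensional values, and is nonzero on only finitely many
indecomposables up to isomorphism. -/
def isFDModule : ObjectProperty (A ⥤ ModuleCat.{v} k) := fun M =>
  M.Additive ∧ (∀ {x y : A} (f : x ⟶ y) (c : k), M.map (c • f) = c • M.map f) ∧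
    (∀ x, Module.Finite k (M.obj x)) ∧
    FinitelyManyUpToIso fun y : A => IsIndec y ∧ Nontrivial (M.obj y)

/-- The category `A`-mod of finite dimensional `A`-modules. -/
abbrev FDModule := (isFDModule k A).FullSubcategory

variable {k A} in
theorem mono_app_injective {M N : A ⥤ ModuleCat.{v} k} (f : M ⟶ N) [Mono f] (x : A) :
    Function.Injective (f.app x) :=
  (ModuleCat.mono_iff_injective _).1 inferInstance

variable {k A} in
theorem epi_app_surjective {M N : A ⥤ ModuleCat.{v} k} (f : M ⟶ N) [Epi f] (x : A) :
    Function.Surjective (f.app x) :=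
  (ModuleCat.epi_iff_surjective _).1 inferInstance

instance : (isFDModule k A).IsClosedUnderSubobjects where
  prop_of_mono {M N} f _ h := by
    obtain ⟨h1, h2, h3, h4⟩ := h
    refine ⟨⟨fun {x y a b} => ?_⟩, fun {x y} a c => ?_, fun x => ?_, ?_⟩
    · rw [← cancel_mono (f.app y)]
      simp [h1.map_add, Preadditive.add_comp]
    · rw [← cancel_mono (f.app y)]
      simp [h2]
    · have := h3 x
      exact Module.Finite.of_injective (f.app x).hom (mono_app_injective f x)
    · exact h4.mono fun y hy => ⟨hy.1, have := hy.2; (mono_app_injective f y).nontrivial⟩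

instance : (isFDModule k A).IsClosedUnderQuotients where
  prop_of_epi {M N} f _ h := by
    obtain ⟨h1, h2, h3, h4⟩ := h
    refine ⟨⟨fun {x y a b} => ?_⟩, fun {x y} a c => ?_, fun x => ?_, ?_⟩
    · rw [← cancel_epi (f.app x)]
      rw [← f.naturality, h1.map_add, Preadditive.add_comp, Preadditive.comp_add,
        f.naturality, f.naturality]
    · rw [← cancel_epi (f.app x)]
      rw [← f.naturality, h2, Linear.smul_comp, Linear.comp_smul, f.naturality]
    · have := h3 x
      exact Module.Finite.of_surjective (f.app x).hom (epi_app_surjective f x)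
    · exact h4.mono fun y hy => ⟨hy.1, have := hy.2; (epi_app_surjective f y).nontrivial⟩

theorem isFDModule_of_isZero {M : A ⥤ ModuleCat.{v} k} (hM : IsZero M) : isFDModule k A M := by
  have h : ∀ x, Subsingleton (M.obj x) := fun x =>
    ModuleCat.isZero_iff_subsingleton.1 (((evaluation A (ModuleCat.{v} k)).obj x).map_isZero hM)
  have h' : ∀ x y (f g : M.obj x ⟶ M.obj y), f = g := fun x y f g => by
    ext a
    exact (h y).elim _ _
  refine ⟨⟨h' _ _ _ _⟩, fun _ _ => h' _ _ _ _, fun x => have := h x; inferInstance, ?_⟩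
  refine Set.Finite.subset Set.finite_empty ?_
  rintro c ⟨y, ⟨-, hy⟩, -⟩
  exact (not_nontrivial_iff_subsingleton.2 (h y) hy).elim

instance : (isFDModule k A).ContainsZero :=
  ⟨⟨_, isZero_zero _, isFDModule_of_isZero k A (isZero_zero _)⟩⟩

theorem isFDModule_biprod {M N : A ⥤ ModuleCat.{v} k} (hM : isFDModule k A M)
    (hN : isFDModule k A N) : isFDModule k A (M ⊞ N) := by
  obtain ⟨h1, h2, h3, h4⟩ := hM
  obtain ⟨l1, l2, l3, l4⟩ := hN
  have tot : ∀ y, (biprod.fst : M ⊞ N ⟶ M).app y ≫ (biprod.inl : M ⟶ M ⊞ N).app y +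
      (biprod.snd : M ⊞ N ⟶ N).app y ≫ (biprod.inr : N ⟶ M ⊞ N).app y = 𝟙 _ := fun y => by
    rw [← NatTrans.comp_app, ← NatTrans.comp_app, ← NatTrans.app_add, biprod.total,
      NatTrans.id_app]
  have ext' : ∀ {y} {X : ModuleCat.{v} k} (f g : X ⟶ (M ⊞ N).obj y),
      f ≫ (biprod.fst : M ⊞ N ⟶ M).app y = g ≫ (biprod.fst : M ⊞ N ⟶ M).app y →
      f ≫ (biprod.snd : M ⊞ N ⟶ N).app y = g ≫ (biprod.snd : M ⊞ N ⟶ N).app y → f = g := by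
    intro y X f g e1 e2
    rw [← Category.comp_id f, ← Category.comp_id g, ← tot, Preadditive.comp_add,
      Preadditive.comp_add, reassoc_of% e1, reassoc_of% e2]
  have inj : ∀ y, Function.Injective fun a : (M ⊞ N).obj y =>
      ((biprod.fst : M ⊞ N ⟶ M).app y a, (biprod.snd : M ⊞ N ⟶ N).app y a) := by
    intro y a b hab
    obtain ⟨e1, e2⟩ := Prod.mk.inj hab
    have := tot y
    have ha := congrArg (fun t => t.hom a) this
    have hb := congrArg (fun t => t.hom b) this
    simp only [ModuleCat.hom_add, ModuleCat.hom_comp, LinearMap.add_apply, LinearMap.comp_apply,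
      ModuleCat.hom_id, LinearMap.id_apply] at ha hb
    rw [← ha, ← hb, e1, e2]
  refine ⟨⟨fun {x y a b} => ?_⟩, fun {x y} a c => ?_, fun x => ?_, ?_⟩
  · apply ext'
    · rw [NatTrans.naturality, h1.map_add, Preadditive.add_comp, Preadditive.comp_add,
        NatTrans.naturality, NatTrans.naturality]
    · rw [NatTrans.naturality, l1.map_add, Preadditive.add_comp, Preadditive.comp_add,
        NatTrans.naturality, NatTrans.naturality]
  · apply ext'
    · rw [NatTrans.naturality, h2, Linear.smul_comp, Linear.comp_smul, NatTrans.naturality]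
    · rw [NatTrans.naturality, l2, Linear.smul_comp, Linear.comp_smul, NatTrans.naturality]
  · have := h3 x
    have := l3 x
    exact Module.Finite.of_injective
      (LinearMap.prod ((biprod.fst : M ⊞ N ⟶ M).app x).hom
        ((biprod.snd : M ⊞ N ⟶ N).app x).hom) (inj x)
  · refine Set.Finite.subset (Set.Finite.union h4 l4) ?_
    rintro c ⟨y, ⟨hy, hy'⟩, rfl⟩
    by_cases hM : Nontrivial (M.obj y)
    · exact Or.inl ⟨y, ⟨hy, hM⟩, rfl⟩
    · refine Or.inr ⟨y, ⟨hy, ?_⟩, rfl⟩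
      have := not_nontrivial_iff_subsingleton.1 hM
      by_contra hN
      have := not_nontrivial_iff_subsingleton.1 hN
      exact not_nontrivial_iff_subsingleton.2 (inj y).subsingleton hy'

instance : (isFDModule k A).IsClosedUnderBinaryProducts where
  limitsOfShape_le := by
    rintro X ⟨p⟩
    have hM := p.prop_diag_obj ⟨WalkingPair.left⟩
    have hN := p.prop_diag_obj ⟨WalkingPair.right⟩
    refine (isFDModule k A).prop_of_iso ?_ (isFDModule_biprod k A hM hN)
    exact (IsLimit.conePointsIsoOfNatIso (BinaryBiproduct.isLimit _ _) p.isLimit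
      (diagramIsoPair p.diag).symm)

instance : (isFDModule k A).IsClosedUnderFiniteProducts :=
  ObjectProperty.IsClosedUnderFiniteProducts.mk'

instance : HasFiniteBiproducts (FDModule k A) := HasFiniteBiproducts.of_hasFiniteProducts

/-! ### The quiver of `A` and the unrolled quiver -/

/-- The quiver of a category with radical square zero. Its vertices are a set of representatives of
the isomorphism classes of indecomposable objects, and the arrows `x ⟶ y` are a basis of
`rad(x, y) / rad²(x, y)`, which is `rad(x, y)` because `rad² = 0`. -/
structure QuiverOf where
  /-- vertices -/
  V : Type w₁
  /-- the object represented by a vertex -/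
  pt : V → A
  indec : ∀ x, IsIndec (pt x)
  eq_of_iso : ∀ x y, Nonempty (pt x ≅ pt y) → x = y
  exists_iso : ∀ X : A, IsIndec X → ∃ x, Nonempty (pt x ≅ X)
  /-- arrows -/
  Arr : V → V → Type w₂
  /-- the arrows as radical morphisms -/
  basis : ∀ x y, Module.Basis (Arr x y) k (rad k (pt x) (pt y))

/-- A quiver of `A` exists. -/
theorem QuiverOf.nonempty [IsLofd k A] : Nonempty (QuiverOf.{w, v, u, u, 0} k A) := by
  classical
  have := IsLofd.finite_hom (k := k) (A := A)
  let V := {c : Quotient (isIsomorphicSetoid A) // IsIndec c.out}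
  exact ⟨{ V := V
           pt := fun c => c.1.out
           indec := fun c => c.2
           eq_of_iso := fun c d h => Subtype.ext (by
            rw [← Quotient.out_eq c.1, ← Quotient.out_eq d.1]
            exact Quotient.sound h)
           exists_iso := fun X hX => by
            have e : Nonempty ((Quotient.mk (isIsomorphicSetoid A) X).out ≅ X) :=
              Quotient.exact (Quotient.out_eq (Quotient.mk (isIsomorphicSetoid A) X))
            refine ⟨⟨Quotient.mk _ X, fun h => hX.1 (h.of_iso e.some.symm), ?_⟩, e⟩
            rintro Y Z b hb ⟨i⟩
            exact hX.2 Y Z b hb ⟨e.some.symm ≪≫ i⟩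
           Arr := fun c d => Fin (Module.finrank k (rad k c.1.out d.1.out))
           basis := fun c d => Module.finBasis k _ }⟩

variable {k A}

namespace QuiverOf

variable (Q : QuiverOf.{w, v, u, w₁, w₂} k A)

/-- The morphism of `A` given by an arrow. -/
def mor {x y : Q.V} (α : Q.Arr x y) : Q.pt x ⟶ Q.pt y := (Q.basis x y α : Q.pt x ⟶ Q.pt y)

theorem isRadical_mor {x y : Q.V} (α : Q.Arr x y) : IsRadical (Q.mor α) := (Q.basis x y α).2

instance finite_arr [IsLofd k A] (x y : Q.V) : Finite (Q.Arr x y) := by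
  have := IsLofd.finite_hom (k := k) (Q.pt x) (Q.pt y)
  exact Module.Finite.finite_basis (Q.basis x y)

/-- The vertices `Q₀ × ℤ` of the unrolled quiver. -/
def Box : Type w₁ := Q.V × ℤ

/-- The arrows of the unrolled quiver: an arrow `α : a ⟶ b` of the quiver and an integer `i` give
an arrow `(α, i) : (b, i) ⟶ (a, i - 1)`. -/
instance : Quiver.{w₂} Q.Box where
  Hom p q := {_α : Q.Arr q.1 p.1 // q.2 = p.2 - 1}

/-- The arrow `(α, n) : (y, n) ⟶ (x, m)`, where `m = n - 1`. -/
def boxArr {x y : Q.V} (α : Q.Arr x y) (n m : ℤ) (h : m = n - 1) :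
    (show Q.Box from (y, n)) ⟶ (show Q.Box from (x, m)) := ⟨α, h⟩

/-- Finite dimensional representations of the unrolled quiver, among all its representations
(functors on its path category): all spaces are finite dimensional and almost all are zero. -/
def isFDRep : ObjectProperty (Paths Q.Box ⥤ ModuleCat.{v} k) := fun M =>
  (∀ p, Module.Finite k (M.obj p)) ∧ {p | Nontrivial (M.obj p)}.Finite

/-- The category of finite dimensional representations of the unrolled quiver. -/
abbrev FDRep := Q.isFDRep.FullSubcategory

variable {Q} in
/-- The vector space `M(x, n)`. -/
def FDRep.sp (M : Q.FDRep) (x : Q.V) (n : ℤ) : ModuleCat.{v} k :=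
  M.obj.obj ((Paths.of Q.Box).obj (x, n))

variable {Q} in
/-- The linear map `M(α, n) : M(y, n) → M(x, n - 1)` for an arrow `α : x ⟶ y`. -/
def FDRep.lin (M : Q.FDRep) {x y : Q.V} (α : Q.Arr x y) (n m : ℤ) (h : m = n - 1) :
    M.sp y n →ₗ[k] M.sp x m :=
  (M.obj.map ((Paths.of Q.Box).map (Q.boxArr α n m h))).hom

theorem FDRep.finite_sp {Q : QuiverOf.{w, v, u, w₁, w₂} k A} (M : FDRep.{w, v, u, w₁, w₂} Q)
    (x : Q.V) (n : ℤ) : Module.Finite k (M.sp x n) :=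
  M.property.1 _

end QuiverOf

/-! ### The complex `F(M)` -/

/-- The module `A^X ⊗ W : z ↦ A(X, z) ⊗ W`, for an object `X` and a finite dimensional space `W`. -/
@[simps obj]
def tens [IsLofd k A] (X : A) (W : ModuleCat.{v} k) (hW : Module.Finite k W) : FDModule k A where
  obj :=
    { obj := fun z => ModuleCat.of k ((X ⟶ z) ⊗[k] W)
      map := fun f => ModuleCat.ofHom (LinearMap.rTensor W (Linear.rightComp k X f))
      map_id := fun z => by
        ext : 1
        refine TensorProduct.ext' fun f w => ?_
        simp
      map_comp := fun f g => by
        ext : 1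
        refine TensorProduct.ext' fun f w => ?_
        simp }
  property := by
    refine ⟨⟨fun {x y f g} => ?_⟩, fun {x y} f c => ?_, fun x => ?_, ?_⟩
    · ext : 1
      refine TensorProduct.ext' fun h w => ?_
      simp [TensorProduct.add_tmul]
    · ext : 1
      refine TensorProduct.ext' fun h w => ?_
      simp [TensorProduct.smul_tmul']
    · have := IsLofd.finite_hom (k := k) X x
      change Module.Finite k ((X ⟶ x) ⊗[k] W)
      infer_instance
    · refine (IsLofd.finite_neighbours (k := k) X).mono fun y hy => ⟨hy.1, Or.inl ?_⟩
      by_contra h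
      have := not_nontrivial_iff_subsingleton.1 h
      have h2 : Subsingleton ((X ⟶ y) ⊗[k] W) := inferInstance
      exact not_nontrivial_iff_subsingleton.2 h2 hy.2

/-- The homomorphism `A^α ⊗ φ : A^Y ⊗ W → A^X ⊗ W'` given by `f ⊗ w ↦ (f ∘ α) ⊗ φ(w)`, for a
morphism `α : X ⟶ Y` and a linear map `φ : W → W'`. -/
def tensMap [IsLofd k A] {X Y : A} (α : X ⟶ Y) {W W' : ModuleCat.{v} k}
    (hW : Module.Finite k W) (hW' : Module.Finite k W') (φ : W →ₗ[k] W') :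
    tens Y W hW ⟶ tens X W' hW' :=
  ObjectProperty.homMk
    { app := fun z => ModuleCat.ofHom (TensorProduct.map (Linear.leftComp k z α) φ)
      naturality := fun z z' g => by
        ext : 1
        refine TensorProduct.ext' fun f a => ?_
        change (α ≫ f ≫ g) ⊗ₜ[k] φ a = ((α ≫ f) ≫ g) ⊗ₜ[k] φ a
        rw [Category.assoc] }

theorem tensMap_comp_eq_zero [IsLofd k A] {X Y Z : A} (α : X ⟶ Y) (β : Y ⟶ Z)
    {W W' W'' : ModuleCat.{v} k} (hW : Module.Finite k W) (hW' : Module.Finite k W')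
    (hW'' : Module.Finite k W'') (φ : W →ₗ[k] W') (ψ : W' →ₗ[k] W'') (h : α ≫ β = 0) :
    tensMap β hW hW' φ ≫ tensMap α hW' hW'' ψ = 0 := by
  ext z : 4
  have key : TensorProduct.map (Linear.leftComp k z α) ψ ∘ₗ
      TensorProduct.map (Linear.leftComp k z β) φ = 0 := by
    refine TensorProduct.ext' fun f a => ?_
    simp [reassoc_of% h]
  exact key

namespace QuiverOf

variable {Q : QuiverOf.{w, v, u, w₁, w₂} k A} (M : FDRep.{w, v, u, w₁, w₂} Q)

/-- The finite set of vertices `x` with `M(x, n) ≠ 0`. -/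
def supp (n : ℤ) : Set Q.V := {x | Nontrivial (M.sp x n)}

theorem finite_supp (n : ℤ) : Finite (supp M n) := by
  refine (Set.Finite.of_finite_image (f := fun x : Q.V => (show Paths Q.Box from (x, n)))
    (M.property.2.subset ?_) ?_).to_subtype
  · rintro _ ⟨x, hx, rfl⟩
    exact hx
  · intro x _ y _ e
    exact congrArg Prod.fst e

instance (n : ℤ) : Finite (supp M n) := finite_supp M n

variable [IsLofd k A]

/-- The projective module `Pₙ = ⨁ₓ A^x ⊗ M(x, n)`; the sum is over the vertices with
`M(x, n) ≠ 0`, the other summands being zero. -/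
def FObj (n : ℤ) : FDModule k A :=
  ⨁ fun x : supp M n => tens (Q.pt x) (M.sp x n) (M.finite_sp x n)

/-- The component `∑_α A^α ⊗ M(α, n) : A^y ⊗ M(y, n) → A^x ⊗ M(x, n - 1)` of the differential, the
sum being over the arrows `α : x ⟶ y`. -/
def FComp (n m : ℤ) (h : m = n - 1) (y x : Q.V) :
    tens (Q.pt y) (M.sp y n) (M.finite_sp y n) ⟶ tens (Q.pt x) (M.sp x m) (M.finite_sp x m) :=
  letI := Fintype.ofFinite (Q.Arr x y)
  ∑ α : Q.Arr x y, tensMap (Q.mor α) _ _ (M.lin α n m h)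

/-- The differential `dₙ : Pₙ → Pₙ₋₁`. -/
def FD (n m : ℤ) (h : m = n - 1) : FObj M n ⟶ FObj M m :=
  biproduct.desc fun y => biproduct.lift fun x => FComp M n m h y x

theorem FD_comp [HasRadicalSquareZero A] (n m l : ℤ) (h : m = n - 1) (h' : l = m - 1) :
    FD M n m h ≫ FD M m l h' = 0 := by
  refine desc_lift_comp_eq_zero _ _ fun z y x => ?_
  simp only [FComp, Preadditive.sum_comp, Preadditive.comp_sum]
  refine Finset.sum_eq_zero fun α _ => Finset.sum_eq_zero fun β _ => ?_
  exact tensMap_comp_eq_zero _ _ _ _ _ _ _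
    (HasRadicalSquareZero.comp_eq_zero _ _ (Q.isRadical_mor _) (Q.isRadical_mor _))

/-- The complex `F(M)`. As a cochain complex, it has `Pₙ` in degree `-n`. -/
def F [HasRadicalSquareZero A] : CochainComplex (FDModule k A) ℤ where
  X i := FObj M (-i)
  d i j := if h : i + 1 = j then FD M (-i) (-j) (by omega) else 0
  shape i j h := dif_neg h
  d_comp_d' i j l h h' := by
    simp only [ComplexShape.up_Rel] at h h'
    rw [dif_pos h, dif_pos h', FD_comp]

theorem isZero_FObj (n : ℤ) (h : ∀ x, ¬ Nontrivial (M.sp x n)) : IsZero (FObj M n) := by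
  have : IsEmpty (supp M n) := ⟨fun x => h _ x.2⟩
  rw [IsZero.iff_id_eq_zero]
  exact biproduct.hom_ext' _ _ fun x => isEmptyElim x

end QuiverOf

/-! ### Complexes of projective modules -/

section Complexes

variable [IsLofd k A]

/-- A complex is (two-sided) bounded. -/
def IsBoundedCx (K : CochainComplex (FDModule k A) ℤ) : Prop :=
  (∃ a, K.IsStrictlyGE a) ∧ ∃ b, K.IsStrictlyLE b

theorem QuiverOf.isBoundedCx_F [HasRadicalSquareZero A] {Q : QuiverOf.{w, v, u, w₁, w₂} k A}
    (M : FDRep.{w, v, u, w₁, w₂} Q) : IsBoundedCx (QuiverOf.F M) := by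
  have hfin : (Prod.snd '' (show Set (Q.V × ℤ) from {p | Nontrivial (M.obj.obj p)})).Finite :=
    M.property.2.image _
  have hz : ∀ n, n ∉ (Prod.snd '' (show Set (Q.V × ℤ) from {p | Nontrivial (M.obj.obj p)})) →
      IsZero (QuiverOf.FObj M n) := fun n hn =>
    QuiverOf.isZero_FObj M n fun x hx => hn ⟨(x, n), hx, rfl⟩
  obtain ⟨a, ha⟩ := hfin.bddBelow
  obtain ⟨b, hb⟩ := hfin.bddAbove
  refine ⟨⟨-b, ?_⟩, ⟨-a, ?_⟩⟩
  · rw [CochainComplex.isStrictlyGE_iff]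
    intro i hi
    exact hz _ fun h => by have := hb h; omega
  · rw [CochainComplex.isStrictlyLE_iff]
    intro i hi
    exact hz _ fun h => by have := ha h; omega

/-- A complex of finite dimensional modules is minimal if the image of each differential lies in the
radical of its target, that is, in all maximal submodules of the target. -/
def IsMinimalCx (K : CochainComplex (FDModule k A) ℤ) : Prop :=
  ∀ (i j : ℤ) (S : Subobject (K.X j)), IsCoatom S → S.Factors (K.d i j)

variable (k A) in
/-- Minimal bounded complexes of projective modules. -/
def isMinBounded : ObjectProperty (CochainComplex (FDModule k A) ℤ) := fun K =>
  IsBoundedCx K ∧ (∀ i, Projective (K.X i)) ∧ IsMinimalCx K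

variable (k A) in
/-- The category of minimal bounded complexes of projective modules. -/
abbrev PMin := (isMinBounded k A).FullSubcategory

/-- `P` is a minimal projective resolution of the complex `K`: a right bounded minimal complex of
projective modules with a quasi-isomorphism to `K`. -/
def IsMinProjResolution (P K : CochainComplex (FDModule k A) ℤ) : Prop :=
  (∃ b, P.IsStrictlyLE b) ∧ (∀ i, Projective (P.X i)) ∧ IsMinimalCx P ∧
    ∃ f : P ⟶ K, QuasiIso f

/-- For a nonzero bounded complex `K`, written homologically `Pₙ = K^{-n}`, let `t` be the minimal
number with `Pₙ = 0` for `n > t`; this is `-t`, the largest `p` with `K^i = 0` for `i < p`. -/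
def bottom (K : CochainComplex (FDModule k A) ℤ) : ℤ := sSup {p : ℤ | K.IsStrictlyGE p}

/-- The complex `0 → Ker d^p → K^p → K^{p+1} → ⋯` with `K^p` in degree `p`. -/
def truncAt (K : CochainComplex (FDModule k A) ℤ) (p : ℤ) : CochainComplex (FDModule k A) ℤ :=
  HomologicalComplex.extend
    (CochainComplex.augment (K.restriction (ComplexShape.embeddingUpIntGE p))
      (kernel.ι ((K.restriction (ComplexShape.embeddingUpIntGE p)).d 0 1)) (kernel.condition _))
    (ComplexShape.embeddingUpIntGE (p - 1))

/-- The truncation `β(K)`: with `t` as above, `β(K)ₙ` is `Pₙ` for `n ≤ t`, the kernel of `dₜ` for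
`n = t + 1`, and zero otherwise, with the differentials of `K` and the inclusion of the kernel. -/
def beta (K : CochainComplex (FDModule k A) ℤ) : CochainComplex (FDModule k A) ℤ :=
  truncAt K (bottom K)

theorem isBoundedCx_truncAt {K : CochainComplex (FDModule k A) ℤ} (hK : IsBoundedCx K) (p : ℤ) :
    IsBoundedCx (truncAt K p) := by
  obtain ⟨-, b, hb⟩ := hK
  refine ⟨⟨p - 1, by unfold truncAt; infer_instance⟩, max b (p - 1), ?_⟩
  rw [CochainComplex.isStrictlyLE_iff]
  intro i hi
  obtain ⟨n, hn⟩ : ∃ n : ℕ, (ComplexShape.embeddingUpIntGE (p - 1)).f (n + 1) = i := by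
    refine ⟨(i - p).toNat, ?_⟩
    simp only [ComplexShape.embeddingUpIntGE_f]
    omega
  refine IsZero.of_iso ?_ (HomologicalComplex.extendXIso _ _ hn)
  refine K.isZero_of_isStrictlyLE b (p + n) ?_
  simp only [ComplexShape.embeddingUpIntGE_f] at hn
  omega

/-- Indecomposable minimal bounded complexes `N` of projectives such that the minimal projective
resolution of `β(N)` is not bounded. -/
def XBar (N : PMin k A) : Prop :=
  IsIndec N ∧ ∃ P, IsMinProjResolution P (beta N.obj) ∧ ¬ IsBoundedCx P

/-- The relation on `XBar`: the minimal projective resolutions of `β(N)` and `β(N')` are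
isomorphic in the homotopy category. -/
def XRel (N N' : PMin k A) : Prop :=
  ∃ P P', IsMinProjResolution P (beta N.obj) ∧ IsMinProjResolution P' (beta N'.obj) ∧
    Nonempty (HomotopyEquiv P P')

/-- `𝒳` is a set of representatives of `XBar` modulo `XRel`. -/
def IsRepresentatives (𝒳 : Set (PMin k A)) : Prop :=
  (∀ N ∈ 𝒳, XBar N) ∧ ∀ N, XBar N → ∃! N', N' ∈ 𝒳 ∧ XRel N N'

/-! ### The bounded derived category -/

variable [HasDerivedCategory.{w₃} (FDModule k A)]

variable (k A) in
/-- The bounded derived category of the category of finite dimensional `A`-modules. -/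
abbrev Db := DerivedCategory.Bounded (FDModule k A)

/-- A bounded complex as an object of the bounded derived category. -/
def toDb (K : CochainComplex (FDModule k A) ℤ) (hK : IsBoundedCx K) : Db k A where
  obj := DerivedCategory.Q.obj K
  property := by
    obtain ⟨⟨a, ha⟩, b, hb⟩ := hK
    exact ⟨⟨a, inferInstance⟩, ⟨b, inferInstance⟩⟩

/-- The complex `β(N)` as an object of the bounded derived category. -/
def betaDb (N : PMin k A) : Db k A := toDb (beta N.obj) (isBoundedCx_truncAt N.property.1 _)

/-- The complex `F(M)` as an object of the bounded derived category. -/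
def FDb [HasRadicalSquareZero A] {Q : QuiverOf.{w, v, u, w₁, w₂} k A}
    (M : QuiverOf.FDRep.{w, v, u, w₁, w₂} Q) : Db k A :=
  toDb (QuiverOf.F M) (QuiverOf.isBoundedCx_F M)

end Complexes

end RadSq

end

/-!
The theorem rests on minimal projective resolutions. Every object of `D^b(A)` is isomorphic to a
right bounded complex `P` of projectives with radical differentials (`exists_minRes_toDb`), and `P`
is unique up to isomorphism of complexes: a homotopy between maps of such complexes changes each
component by a radical map only, so that homotopy equivalences are isomorphisms
(`exists_iso_of_Q_iso`). The indecomposable objects therefore fall into two classes, according to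
whether `P` is bounded or not; the first class consists of the `F(M)`, the second of the `β(N)`, and
they do not meet.

*Bounded resolutions.* Every projective module is a direct sum of modules `A^x ⊗ W`
(`nonempty_iso_tsum_topAt`), and a radical map between such sums is a matrix with entries `∑_α A^α ⊗
φ_α` for unique linear maps `φ_α` (`exists_eq_arrSum_of_isRadical`). As the composite of two radical
maps vanishes, the condition `d² = 0` is void, so a bounded minimal complex of projectives is the
same thing as a representation of the unrolled quiver (`exists_iso_F`). A map `F(M) ⟶ F(M')` is,
modulo the radical, given by linear maps `M(x, n) → M'(x, n)`. Radical perturbations do not affect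
composites with the differentials, so these linear maps form a homomorphism of representations: `F`
is full modulo the radical (`exists_FMap`). It is also faithful modulo the radical
(`eq_zero_of_isRadical_FMap`). Hence `F` preserves and reflects isomorphism and indecomposability,
also after passage to the derived category.

*Unbounded resolutions.* Suppose that `P` is unbounded, and choose a degree `p` so low that `P` is
exact in degrees `≤ p` and `P^p ≠ 0`. The brutal truncation `N` of `P` in degrees `≥ p` is a bounded
minimal complex of projectives, and `P ⟶ β(N)` is a quasi-isomorphism (`exists_xBar`). It remains to
compare `N` with `β(N)` as regards indecomposability. Both directions use that the differential of
`β(N)` on the added kernel is radical, so that quasi-isomorphisms involving `P` and `β(N)` are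
isomorphisms in degrees `≥ p`. If `β(N)` is indecomposable in `D^b(A)`, an idempotent of `N` extends
to one of `β(N)`, which is trivial in the derived category, and hence it is trivial itself. If `N`
is indecomposable, its endomorphism ring is local by Fitting's lemma, and an idempotent of `β(N)` in
the derived category restricts to an endomorphism of `N`, which is invertible or has invertible
complement (`idem_of_local`). Equivalence of `N` and `N'` is by definition isomorphism of the
minimal resolutions, that is, isomorphism of `β(N)` and `β(N')` in `D^b(A)`.
-/

open scoped ZeroObject

noncomputable section

namespace RadSq

/-! ### Radical morphisms -/

section Radical

variable {C : Type u} [Category.{v} C] [Preadditive C]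

theorem isRadical_zero (X Y : C) : IsRadical (0 : X ⟶ Y) := fun g => by
  simpa using (inferInstance : IsIso (𝟙 X))

theorem IsRadical.comp_right {X Y Z : C} {f : X ⟶ Y} (hf : IsRadical f) (g : Y ⟶ Z) :
    IsRadical (f ≫ g) := fun h => by
  simpa using hf (g ≫ h)

theorem IsRadical.comp_left {X Y Z : C} {f : Y ⟶ Z} (hf : IsRadical f) (g : X ⟶ Y) :
    IsRadical (g ≫ f) := fun h => by
  simpa using hf.isIso' h g

theorem IsRadical.add {X Y : C} {f₁ f₂ : X ⟶ Y} (h₁ : IsRadical f₁) (h₂ : IsRadical f₂) :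
    IsRadical (f₁ + f₂) := fun g => by
  have i₁ := h₁ g
  have i₂ := h₂.isIso' g (inv (𝟙 X - f₁ ≫ g))
  have : 𝟙 X - (f₁ + f₂) ≫ g =
      (𝟙 X - f₁ ≫ g) ≫ (𝟙 X - inv (𝟙 X - f₁ ≫ g) ≫ f₂ ≫ g) := by
    rw [Preadditive.comp_sub, IsIso.hom_inv_id_assoc]
    simp only [Preadditive.add_comp, Category.comp_id]
    abel
  rw [this]
  infer_instance

theorem IsRadical.neg {X Y : C} {f : X ⟶ Y} (h : IsRadical f) : IsRadical (-f) := by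
  simpa using h.comp_right (-𝟙 Y)

theorem IsRadical.sub {X Y : C} {f₁ f₂ : X ⟶ Y} (h₁ : IsRadical f₁) (h₂ : IsRadical f₂) :
    IsRadical (f₁ - f₂) := by
  rw [sub_eq_add_neg]
  exact h₁.add h₂.neg

theorem isRadical_sum {X Y : C} {ι : Type*} (s : Finset ι) (f : ι → (X ⟶ Y))
    (h : ∀ i ∈ s, IsRadical (f i)) : IsRadical (∑ i ∈ s, f i) := by
  classical
  induction s using Finset.induction_on with
  | empty => simpa using isRadical_zero X Y
  | insert a s ha ih =>
    rw [Finset.sum_insert ha]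
    exact (h a (by simp)).add (ih fun i hi => h i (by simp [hi]))

/-- The set of isomorphisms is stable under radical perturbations. -/
theorem IsRadical.isIso_add {X Y : C} {r : X ⟶ Y} (hr : IsRadical r) (f : X ⟶ Y) [IsIso f] :
    IsIso (f + r) := by
  have h := hr (-inv f)
  have : f + r = (𝟙 X - r ≫ (-inv f)) ≫ f := by simp [Preadditive.add_comp]
  rw [this]
  infer_instance

theorem IsRadical.isIso_of_sub {X Y : C} {f g : X ⟶ Y} (hr : IsRadical (g - f)) [IsIso f] :
    IsIso g := by
  have := hr.isIso_add f
  simpa using this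

/-- It suffices to test radicality on the other side. -/
theorem isRadical_of_isIso {X Y : C} {f : X ⟶ Y} (h : ∀ g : Y ⟶ X, IsIso (𝟙 Y - g ≫ f)) :
    IsRadical f := fun g => by
  have := h g
  set u := inv (𝟙 Y - g ≫ f) with hu
  have h1 : (𝟙 Y - g ≫ f) ≫ u = 𝟙 Y := IsIso.hom_inv_id _
  have h2 : u ≫ (𝟙 Y - g ≫ f) = 𝟙 Y := IsIso.inv_hom_id _
  simp only [Preadditive.sub_comp, Preadditive.comp_sub, Category.id_comp, Category.comp_id,
    Category.assoc] at h1 h2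
  have h1' : g ≫ f ≫ u = u - 𝟙 Y := by rw [← h1]; abel
  have h2' : u ≫ g ≫ f = u - 𝟙 Y := by rw [← h2]; abel
  refine ⟨𝟙 X + f ≫ u ≫ g, ?_, ?_⟩
  · have : f ≫ (g ≫ f ≫ u) ≫ g = f ≫ u ≫ g - f ≫ g := by
      rw [h1']; simp
    simp only [Category.assoc] at this
    simp [this]
  · have : f ≫ (u ≫ g ≫ f) ≫ g = f ≫ u ≫ g - f ≫ g := by
      rw [h2']; simp
    simp only [Category.assoc] at this
    simp [this]

theorem IsRadical.eq_zero_of_idem {X : C} {e : X ⟶ X} (h : IsRadical e) (he : e ≫ e = e) :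
    e = 0 := by
  have := h (𝟙 X)
  rw [Category.comp_id] at this
  rw [← cancel_mono (𝟙 X - e)]
  simp [he]

theorem eq_id_of_idem_of_isIso {C : Type u} [Category.{v} C] {X : C} {e : X ⟶ X} (he : e ≫ e = e)
    [IsIso e] : e = 𝟙 X := by
  rw [← cancel_mono e, he, Category.id_comp]

theorem isIso_one_sub_of_sq {X : C} {f : X ⟶ X} (h : f ≫ f = 0) : IsIso (𝟙 X - f) :=
  ⟨𝟙 X + f, by simp [h], by simp [h]⟩

end Radical

/-! ### Indecomposable objects and idempotents -/

section Idempotents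

variable {C : Type u} [Category.{v} C] [Preadditive C]

theorem isIndec_of_idem {X : C} (h0 : ¬ IsZero X)
    (h : ∀ e : X ⟶ X, e ≫ e = e → e = 0 ∨ e = 𝟙 X) : IsIndec X := by
  refine ⟨h0, fun Y Z b ⟨hb⟩ ⟨i⟩ => ?_⟩
  have hY : b.inl ≫ i.inv ≫ i.hom ≫ b.fst = 𝟙 Y := by simp
  have hZ : b.inr ≫ i.inv ≫ i.hom ≫ b.snd = 𝟙 Z := by simp
  have hYZ : b.inr ≫ i.inv ≫ i.hom ≫ b.fst = 0 := by simp
  rcases h (i.hom ≫ b.fst ≫ b.inl ≫ i.inv) (by simp) with h | h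
  · left
    rw [IsZero.iff_id_eq_zero]
    have := congrArg (fun t => b.inl ≫ i.inv ≫ t ≫ i.hom ≫ b.fst) h
    simpa using this
  · right
    rw [IsZero.iff_id_eq_zero]
    have := congrArg (fun t => b.inr ≫ i.inv ≫ t ≫ i.hom ≫ b.snd) h
    simp only [Category.assoc, Category.id_comp, hZ, reassoc_of% hYZ, zero_comp] at this
    exact this.symm

/-- An indecomposable object is not the direct sum of the images of two split orthogonal
idempotents, unless one of them vanishes. -/
theorem IsIndec.eq_zero_or_of_split {X Y Z : C} (hX : IsIndec X) {e e' : X ⟶ X}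
    (he : e + e' = 𝟙 X)
    {p : X ⟶ Y} {i : Y ⟶ X} (hip : i ≫ p = 𝟙 Y) (hpi : p ≫ i = e)
    {q : X ⟶ Z} {j : Z ⟶ X} (hjq : j ≫ q = 𝟙 Z) (hqj : q ≫ j = e') :
    e = 0 ∨ e' = 0 := by
  have hee : e ≫ e = e := by simp [← hpi, reassoc_of% hip]
  have h1 : e ≫ e' = 0 := by
    have : e' = 𝟙 X - e := by rw [← he]; abel
    simp [this, hee]
  have h2 : e' ≫ e = 0 := by
    have : e' = 𝟙 X - e := by rw [← he]; abel
    simp [this, hee]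
  have hiq : i ≫ q = 0 := by
    have : i ≫ (e ≫ e') ≫ q = i ≫ q := by
      simp [← hpi, ← hqj, reassoc_of% hip, hjq]
    rw [← this, h1]; simp
  have hjp : j ≫ p = 0 := by
    have : j ≫ (e' ≫ e) ≫ p = j ≫ p := by
      simp [← hpi, ← hqj, reassoc_of% hjq, hip]
    rw [← this, h2]; simp
  let b : BinaryBicone Y Z :=
    { pt := X, fst := p, snd := q, inl := i, inr := j, inl_fst := hip, inl_snd := hiq
      inr_fst := hjp, inr_snd := hjq }
  have hb : b.IsBilimit := isBinaryBilimitOfTotal b (by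
    change p ≫ i + q ≫ j = 𝟙 X
    rw [hpi, hqj, he])
  rcases hX.2 Y Z b ⟨hb⟩ ⟨Iso.refl _⟩ with h | h
  · left; rw [← hpi, h.eq_of_src i 0, comp_zero]
  · right; rw [← hqj, h.eq_of_src j 0, comp_zero]

theorem IsIndec.idem [IsIdempotentComplete C] {X : C} (hX : IsIndec X) (e : X ⟶ X)
    (he : e ≫ e = e) : e = 0 ∨ e = 𝟙 X := by
  obtain ⟨Y, i, p, hip, hpi⟩ := IsIdempotentComplete.idempotents_split X e he
  obtain ⟨Z, j, q, hjq, hqj⟩ := IsIdempotentComplete.idempotents_split X (𝟙 X - e)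
    (by simp [he])
  rcases hX.eq_zero_or_of_split (by abel) hip hpi hjq hqj with h | h
  · exact Or.inl h
  · exact Or.inr (sub_eq_zero.1 h).symm

theorem IsIndec.of_iso {X Y : C} (hX : IsIndec X) (e : X ≅ Y) : IsIndec Y :=
  ⟨fun h => hX.1 (h.of_iso e), fun Z W b hb ⟨i⟩ => hX.2 Z W b hb ⟨e ≪≫ i⟩⟩

end Idempotents

/-! ### Finite dimensional endomorphism algebras -/

section Fitting

/-- Fitting's lemma in a finite dimensional algebra: some power `hⁿ` is strongly regular, and
`hⁿ c` is the idempotent of the Fitting decomposition. -/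
theorem exists_pow_eq_pow_mul (k : Type*) {E : Type*} [Field k] [Ring E] [Algebra k E]
    [Module.Finite k E] (h : E) :
    ∃ n : ℕ, 1 ≤ n ∧ ∃ c : E, Commute h c ∧ h ^ n = h ^ n * h ^ n * c := by
  have hint : IsIntegral k h := Algebra.IsIntegral.isIntegral h
  have hm0 : minpoly k h ≠ 0 := minpoly.ne_zero hint
  obtain ⟨r, hr, hr0⟩ := Polynomial.exists_eq_pow_rootMultiplicity_mul_and_not_dvd _ hm0 0
  set n := Polynomial.rootMultiplicity 0 (minpoly k h)
  simp only [map_zero, sub_zero] at hr hr0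
  have hcop : IsCoprime ((Polynomial.X : Polynomial k) ^ (n + 1)) r :=
    IsCoprime.pow_left ((Polynomial.irreducible_X).coprime_iff_not_dvd.2 hr0)
  obtain ⟨a, b, hab⟩ := hcop
  refine ⟨n + 1, by omega, Polynomial.aeval h a, ?_, ?_⟩
  · have := congrArg (Polynomial.aeval h) (mul_comm Polynomial.X a)
    change _ * _ = _ * _
    simpa using this
  · have h1 := congrArg (fun t => Polynomial.aeval h (Polynomial.X ^ (n + 1) * t)) hab
    have h2 : Polynomial.aeval h (Polynomial.X ^ n * r) = 0 := by rw [← hr]; exact minpoly.aeval k h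
    have h3 : (Polynomial.X ^ (n + 1) * (a * Polynomial.X ^ (n + 1) + b * r) : Polynomial k) =
        Polynomial.X ^ (n + 1) * Polynomial.X ^ (n + 1) * a +
          Polynomial.X * b * (Polynomial.X ^ n * r) := by ring
    rw [h3] at h1
    rw [map_add, map_mul _ (_ * b), h2] at h1
    simpa using h1.symm

variable {C : Type u} [Category.{v} C] [Preadditive C] (k : Type w) [Field k] [Linear k C]

/-- A retract `Y` of `X` whose endomorphism algebra is not smaller is all of `X`. -/
theorem retract_eq_id {X Y : C} [Module.Finite k (X ⟶ X)] {i : Y ⟶ X} {p : X ⟶ Y}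
    (hip : i ≫ p = 𝟙 Y) (hle : Module.finrank k (X ⟶ X) ≤ Module.finrank k (Y ⟶ Y)) :
    p ≫ i = 𝟙 X := by
  let F : (Y ⟶ Y) →ₗ[k] (X ⟶ X) :=
    { toFun := fun f => p ≫ f ≫ i
      map_add' := by simp
      map_smul' := by simp }
  have hF : Function.Injective F := fun f g hfg => by
    have := congrArg (fun t => i ≫ t ≫ p) (show p ≫ f ≫ i = p ≫ g ≫ i from hfg)
    simpa [hip, reassoc_of% hip] using this
  have : Module.Finite k (Y ⟶ Y) := Module.Finite.of_injective F hF
  obtain ⟨f, hf⟩ := ((LinearMap.injective_iff_surjective_of_finrank_eq_finrank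
    (le_antisymm (LinearMap.finrank_le_finrank_of_injective hF) hle)).1 hF) (𝟙 X)
  have hf' : p ≫ f ≫ i = 𝟙 X := hf
  rw [← Category.comp_id (p ≫ i), ← hf']
  simp [reassoc_of% hip]

/-- If the endomorphism algebra of `X` is finite dimensional and has no nontrivial idempotents,
it is local. -/
theorem isIso_or_isIso_one_sub {X : C} [Module.Finite k (X ⟶ X)]
    (hX : ∀ e : X ⟶ X, e ≫ e = e → e = 0 ∨ e = 𝟙 X) (h : X ⟶ X) :
    IsIso h ∨ IsIso (𝟙 X - h) := by
  have : Module.Finite k (End X) := inferInstanceAs (Module.Finite k (X ⟶ X))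
  let h' : End X := h
  obtain ⟨n, hn, c, hcomm, hq⟩ := exists_pow_eq_pow_mul k (E := End X) h'
  have hc : Commute (h' ^ n) c := hcomm.pow_left n
  have he : (h' ^ n * c) * (h' ^ n * c) = h' ^ n * c := by
    calc (h' ^ n * c) * (h' ^ n * c) = h' ^ n * (c * h' ^ n) * c := by simp only [mul_assoc]
      _ = h' ^ n * h' ^ n * c * c := by rw [← hc.eq]; simp only [mul_assoc]
      _ = h' ^ n * c := by rw [← hq]
  rcases hX (h' ^ n * c) he with h0 | h1
  · right
    have h0' : h' ^ n * c = (0 : End X) := h0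
    have hn0 : h' ^ n = 0 := by rw [hq, mul_assoc, h0', mul_zero]
    have hu : IsUnit (1 - h') := IsNilpotent.isUnit_one_sub ⟨n, hn0⟩
    exact (isUnit_iff_isIso _).1 hu
  · left
    have h1' : h' ^ n * c = (1 : End X) := h1
    have hu : IsUnit (h' ^ n) := by
      refine (isUnit_iff_exists).2 ⟨c, h1', ?_⟩
      rw [← hc.eq, h1']
    exact (isUnit_iff_isIso _).1 ((isUnit_pow_iff (by omega)).1 hu)

/-- An epimorphic endomorphism is invertible if the endomorphism algebra is finite dimensional. -/
theorem isIso_of_epi_endo {X : C} [Module.Finite k (X ⟶ X)] (h : X ⟶ X) [Epi h] : IsIso h := by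
  have : Module.Finite k (End X) := inferInstanceAs (Module.Finite k (X ⟶ X))
  let h' : End X := h
  obtain ⟨n, hn, c, hcomm, hq⟩ := exists_pow_eq_pow_mul k (E := End X) h'
  have hc : Commute (h' ^ n) c := hcomm.pow_left n
  have hepi : ∀ m : ℕ, Epi (show X ⟶ X from h' ^ m) := by
    intro m
    induction m with
    | zero => exact (inferInstance : Epi (𝟙 X))
    | succ m ih =>
      have : (show X ⟶ X from h' ^ (m + 1)) = h ≫ (show X ⟶ X from h' ^ m) := pow_succ h' m
      rw [this]
      exact epi_comp _ _
  have := hepi n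
  have h1 : h' ^ n * c = (1 : End X) := by
    rw [hc.eq]
    refine (cancel_epi (show X ⟶ X from h' ^ n)).1 ?_
    change c * h' ^ n * h' ^ n = 1 * h' ^ n
    rw [← hc.eq, mul_assoc, ← hc.eq, ← mul_assoc, ← hq, one_mul]
  have hu : IsUnit (h' ^ n) := by
    refine (isUnit_iff_exists).2 ⟨c, h1, ?_⟩
    rw [← hc.eq, h1]
  exact (isUnit_iff_isIso _).1 ((isUnit_pow_iff (by omega)).1 hu)

end Fitting

/-! ### Projective covers -/

section ProjectiveCovers

variable {C : Type u} [Category.{v} C] [Abelian C] (k : Type w) [Field k] [Linear k C]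

/-- Projective covers exist: among the projectives mapping onto `E`, let `P` be one with an
endomorphism algebra of minimal dimension. By Fitting's lemma an endomorphism of `P` over `E` that
is not invertible would split off a proper summand still mapping onto `E`. -/
theorem exists_projectiveCover [EnoughProjectives C]
    [∀ X Y : C, Module.Finite k (X ⟶ Y)] (E : C) :
    ∃ (P : C) (p : P ⟶ E), Projective P ∧ Epi p ∧ IsRadical (kernel.ι p) := by
  classical
  have hne : ∃ n : ℕ, ∃ (P : C) (p : P ⟶ E), Projective P ∧ Epi p ∧
      Module.finrank k (P ⟶ P) = n :=
    ⟨_, Projective.over E, Projective.π E, inferInstance, inferInstance, rfl⟩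
  obtain ⟨P, p, hP, hp, hn⟩ := Nat.find_spec hne
  have hmin : ∀ (P' : C) (p' : P' ⟶ E), Projective P' → Epi p' →
      Module.finrank k (P ⟶ P) ≤ Module.finrank k (P' ⟶ P') := fun P' p' h1 h2 => by
    rw [hn]; exact Nat.find_min' hne ⟨P', p', h1, h2, rfl⟩
  -- every endomorphism over `E` is invertible
  have key : ∀ h : P ⟶ P, h ≫ p = p → IsIso h := by
    intro h hh
    let h' : End P := h
    have : Module.Finite k (End P) := inferInstanceAs (Module.Finite k (P ⟶ P))
    obtain ⟨n, hn1, c, hcomm, hq⟩ := exists_pow_eq_pow_mul k (E := End P) h'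
    have hc : Commute (h' ^ n) c := hcomm.pow_left n
    have hpow : ∀ m : ℕ, (show P ⟶ P from h' ^ m) ≫ p = p := by
      intro m
      induction m with
      | zero => exact Category.id_comp p
      | succ m ih =>
        have : (show P ⟶ P from h' ^ (m + 1)) = h ≫ (show P ⟶ P from h' ^ m) := pow_succ h' m
        rw [this, Category.assoc, ih, hh]
    have he : (h' ^ n * c) * (h' ^ n * c) = h' ^ n * c := by
      calc (h' ^ n * c) * (h' ^ n * c) = h' ^ n * (c * h' ^ n) * c := by simp only [mul_assoc]
        _ = h' ^ n * h' ^ n * c * c := by rw [← hc.eq]; simp only [mul_assoc]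
        _ = h' ^ n * c := by rw [← hq]
    have hcp : (show P ⟶ P from c) ≫ p = p := by
      have : (show P ⟶ P from h' ^ n) = (show P ⟶ P from c) ≫
          (show P ⟶ P from h' ^ n) ≫ (show P ⟶ P from h' ^ n) := hq
      have h2 := congrArg (fun t => t ≫ p) this
      simp only [Category.assoc, hpow] at h2
      exact h2.symm
    set e : P ⟶ P := h' ^ n * c with hedef
    have hep : e ≫ p = p := by
      have : e = (show P ⟶ P from c) ≫ (show P ⟶ P from h' ^ n) := rfl
      rw [this, Category.assoc, hpow, hcp]
    obtain ⟨P', i, q, hiq, hqi⟩ := IsIdempotentComplete.idempotents_split P e he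
    have hP' : Projective P' := Retract.projective ⟨i, q, hiq⟩
    have hp' : Epi (i ≫ p) := by
      have : q ≫ i ≫ p = p := by rw [← Category.assoc, hqi, hep]
      have h3 : Epi (q ≫ i ≫ p) := by rw [this]; exact hp
      exact epi_of_epi q _
    have hle := hmin P' (i ≫ p) hP' hp'
    have he1 : e = 𝟙 P := by rw [← hqi, retract_eq_id k hiq hle]
    have h1 : h' ^ n * c = (1 : End P) := he1
    have hu : IsUnit (h' ^ n) := by
      refine (isUnit_iff_exists).2 ⟨c, h1, ?_⟩
      rw [← hc.eq, h1]
    exact (isUnit_iff_isIso _).1 ((isUnit_pow_iff (by omega)).1 hu)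
  exact ⟨P, p, hP, hp, isRadical_of_isIso fun g => key _ (by simp)⟩

end ProjectiveCovers

/-! ### Homotopies and morphisms in the derived category -/

section Complexes

variable {C : Type u} [Category.{v} C]

theorem homotopy_f [Preadditive C] {K L : CochainComplex C ℤ} {f g : K ⟶ L} (h : Homotopy f g)
    (i : ℤ) :
    f.f i - g.f i = K.d i (i + 1) ≫ h.hom (i + 1) i + h.hom i (i - 1) ≫ L.d (i - 1) i := by
  rw [h.comm i, dNext_eq h.hom (show (ComplexShape.up ℤ).Rel i (i + 1) from rfl),
    prevD_eq h.hom (show (ComplexShape.up ℤ).Rel (i - 1) i by simp)]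
  abel

/-- Homotopic maps differ by a radical map in each degree if the differentials are radical. -/
theorem isRadical_of_homotopy [Preadditive C] {K L : CochainComplex C ℤ} {f g : K ⟶ L}
    (h : Homotopy f g) (i : ℤ)
    (hK : IsRadical (K.d i (i + 1))) (hL : IsRadical (L.d (i - 1) i)) :
    IsRadical (f.f i - g.f i) := by
  rw [homotopy_f h]
  exact (hK.comp_right _).add (hL.comp_left _)

theorem isIso_of_isIso_f [Preadditive C] {K L : CochainComplex C ℤ} (f : K ⟶ L)
    (h : ∀ i, IsIso (f.f i)) : IsIso f :=
  HomologicalComplex.Hom.isIso_of_components f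

/-- A homotopy equivalence between complexes with radical differentials is an isomorphism. -/
theorem isIso_of_homotopyEquiv [Preadditive C] {K L : CochainComplex C ℤ} (e : HomotopyEquiv K L)
    (hK : ∀ i j, IsRadical (K.d i j)) (hL : ∀ i j, IsRadical (L.d i j)) :
    IsIso e.hom := by
  have : ∀ i, IsIso (e.hom.f i) := fun i => by
    have h1 : IsIso ((e.hom ≫ e.inv).f i) := by
      have := isRadical_of_homotopy e.homotopyHomInvId i (hK _ _) (hK _ _)
      have h2 : IsIso ((𝟙 K : K ⟶ K).f i) := by rw [HomologicalComplex.id_f]; infer_instance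
      exact this.isIso_of_sub
    have h2 : IsIso ((e.inv ≫ e.hom).f i) := by
      have := isRadical_of_homotopy e.homotopyInvHomId i (hL _ _) (hL _ _)
      have h2 : IsIso ((𝟙 L : L ⟶ L).f i) := by rw [HomologicalComplex.id_f]; infer_instance
      exact this.isIso_of_sub
    rw [HomologicalComplex.comp_f] at h1 h2
    have : IsSplitMono (e.hom.f i) := ⟨⟨e.inv.f i ≫ inv (e.hom.f i ≫ e.inv.f i), by
      rw [← Category.assoc, IsIso.hom_inv_id]⟩⟩
    have : Epi (e.hom.f i) := by
      have : Epi (e.inv.f i ≫ e.hom.f i) := inferInstance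
      exact epi_of_epi (e.inv.f i) _
    exact isIso_of_epi_of_isSplitMono _
  exact isIso_of_isIso_f _ this

variable [Abelian C] [HasDerivedCategory.{w₃} C]

open DerivedCategory

theorem exists_Q_map_eq {P K : CochainComplex C ℤ} [P.IsKProjective]
    (φ : Q.obj P ⟶ Q.obj K) : ∃ f : P ⟶ K, Q.map f = φ := by
  obtain ⟨g, hg⟩ := (CochainComplex.IsKProjective.Qh_map_bijective P
    ((HomotopyCategory.quotient C (.up ℤ)).obj K)).surjective
    ((quotientCompQhIso C).hom.app P ≫ φ ≫ (quotientCompQhIso C).inv.app K)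
  obtain ⟨f, rfl⟩ := (HomotopyCategory.quotient C (.up ℤ)).map_surjective g
  refine ⟨f, ?_⟩
  have h1 := (quotientCompQhIso C).hom.naturality f
  have h2 : Qh.map ((HomotopyCategory.quotient C (.up ℤ)).map f) =
    (HomotopyCategory.quotient C (.up ℤ) ⋙ Qh).map f := rfl
  rw [h2] at hg
  rw [hg] at h1
  simp only [Category.assoc, Iso.inv_hom_id_app, Category.comp_id] at h1
  exact ((cancel_epi _).1 h1).symm

theorem homotopy_of_Q_map_eq {P K : CochainComplex C ℤ} [P.IsKProjective] {f g : P ⟶ K}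
    (h : Q.map f = Q.map g) : Nonempty (Homotopy f g) := by
  refine ⟨HomotopyCategory.homotopyOfEq _ _ ?_⟩
  apply (CochainComplex.IsKProjective.Qh_map_bijective P
    ((HomotopyCategory.quotient C (.up ℤ)).obj K)).injective
  change (HomotopyCategory.quotient C (.up ℤ) ⋙ Qh).map f =
    (HomotopyCategory.quotient C (.up ℤ) ⋙ Qh).map g
  rw [← cancel_mono ((quotientCompQhIso C).hom.app K), (quotientCompQhIso C).hom.naturality,
    (quotientCompQhIso C).hom.naturality, h]

theorem Q_map_eq_of_homotopy {P K : CochainComplex C ℤ} {f g : P ⟶ K} (h : Homotopy f g) :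
    Q.map f = Q.map g := by
  rw [← cancel_epi ((quotientCompQhIso C).hom.app P), ← (quotientCompQhIso C).hom.naturality,
    ← (quotientCompQhIso C).hom.naturality]
  congr 1
  change Qh.map ((HomotopyCategory.quotient C (.up ℤ)).map f) =
    Qh.map ((HomotopyCategory.quotient C (.up ℤ)).map g)
  rw [HomotopyCategory.eq_of_homotopy f g h]

/-- Complexes of projectives that are isomorphic in the derived category are isomorphic if their
differentials are radical. -/
theorem exists_iso_of_Q_iso {P P' : CochainComplex C ℤ} [P.IsKProjective] [P'.IsKProjective]
    (hP : ∀ i j, IsRadical (P.d i j)) (hP' : ∀ i j, IsRadical (P'.d i j))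
    (e : Q.obj P ≅ Q.obj P') : ∃ f : P ≅ P', Q.map f.hom = e.hom := by
  obtain ⟨f, hf⟩ := exists_Q_map_eq e.hom
  obtain ⟨g, hg⟩ := exists_Q_map_eq e.inv
  obtain ⟨h1⟩ := homotopy_of_Q_map_eq (f := f ≫ g) (g := 𝟙 P) (by simp [hf, hg])
  obtain ⟨h2⟩ := homotopy_of_Q_map_eq (f := g ≫ f) (g := 𝟙 P') (by simp [hf, hg])
  have := isIso_of_homotopyEquiv ⟨f, g, h1, h2⟩ hP hP'
  exact ⟨asIso f, hf⟩

end Complexes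

/-! ### Minimal projective resolutions -/

namespace MinRes

variable {C : Type u} [Category.{v} C] [Abelian C]
  (hcov : ∀ E : C, ∃ (P : C) (p : P ⟶ E), Projective P ∧ Epi p ∧ IsRadical (kernel.ι p))

/-- The data from which the term in degree `n` of the resolution of `L` is built: the cycles `Z`
in degree `n - 1` of the part constructed so far, the differential of `L` in degree `n` with its
target `T` (which is zero for `n = 0`), and the map `Z ⟶ T`. -/
structure Stage (L : ChainComplex C ℕ) (n : ℕ) where
  /-- the cycles -/
  Z : C
  /-- the target of the differential of `L` -/
  T : C
  /-- the differential of `L` -/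
  bd : L.X n ⟶ T
  /-- the map to `L` on cycles -/
  g : Z ⟶ T
  d_bd : L.d (n + 1) n ≫ bd = 0

variable {L : ChainComplex C ℕ} {n : ℕ} (s : Stage L n)

namespace Stage

/-- The map induced by the differential on `Lₙ` modulo boundaries. -/
def obd : cokernel (L.d (n + 1) n) ⟶ s.T := cokernel.desc _ s.bd s.d_bd

/-- The term of the resolution in degree `n`: a projective cover of the pullback of the cycles in
degree `n - 1` and of `Lₙ` modulo boundaries. -/
def P : C := (hcov (pullback s.g s.obd)).choose

/-- The covering map. -/
def p : s.P hcov ⟶ pullback s.g s.obd := (hcov (pullback s.g s.obd)).choose_spec.choose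

instance projective : Projective (s.P hcov) :=
  (hcov (pullback s.g s.obd)).choose_spec.choose_spec.1

instance epi_p : Epi (s.p hcov) := (hcov (pullback s.g s.obd)).choose_spec.choose_spec.2.1

theorem isRadical : IsRadical (kernel.ι (s.p hcov)) :=
  (hcov (pullback s.g s.obd)).choose_spec.choose_spec.2.2

/-- The differential, with values in the cycles. -/
def a : s.P hcov ⟶ s.Z := s.p hcov ≫ pullback.fst _ _

/-- The map from the resolution to `L`. -/
def f : s.P hcov ⟶ L.X n :=
  Projective.factorThru (s.p hcov ≫ pullback.snd _ _) (cokernel.π (L.d (n + 1) n))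

theorem f_π : s.f hcov ≫ cokernel.π (L.d (n + 1) n) = s.p hcov ≫ pullback.snd _ _ :=
  Projective.factorThru_comp _ _

theorem f_bd : s.f hcov ≫ s.bd = s.a hcov ≫ s.g := by
  have h : s.bd = cokernel.π (L.d (n + 1) n) ≫ s.obd := by simp [obd]
  rw [h, ← Category.assoc, s.f_π hcov, Category.assoc, ← pullback.condition, a, Category.assoc]

/-- The next stage. -/
@[reducible]
def next : Stage L (n + 1) where
  Z := kernel (s.a hcov)
  T := L.X n
  bd := L.d (n + 1) n
  g := kernel.ι (s.a hcov) ≫ s.f hcov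
  d_bd := L.d_comp_d _ _ _

/-- The differential of the resolution. -/
def diff : (s.next hcov).P hcov ⟶ s.P hcov := (s.next hcov).a hcov ≫ kernel.ι (s.a hcov)

theorem diff_a : s.diff hcov ≫ s.a hcov = 0 := by
  rw [diff, Category.assoc, kernel.condition, comp_zero]

theorem diff_f : s.diff hcov ≫ s.f hcov = (s.next hcov).f hcov ≫ L.d (n + 1) n := by
  rw [diff, Category.assoc]
  exact ((s.next hcov).f_bd hcov).symm

theorem diff_p : s.diff hcov ≫ s.p hcov = 0 := by
  apply pullback.hom_ext
  · rw [Category.assoc, zero_comp]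
    exact s.diff_a hcov
  · rw [Category.assoc, zero_comp, ← s.f_π hcov, ← Category.assoc, diff_f, Category.assoc,
      cokernel.condition, comp_zero]

theorem isRadical_diff : IsRadical (s.diff hcov) := by
  rw [← kernel.lift_ι _ _ (s.diff_p hcov)]
  exact (s.isRadical hcov).comp_left _

theorem diff_diff : (s.next hcov).diff hcov ≫ s.diff hcov = 0 := by
  have := (s.next hcov).diff_a hcov
  rw [show s.diff hcov = (s.next hcov).a hcov ≫ kernel.ι (s.a hcov) from rfl, reassoc_of% this,
    zero_comp]

/-- The map to `L` is surjective on homology: a cycle of `L` is, after passing to a cover, the sum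
of the image of a cycle and a boundary. -/
theorem lift_cycles {A : C} (y : A ⟶ L.X n) (hy : y ≫ s.bd = 0) :
    ∃ (A' : C) (π : A' ⟶ A) (_ : Epi π) (x : A' ⟶ s.P hcov) (_ : x ≫ s.a hcov = 0)
      (z : A' ⟶ L.X (n + 1)), π ≫ y = x ≫ s.f hcov + z ≫ L.d (n + 1) n := by
  have h : (0 : A ⟶ s.Z) ≫ s.g = (y ≫ cokernel.π (L.d (n + 1) n)) ≫ s.obd := by
    simp [obd, hy]
  obtain ⟨A', π, hπ, x, hx⟩ := surjective_up_to_refinements_of_epi (s.p hcov)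
    (pullback.lift _ _ h)
  have hxa : x ≫ s.a hcov = 0 := by
    rw [a, ← Category.assoc, ← hx, Category.assoc, pullback.lift_fst, comp_zero]
  have hxf : (π ≫ y - x ≫ s.f hcov) ≫ cokernel.π (L.d (n + 1) n) = 0 := by
    rw [Preadditive.sub_comp, Category.assoc, Category.assoc, s.f_π hcov, ← Category.assoc x, ← hx,
      Category.assoc, pullback.lift_snd, sub_self]
  obtain ⟨A'', π', hπ', z, hz⟩ :=
    (ShortComplex.exact_cokernel (L.d (n + 1) n)).exact_up_to_refinements
      (π ≫ y - x ≫ s.f hcov) hxf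
  refine ⟨A'', π' ≫ π, inferInstance, π' ≫ x, by simp [hxa], z, ?_⟩
  have hz' : π' ≫ (π ≫ y - x ≫ s.f hcov) = z ≫ L.d (n + 1) n := hz
  rw [← hz']
  simp

/-- The map to `L` is injective on homology: a cycle whose image is a boundary is itself, after
passing to a cover, a boundary. -/
theorem lift_boundary {A : C} (x : A ⟶ s.P hcov) (hx : x ≫ s.a hcov = 0)
    (y : A ⟶ L.X (n + 1)) (hxy : x ≫ s.f hcov = y ≫ L.d (n + 1) n) :
    ∃ (A' : C) (π : A' ⟶ A) (_ : Epi π) (z : A' ⟶ (s.next hcov).P hcov),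
      π ≫ x = z ≫ s.diff hcov := by
  have h : kernel.lift _ x hx ≫ (s.next hcov).g =
      (y ≫ cokernel.π (L.d (n + 1 + 1) (n + 1))) ≫ (s.next hcov).obd := by
    simp [obd, hxy]
  obtain ⟨A', π, hπ, z, hz⟩ := surjective_up_to_refinements_of_epi ((s.next hcov).p hcov)
    (pullback.lift _ _ h)
  refine ⟨A', π, hπ, z, ?_⟩
  have : z ≫ (s.next hcov).a hcov = π ≫ kernel.lift _ x hx := by
    rw [a, ← Category.assoc, ← hz, Category.assoc, pullback.lift_fst]
  rw [diff, ← Category.assoc, this, Category.assoc, kernel.lift_ι]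

end Stage

/-- The stages of the construction. -/
def stage (L : ChainComplex C ℕ) : ∀ n, Stage L n
  | 0 => ⟨0, 0, 0, 0, comp_zero⟩
  | n + 1 => (stage L n).next hcov

/-- The minimal projective resolution of `L`. It is minimal because the image of each differential
lies in the kernel of a projective cover. -/
def res (L : ChainComplex C ℕ) : ChainComplex C ℕ :=
  ChainComplex.of (fun n => (stage hcov L n).P hcov) (fun n => (stage hcov L n).diff hcov)
    fun n => (stage hcov L n).diff_diff hcov

theorem res_d (L : ChainComplex C ℕ) (n : ℕ) :
    (res hcov L).d (n + 1) n = (stage hcov L n).diff hcov :=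
  ChainComplex.of_d (fun n => (stage hcov L n).P hcov) (fun n => (stage hcov L n).diff hcov) n

/-- The map from the resolution. -/
def resMap (L : ChainComplex C ℕ) : res hcov L ⟶ L where
  f n := (stage hcov L n).f hcov
  comm' i j h := by
    obtain rfl : j + 1 = i := h
    rw [res_d]
    exact ((stage hcov L j).diff_f hcov).symm

instance (L : ChainComplex C ℕ) (n : ℕ) : Projective ((res hcov L).X n) :=
  (stage hcov L n).projective hcov

theorem isRadical_res_d (L : ChainComplex C ℕ) (i j : ℕ) : IsRadical ((res hcov L).d i j) := by
  by_cases h : j + 1 = i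
  · subst h
    rw [res_d]
    exact (stage hcov L j).isRadical_diff hcov
  · rw [(res hcov L).shape i j h]
    exact isRadical_zero _ _

theorem comp_a_iff (L : ChainComplex C ℕ) (n : ℕ) {A : C} (x : A ⟶ (res hcov L).X n) (j : ℕ)
    (hj : (ComplexShape.down ℕ).next n = j) (hx : x ≫ (res hcov L).d n j = 0) :
    (show A ⟶ (stage hcov L n).P hcov from x) ≫ (stage hcov L n).a hcov = 0 := by
  cases n with
  | zero => exact (isZero_zero C).eq_of_tgt _ _
  | succ n =>
    obtain rfl : n = j := by simpa using hj
    rw [res_d] at hx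
    have h2 : (show A ⟶ ((stage hcov L n).next hcov).P hcov from x) ≫
      (stage hcov L n).diff hcov = 0 := hx
    rw [Stage.diff, ← Category.assoc] at h2
    exact (cancel_mono (kernel.ι ((stage hcov L n).a hcov))).1 (h2.trans zero_comp.symm)

theorem comp_bd_iff (L : ChainComplex C ℕ) (n : ℕ) {A : C} (y : A ⟶ L.X n) (j : ℕ)
    (hj : (ComplexShape.down ℕ).next n = j) :
    y ≫ L.d n j = 0 → y ≫ (stage hcov L n).bd = 0 := by
  cases n with
  | zero => exact fun _ => (isZero_zero C).eq_of_tgt _ _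
  | succ n =>
    obtain rfl : n = j := by simpa using hj
    exact id

theorem a_comp_d (L : ChainComplex C ℕ) (n : ℕ) {A : C} (x : A ⟶ (stage hcov L n).P hcov) (j : ℕ)
    (hj : (ComplexShape.down ℕ).next n = j) (hx : x ≫ (stage hcov L n).a hcov = 0) :
    (show A ⟶ (res hcov L).X n from x) ≫ (res hcov L).d n j = 0 := by
  cases n with
  | zero =>
    rw [(res hcov L).shape _ _ (by simp), comp_zero]
  | succ n =>
    obtain rfl : n = j := by simpa using hj
    rw [res_d]
    have h2 : (show A ⟶ ((stage hcov L n).next hcov).P hcov from x) ≫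
      (stage hcov L n).diff hcov = 0 := by
      rw [Stage.diff, ← Category.assoc]
      exact (congrArg (· ≫ _) hx).trans zero_comp
    exact h2

instance quasiIso_resMap (L : ChainComplex C ℕ) : QuasiIso (resMap hcov L) where
  quasiIsoAt n := by
    rw [quasiIsoAt_iff_isIso_homologyMap]
    have hi : (ComplexShape.down ℕ).prev n = n + 1 := by simp
    have h1 : Mono (HomologicalComplex.homologyMap (resMap hcov L) n) := by
      rw [HomologicalComplex.mono_homologyMap_iff_up_to_refinements _ (n + 1) n _ hi rfl]
      intro A x hx y hxy
      obtain ⟨A', π, hπ, z, hz⟩ := (stage hcov L n).lift_boundary hcov x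
        (comp_a_iff hcov L n x _ rfl hx) y hxy
      refine ⟨A', π, hπ, z, ?_⟩
      rw [res_d]
      exact hz
    have h2 : Epi (HomologicalComplex.homologyMap (resMap hcov L) n) := by
      rw [HomologicalComplex.epi_homologyMap_iff_up_to_refinements _ (n + 1) n _ hi rfl]
      intro A y hy
      obtain ⟨A', π, hπ, x, hx, z, hz⟩ := (stage hcov L n).lift_cycles hcov y
        (comp_bd_iff hcov L n y _ rfl hy)
      exact ⟨A', π, hπ, x, a_comp_d hcov L n x _ rfl hx, z, hz⟩
    exact isIso_of_mono_of_epi _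

end MinRes

/-- Every bounded above complex has a minimal projective resolution, provided that all objects have
projective covers. -/
theorem exists_minRes {C : Type u} [Category.{v} C] [Abelian C]
    (hcov : ∀ E : C, ∃ (P : C) (p : P ⟶ E), Projective P ∧ Epi p ∧ IsRadical (kernel.ι p))
    (K : CochainComplex C ℤ) (b : ℤ) [K.IsStrictlyLE b] :
    ∃ (P : CochainComplex C ℤ) (f : P ⟶ K), P.IsStrictlyLE b ∧ (∀ i, Projective (P.X i)) ∧
      (∀ i j, IsRadical (P.d i j)) ∧ QuasiIso f := by
  let e := ComplexShape.embeddingUpIntLE b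
  let L := K.truncLE' e
  let R := MinRes.res hcov L
  let ι : L.extend e ⟶ K :=
    (HomologicalComplex.truncLEIso K e).inv ≫ HomologicalComplex.ιTruncLE K e
  have hι : IsIso ι := inferInstanceAs (IsIso (_ ≫ HomologicalComplex.ιTruncLE K e))
  refine ⟨R.extend e, HomologicalComplex.extendMap (MinRes.resMap hcov L) e ≫ ι, ?_, ?_, ?_, ?_⟩
  · infer_instance
  · intro i
    by_cases h : ∃ n, e.f n = i
    · obtain ⟨n, hn⟩ := h
      exact Projective.of_iso (R.extendXIso e hn).symm inferInstance
    · exact (R.isZero_extend_X e i (by simpa using h)).projective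
  · intro i j
    by_cases h : ∃ n, e.f n = i
    · by_cases h' : ∃ n, e.f n = j
      · obtain ⟨n, hn⟩ := h
        obtain ⟨m, hm⟩ := h'
        rw [R.extend_d_eq e hn hm]
        exact ((MinRes.isRadical_res_d hcov L n m).comp_right _).comp_left _
      · rw [(R.isZero_extend_X e j (by simpa using h')).eq_of_tgt (HomologicalComplex.d _ _ _) 0]
        exact isRadical_zero _ _
    · rw [(R.isZero_extend_X e i (by simpa using h)).eq_of_src (HomologicalComplex.d _ _ _) 0]
      exact isRadical_zero _ _
  · infer_instance

/-! ### Brutal truncations and extension of maps -/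

section BrutalTruncation

variable {C : Type u} [Category.{v} C] [Abelian C]

/-- A map from a complex in degrees `> q` lifts along a map that is an isomorphism in degrees
`> q`. -/
theorem exists_lift_of_isIso {X N B : CochainComplex C ℤ} (q : ℤ)
    (hX : ∀ i ≤ q, IsZero (X.X i)) (j : N ⟶ B) (hj : ∀ i, q < i → IsIso (j.f i)) (φ : X ⟶ B) :
    ∃ u : X ⟶ N, u ≫ j = φ := by
  classical
  refine ⟨{ f := fun i => if h : q < i then (have := hj i h; φ.f i ≫ inv (j.f i)) else 0
            comm' := fun i k hik => ?_ }, ?_⟩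
  · obtain rfl : i + 1 = k := hik
    by_cases h : q < i
    · have h' : q < i + 1 := by omega
      have := hj i h
      have := hj _ h'
      rw [dif_pos h, dif_pos h', ← cancel_mono (j.f (i + 1))]
      simp only [Category.assoc, IsIso.inv_hom_id, Category.comp_id]
      rw [← j.comm, IsIso.inv_hom_id_assoc, φ.comm]
    · exact (hX i (by omega)).eq_of_src _ _
  · ext i
    by_cases h : q < i
    · have := hj i h
      simp [h]
    · exact (hX i (by omega)).eq_of_src _ _

theorem mono_d_of_exactAt {B : CochainComplex C ℤ} (q : ℤ) (hB : ∀ i < q, IsZero (B.X i))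
    (h : B.ExactAt q) : Mono (B.d q (q + 1)) := by
  rw [B.exactAt_iff' (q - 1) q (q + 1) (by simp) (by simp)] at h
  exact h.mono_g ((hB (q - 1) (by omega)).eq_of_src _ _)

theorem exists_lift_of_exactAt {B : CochainComplex C ℤ} (q : ℤ) (hm : Mono (B.d q (q + 1)))
    (h : B.ExactAt (q + 1)) {A : C} (x : A ⟶ B.X (q + 1))
    (hx : x ≫ B.d (q + 1) (q + 1 + 1) = 0) :
    ∃ m : A ⟶ B.X q, m ≫ B.d q (q + 1) = x := by
  rw [B.exactAt_iff' q (q + 1) (q + 1 + 1) (by simp) (by simp)] at h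
  have : Mono (B.sc' q (q + 1) (q + 1 + 1)).f := hm
  exact ⟨h.lift x hx, h.lift_f x hx⟩

/-- A map `φ` from a complex `N` in degrees `> q` to a complex in degrees `≥ q` that is exact in
degrees `≤ q + 1` extends to every complex that agrees with `N` in degrees `> q`. Exactness says
that `B^q` is the kernel of the differential on `B^{q+1}`, which determines the extension in degree
`q`. -/
theorem exists_extension {N P B : CochainComplex C ℤ} (q : ℤ)
    (hN : ∀ i ≤ q, IsZero (N.X i)) (hB : ∀ i < q, IsZero (B.X i))
    (hex : ∀ i ≤ q + 1, B.ExactAt i)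
    (inc : N ⟶ P) (hinc : ∀ i, q < i → IsIso (inc.f i)) (φ : N ⟶ B) :
    ∃ ψ : P ⟶ B, inc ≫ ψ = φ := by
  classical
  have hm := mono_d_of_exactAt q hB (hex q (by omega))
  have := hinc (q + 1) (by omega)
  have := hinc (q + 1 + 1) (by omega)
  obtain ⟨m, hmd⟩ := exists_lift_of_exactAt q hm (hex (q + 1) le_rfl)
    (P.d q (q + 1) ≫ inv (inc.f (q + 1)) ≫ φ.f (q + 1)) (by
      have h1 : φ.f (q + 1) ≫ B.d (q + 1) (q + 1 + 1) =
        inc.f (q + 1) ≫ P.d (q + 1) (q + 1 + 1) ≫ inv (inc.f (q + 1 + 1)) ≫ φ.f (q + 1 + 1) := by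
        rw [φ.comm, ← Category.assoc (inc.f _), inc.comm]
        simp
      simp only [Category.assoc]
      rw [h1]
      simp only [IsIso.inv_hom_id_assoc, HomologicalComplex.d_comp_d_assoc, zero_comp])
  let g : ∀ i, P.X i ⟶ B.X i := Function.update
    (fun i => if h : q < i then (have := hinc i h; inv (inc.f i) ≫ φ.f i) else 0) q m
  have hgq : g q = m := Function.update_self ..
  have hg : ∀ i (h : q < i), g i = (have := hinc i h; inv (inc.f i) ≫ φ.f i) := fun i h => by
    simp only [g]
    rw [Function.update_of_ne (by omega), dif_pos h]
  have hcomm : ∀ i, g i ≫ B.d i (i + 1) = P.d i (i + 1) ≫ g (i + 1) := by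
    intro i
    rcases lt_trichotomy i q with h | rfl | h
    · rw [(hB i h).eq_of_tgt (g i) 0, zero_comp]
      rcases (show i + 1 < q ∨ i + 1 = q by omega) with h' | h'
      · exact (hB _ h').eq_of_tgt _ _
      · obtain rfl := h'
        rw [hgq, ← cancel_mono (B.d (i + 1) (i + 1 + 1)), Category.assoc, hmd]
        simp
    · rw [hgq, hmd, hg _ (by omega)]
    · have := hinc i h
      have := hinc (i + 1) (by omega)
      rw [hg i h, hg (i + 1) (by omega), ← cancel_epi (inc.f i)]
      simp only [Category.assoc, IsIso.hom_inv_id_assoc, HomologicalComplex.Hom.comm]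
      rw [← Category.assoc (inc.f i), inc.comm]
      simp
  refine ⟨{ f := g, comm' := fun i k hik => ?_ }, ?_⟩
  · obtain rfl : i + 1 = k := hik
    exact hcomm i
  · ext i
    by_cases h : q < i
    · have := hinc i h
      change inc.f i ≫ g i = φ.f i
      rw [hg i h, IsIso.hom_inv_id_assoc]
    · exact (hN i (by omega)).eq_of_src _ _

/-- The extension is unique, since the differential of `B` in degree `q` is a monomorphism. -/
theorem extension_unique {N P B : CochainComplex C ℤ} (q : ℤ)
    (hB : ∀ i < q, IsZero (B.X i)) (hex : B.ExactAt q)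
    (inc : N ⟶ P) (hinc : ∀ i, q < i → IsIso (inc.f i)) {φ ψ : P ⟶ B}
    (h : inc ≫ φ = inc ≫ ψ) : φ = ψ := by
  have hm := mono_d_of_exactAt q hB hex
  have hf : ∀ i, q < i → φ.f i = ψ.f i := fun i hi => by
    have := hinc i hi
    rw [← cancel_epi (inc.f i), ← HomologicalComplex.comp_f, h, HomologicalComplex.comp_f]
  ext i
  rcases lt_trichotomy i q with h' | rfl | h'
  · exact (hB i h').eq_of_tgt _ _
  · rw [← cancel_mono (B.d i (i + 1)), φ.comm, ψ.comm, hf _ (by omega)]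
  · exact hf i h'

open Classical in
/-- The endomorphism of `P.X i` whose kernel is the term in degree `i` of the brutal truncation. -/
def brutalEnd (P : CochainComplex C ℤ) (q i : ℤ) : P.X i ⟶ P.X i := if q < i then 0 else 𝟙 _

theorem brutalEnd_of_lt (P : CochainComplex C ℤ) {q i : ℤ} (h : q < i) : brutalEnd P q i = 0 :=
  if_pos h

theorem brutalEnd_of_le (P : CochainComplex C ℤ) {q i : ℤ} (h : i ≤ q) : brutalEnd P q i = 𝟙 _ :=
  if_neg (by omega)

theorem isZero_kernel_brutalEnd (P : CochainComplex C ℤ) {q i : ℤ} (h : i ≤ q) :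
    IsZero (kernel (brutalEnd P q i)) := by
  have : Mono (brutalEnd P q i) := by
    rw [brutalEnd_of_le P h]; infer_instance
  exact isZero_kernel_of_mono _

theorem brutal_aux (P : CochainComplex C ℤ) (q i j : ℤ) :
    (kernel.ι (brutalEnd P q i) ≫ P.d i j) ≫ brutalEnd P q j = 0 := by
  by_cases h : i + 1 = j
  · by_cases hi : q < i
    · rw [brutalEnd_of_lt P (show q < j by omega), comp_zero]
    · exact (isZero_kernel_brutalEnd P (show i ≤ q by omega)).eq_of_src _ _
  · rw [P.shape i j h, comp_zero, zero_comp]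

/-- The brutal truncation in degrees `> q`. In each degree it is the kernel of zero or of the
identity, so that the inclusion into `P` is a map of complexes by construction. -/
def brutal (P : CochainComplex C ℤ) (q : ℤ) : CochainComplex C ℤ where
  X i := kernel (brutalEnd P q i)
  d i j := kernel.lift _ (kernel.ι _ ≫ P.d i j) (brutal_aux P q i j)
  shape i j h := by
    rw [← cancel_mono (kernel.ι _), kernel.lift_ι, P.shape i j h, comp_zero, zero_comp]
  d_comp_d' i j k _ _ := by
    rw [← cancel_mono (kernel.ι _)]
    simp

/-- The inclusion of the brutal truncation. -/
def brutalι (P : CochainComplex C ℤ) (q : ℤ) : brutal P q ⟶ P where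
  f _ := kernel.ι _
  comm' i j _ := (kernel.lift_ι _ _ (brutal_aux P q i j)).symm

theorem isIso_brutalι (P : CochainComplex C ℤ) (q : ℤ) (i : ℤ) (h : q < i) :
    IsIso ((brutalι P q).f i) := by
  have hs : IsSplitEpi (kernel.ι (brutalEnd P q i)) :=
    ⟨⟨kernel.lift _ (𝟙 _) (by rw [brutalEnd_of_lt P h, comp_zero]), kernel.lift_ι _ _ _⟩⟩
  exact isIso_of_mono_of_isSplitEpi (kernel.ι (brutalEnd P q i))

theorem isZero_brutal (P : CochainComplex C ℤ) (q : ℤ) (i : ℤ) (h : i ≤ q) :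
    IsZero ((brutal P q).X i) := isZero_kernel_brutalEnd P h

end BrutalTruncation

/-! ### Complexes agreeing in high degrees -/

section Agreement

variable {C : Type u} [Category.{v} C] [Abelian C]

theorem isRadical_d_of_isIso {K L : CochainComplex C ℤ} (f : K ⟶ L) (i k : ℤ)
    [IsIso (f.f i)] [IsIso (f.f k)] (h : IsRadical (K.d i k)) : IsRadical (L.d i k) := by
  have : L.d i k = inv (f.f i) ≫ K.d i k ≫ f.f k := by simp
  rw [this]
  exact (h.comp_right _).comp_left _

theorem isRadical_d_of_isIso' {K L : CochainComplex C ℤ} (f : K ⟶ L) (i k : ℤ)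
    [IsIso (f.f i)] [IsIso (f.f k)] (h : IsRadical (L.d i k)) : IsRadical (K.d i k) := by
  have : K.d i k = f.f i ≫ L.d i k ≫ inv (f.f k) := by
    rw [← Category.assoc, f.comm]; simp
  rw [this]
  exact (h.comp_right _).comp_left _

theorem quasiIsoAt_of_isIso {K L : CochainComplex C ℤ} (f : K ⟶ L) (i : ℤ)
    (h1 : IsIso (f.f (i - 1))) (h2 : IsIso (f.f i)) (h3 : IsIso (f.f (i + 1))) :
    QuasiIsoAt f i := by
  rw [quasiIsoAt_iff' f (i - 1) i (i + 1) (by simp) (by simp)]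
  have : IsIso ((HomologicalComplex.shortComplexFunctor' C (ComplexShape.up ℤ)
    (i - 1) i (i + 1)).map f).τ₁ := h1
  have : IsIso ((HomologicalComplex.shortComplexFunctor' C (ComplexShape.up ℤ)
    (i - 1) i (i + 1)).map f).τ₂ := h2
  have : IsIso ((HomologicalComplex.shortComplexFunctor' C (ComplexShape.up ℤ)
    (i - 1) i (i + 1)).map f).τ₃ := h3
  exact ShortComplex.quasiIso_of_epi_of_isIso_of_mono _

theorem quasiIso_of_agree {K L : CochainComplex C ℤ} (f : K ⟶ L) (q : ℤ)
    (h : ∀ i, q < i → IsIso (f.f i)) (hK : ∀ i ≤ q + 1, K.ExactAt i)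
    (hL : ∀ i ≤ q + 1, L.ExactAt i) : QuasiIso f where
  quasiIsoAt i := by
    by_cases hi : i ≤ q + 1
    · exact (quasiIsoAt_iff_exactAt f i (hK i hi)).2 (hL i hi)
    · exact quasiIsoAt_of_isIso f i (h _ (by omega)) (h _ (by omega)) (h _ (by omega))

/-- An acyclic complex of projectives with radical differentials is zero: its identity is homotopic
to zero, hence a radical idempotent in each degree. -/
theorem isZero_of_acyclic {P : CochainComplex C ℤ} [P.IsKProjective]
    (hP : ∀ i j, IsRadical (P.d i j)) (h : P.Acyclic) (i : ℤ) : IsZero (P.X i) := by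
  have h1 := isRadical_of_homotopy (CochainComplex.IsKProjective.homotopyZero (𝟙 P) h) i
    (hP _ _) (hP _ _)
  rw [IsZero.iff_id_eq_zero]
  simp only [HomologicalComplex.id_f, HomologicalComplex.zero_f, sub_zero] at h1
  exact h1.eq_zero_of_idem (by simp)

theorem isRadical_d_agree {P B : CochainComplex C ℤ} (q : ℤ) (hP : ∀ i j, IsRadical (P.d i j))
    (f : P ⟶ B) (hf : ∀ i, q < i → IsIso (f.f i)) (hB : IsRadical (B.d q (q + 1))) (i : ℤ)
    (hi : q < i) : IsRadical (B.d (i - 1) i) := by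
  obtain ⟨k, rfl⟩ : ∃ k, i = k + 1 := ⟨i - 1, by omega⟩
  rw [add_sub_cancel_right]
  by_cases h : k = q
  · rw [h]; exact hB
  · have := hf k (by omega)
    have := hf (k + 1) (by omega)
    exact isRadical_d_of_isIso f _ _ (hP _ _)

/-- Let `B` agree with `N` in degrees `> q` and be exact in degrees `≤ q + 1`. If the endomorphism
ring of `N` is local and `B` is not acyclic, the differential `d : B^q ⟶ B^{q+1}` is radical. Indeed
a map `φ : B^{q+1} ⟶ B^q` induces an endomorphism `θ` of `N`, equal to `φ ≫ d` in degree `q + 1`,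
whose image in `B` is null-homotopic. If `θ` is invertible, `N ⟶ B` is null-homotopic and `B` is
acyclic; otherwise `1 - θ` is invertible, and so is `1 - φ ≫ d`. -/
theorem isRadical_d_of_local {N B : CochainComplex C ℤ} (q : ℤ)
    (hN : ∀ i ≤ q, IsZero (N.X i)) (hex : ∀ i ≤ q + 1, B.ExactAt i)
    (j : N ⟶ B) (hj : ∀ i, q < i → IsIso (j.f i))
    (hloc : ∀ θ : N ⟶ N, IsIso θ ∨ IsIso (𝟙 N - θ)) (hac : ¬ B.Acyclic) :
    IsRadical (B.d q (q + 1)) := by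
  classical
  refine isRadical_of_isIso fun φ => ?_
  -- the homotopy whose only component is `φ`, from degree `q + 1` to degree `q`
  let H : ∀ i k, N.X i ⟶ B.X k := Pi.single (q + 1) (Pi.single q (j.f (q + 1) ≫ φ))
  have hH1 : H (q + 1) q = j.f (q + 1) ≫ φ := by simp [H]
  have hH2 : ∀ i k, i ≠ q + 1 → H i k = 0 := fun i k h => by simp [H, h]
  have hH3 : ∀ i k, k ≠ q → H i k = 0 := fun i k h => by
    by_cases h' : i = q + 1
    · subst h'; simp [H, h]
    · exact hH2 i k h'
  have hom : Homotopy (Homotopy.nullHomotopicMap H) 0 := Homotopy.nullHomotopy H fun i k hik => by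
    by_cases h' : k = q
    · subst h'
      exact hH2 _ _ fun h => hik h.symm
    · exact hH3 _ _ h'
  obtain ⟨θ, hθ⟩ := exists_lift_of_isIso q hN j hj (Homotopy.nullHomotopicMap H)
  have hη : (Homotopy.nullHomotopicMap H).f (q + 1) = j.f (q + 1) ≫ φ ≫ B.d q (q + 1) := by
    rw [Homotopy.nullHomotopicMap_f (k₂ := q) (k₁ := q + 1) (k₀ := q + 1 + 1)
      (show q + 1 = q + 1 from rfl) (show q + 1 + 1 = q + 1 + 1 from rfl)]
    rw [hH1, hH2 _ _ (by omega), comp_zero, zero_add, Category.assoc]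
  rcases hloc θ with h | h
  · exfalso
    apply hac
    -- `j` is null-homotopic because `θ ≫ j` is
    have hj0 : Homotopy j 0 := by
      have h1 := hom.compLeft (inv θ)
      rw [← hθ, IsIso.inv_hom_id_assoc, comp_zero] at h1
      exact h1
    intro i
    by_cases hi : i ≤ q + 1
    · exact hex i hi
    · rw [HomologicalComplex.exactAt_iff_isZero_homology]
      have := quasiIsoAt_of_isIso j i (hj _ (by omega)) (hj _ (by omega)) (hj _ (by omega))
      have h2 := (quasiIsoAt_iff_isIso_homologyMap j i).1 this
      have h3 : HomologicalComplex.homologyMap j i = 0 := by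
        rw [hj0.homologyMap_eq, HomologicalComplex.homologyMap_zero]
      have h4 := IsIso.inv_hom_id (HomologicalComplex.homologyMap j i)
      rw [IsZero.iff_id_eq_zero, ← h4]
      exact (congrArg (inv _ ≫ ·) h3).trans comp_zero
  · have := hj (q + 1) (by omega)
    have h1 : (𝟙 N - θ).f (q + 1) ≫ j.f (q + 1) =
        j.f (q + 1) ≫ (𝟙 _ - φ ≫ B.d q (q + 1)) := by
      have : θ.f (q + 1) ≫ j.f (q + 1) = j.f (q + 1) ≫ φ ≫ B.d q (q + 1) := by
        rw [← HomologicalComplex.comp_f, hθ, hη]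
      simp [Preadditive.sub_comp, this]
    have h2 : IsIso (j.f (q + 1) ≫ (𝟙 _ - φ ≫ B.d q (q + 1))) := by
      rw [← h1]; infer_instance
    exact IsIso.of_isIso_comp_left (j.f (q + 1)) _

end Agreement

/-! ### Endomorphisms of truncations in the derived category -/

section Beta

variable {C : Type u} [Category.{v} C] [Abelian C] [HasDerivedCategory.{w₃} C]

open DerivedCategory

/-- Let `f : P ⟶ B` be a minimal projective resolution that is an isomorphism in degrees `> q`,
where `B^q ⟶ B^{q+1}` is radical. Then every quasi-isomorphism `B ⟶ B` is an isomorphism in degrees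
`> q`. -/
theorem isIso_f_of_quasiIso {P B : CochainComplex C ℤ} (q : ℤ) [P.IsKProjective]
    (hP : ∀ i j, IsRadical (P.d i j)) (f : P ⟶ B) [QuasiIso f]
    (hf : ∀ i, q < i → IsIso (f.f i)) (hB : IsRadical (B.d q (q + 1))) (φ : B ⟶ B) [QuasiIso φ]
    (i : ℤ) (hi : q < i) : IsIso (φ.f i) := by
  obtain ⟨s, hs⟩ := exists_iso_of_Q_iso hP hP
    (asIso (Q.map f) ≪≫ asIso (Q.map φ) ≪≫ (asIso (Q.map f)).symm)
  obtain ⟨h⟩ := homotopy_of_Q_map_eq (f := s.hom ≫ f) (g := f ≫ φ) (by simp [hs])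
  have h1 := isRadical_of_homotopy h i (hP _ _) (isRadical_d_agree q hP f hf hB i hi)
  have := hf i hi
  have h2 : IsIso ((s.hom ≫ f).f i) := by rw [HomologicalComplex.comp_f]; infer_instance
  have h3 : IsIso ((f ≫ φ).f i) := by
    have h4 := h1.neg
    rw [neg_sub] at h4
    exact h4.isIso_of_sub
  rw [HomologicalComplex.comp_f] at h3
  exact IsIso.of_isIso_comp_left (f.f i) (φ.f i)

/-- Let `B` agree with the minimal complex `N` of projectives in degrees `> q`, and let `B^q ⟶
B^{q+1}` be radical. Then a minimal projective resolution of `B` agrees with `B` in degrees `> q`: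
it is compared with `N` through maps `N ⟶ P` and `P^{> q} ⟶ N`; the composites `N ⟶ P ⟶ B` and `P^{>
q} ⟶ N ⟶ P` are isomorphisms in these degrees. -/
theorem isIso_resolution {N B P : CochainComplex C ℤ} (q : ℤ) [N.IsKProjective] [P.IsKProjective]
    [(brutal P q).IsKProjective]
    (hN : ∀ i j, IsRadical (N.d i j)) (hP : ∀ i j, IsRadical (P.d i j))
    (j : N ⟶ B) (hj : ∀ i, q < i → IsIso (j.f i)) (hB : IsRadical (B.d q (q + 1)))
    (f : P ⟶ B) [QuasiIso f] (i : ℤ) (hi : q < i) : IsIso (f.f i) := by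
  obtain ⟨g, hg⟩ := exists_Q_map_eq (Q.map j ≫ inv (Q.map f))
  obtain ⟨h1⟩ := homotopy_of_Q_map_eq (f := g ≫ f) (g := j) (by simp [hg])
  obtain ⟨u, hu⟩ := exists_lift_of_isIso q (isZero_brutal P q) j hj (brutalι P q ≫ f)
  obtain ⟨h2⟩ := homotopy_of_Q_map_eq (f := u ≫ g) (g := brutalι P q) (by
    rw [← cancel_mono (Q.map f), ← Q.map_comp, ← Q.map_comp, Category.assoc,
      Q_map_eq_of_homotopy (h1.compLeft u), hu])
  have := hj i hi
  have := isIso_brutalι P q i hi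
  have := isIso_brutalι P q (i + 1) (by omega)
  have i1 : IsIso ((g ≫ f).f i) :=
    (isRadical_of_homotopy h1 i (hN _ _) (isRadical_d_agree q hN j hj hB i hi)).isIso_of_sub
  have i2 : IsIso ((u ≫ g).f i) :=
    (isRadical_of_homotopy h2 i (isRadical_d_of_isIso' (brutalι P q) _ _ (hP _ _))
      (hP _ _)).isIso_of_sub
  rw [HomologicalComplex.comp_f] at i1 i2
  have : Epi (f.f i) := epi_of_epi (g.f i) _
  have : Mono (f.f i) := by
    have h3 : (brutalι P q).f i ≫ f.f i = u.f i ≫ j.f i := by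
      rw [← HomologicalComplex.comp_f, ← hu, HomologicalComplex.comp_f]
    have : Mono (u.f i) := mono_of_mono _ (g.f i)
    have h4 : f.f i = inv ((brutalι P q).f i) ≫ u.f i ≫ j.f i := by rw [← h3]; simp
    rw [h4]
    infer_instance
  exact isIso_of_mono_of_epi _

/-- The truncation `B` of a complex `N` with local endomorphism ring has only trivial idempotent
endomorphisms in the derived category. An idempotent `e` is represented by an endomorphism `s` of a
minimal resolution `P`, which restricts to an endomorphism `sN` of `N`. If `sN` is invertible then
`e` is an automorphism and hence the identity; otherwise the same applies to `1 - e`. -/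
theorem idem_of_local {N B P : CochainComplex C ℤ} (q : ℤ) [N.IsKProjective] [P.IsKProjective]
    [(brutal P q).IsKProjective]
    (hN0 : ∀ i ≤ q, IsZero (N.X i)) (hex : ∀ i ≤ q + 1, B.ExactAt i)
    (hN : ∀ i j, IsRadical (N.d i j)) (hP : ∀ i j, IsRadical (P.d i j))
    (j : N ⟶ B) (hj : ∀ i, q < i → IsIso (j.f i))
    (hloc : ∀ θ : N ⟶ N, IsIso θ ∨ IsIso (𝟙 N - θ)) (hac : ¬ B.Acyclic)
    (f : P ⟶ B) [QuasiIso f] (e : Q.obj B ⟶ Q.obj B) (he : e ≫ e = e) : e = 0 ∨ e = 𝟙 _ := by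
  have hB := isRadical_d_of_local q hN0 hex j hj hloc hac
  have hf := isIso_resolution q hN hP j hj hB f
  have hPex : ∀ i ≤ q + 1, P.ExactAt i := fun i hi =>
    (quasiIsoAt_iff_exactAt' f i (hex i hi)).1 inferInstance
  obtain ⟨s, hs⟩ := exists_Q_map_eq (Q.map f ≫ e ≫ inv (Q.map f))
  obtain ⟨g, hg⟩ := exists_lift_of_isIso q hN0 f hf j
  obtain ⟨sN, hsN⟩ := exists_lift_of_isIso q hN0 j hj (g ≫ s ≫ f)
  have hgi : ∀ i, q < i → IsIso (g.f i) := fun i hi => by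
    have h1 : g.f i ≫ f.f i = j.f i := by rw [← HomologicalComplex.comp_f, hg]
    have := hj i hi
    have := hf i hi
    have h2 : IsIso (g.f i ≫ f.f i) := by rw [h1]; infer_instance
    exact IsIso.of_isIso_comp_right (g.f i) (f.f i)
  -- an endomorphism of `P` that is invertible on `N` is a quasi-isomorphism
  have key : ∀ (t : P ⟶ P) (tN : N ⟶ N), tN ≫ j = g ≫ t ≫ f → IsIso tN → IsIso (Q.map t) := by
    intro t tN ht _
    have : QuasiIso t := quasiIso_of_agree t q (fun i hi => by
      have := hj i hi
      have := hf i hi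
      have := hgi i hi
      have h1 : t.f i = inv (g.f i) ≫ (tN.f i ≫ j.f i) ≫ inv (f.f i) := by
        rw [← HomologicalComplex.comp_f, ht]; simp
      rw [h1]
      infer_instance) hPex hPex
    infer_instance
  have he' : (𝟙 _ - e) ≫ (𝟙 _ - e) = 𝟙 _ - e := by simp [he]
  rcases hloc sN with h | h
  · right
    have h1 := key s sN hsN h
    rw [hs] at h1
    have h2 : IsIso (e ≫ inv (Q.map f)) := IsIso.of_isIso_comp_left (Q.map f) _
    have h3 : IsIso e := IsIso.of_isIso_comp_right e (inv (Q.map f))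
    exact eq_id_of_idem_of_isIso he
  · left
    have h1 := key (𝟙 P - s) (𝟙 N - sN) (by
      simp [Preadditive.sub_comp, Preadditive.comp_sub, hsN, hg]) h
    have h0 : Q.map (𝟙 P - s) = Q.map f ≫ (𝟙 _ - e) ≫ inv (Q.map f) := by
      rw [Functor.map_sub, hs]
      simp [Preadditive.sub_comp, Preadditive.comp_sub]
    rw [h0] at h1
    have h2 : IsIso ((𝟙 _ - e) ≫ inv (Q.map f)) := IsIso.of_isIso_comp_left (Q.map f) _
    have h3 : IsIso (𝟙 _ - e) := IsIso.of_isIso_comp_right (𝟙 _ - e) (inv (Q.map f))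
    have := eq_id_of_idem_of_isIso he'
    simpa using this

end Beta

/-! ### Decomposition into indecomposables -/

section Decomposition

variable {C : Type u} [Category.{v} C] [Preadditive C] (k : Type w) [Field k] [Linear k C]

/-- Induction over the decompositions of the objects into indecomposables. -/
theorem indec_induction [IsIdempotentComplete C] (hfin : ∀ X : C, Module.Finite k (X ⟶ X))
    {motive : C → Prop} (zero : ∀ X, IsZero X → motive X) (indec : ∀ X, IsIndec X → motive X)
    (sum : ∀ (X Y Z : C) (i : Y ⟶ X) (p : X ⟶ Y) (j : Z ⟶ X) (q : X ⟶ Z),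
      p ≫ i + q ≫ j = 𝟙 X → motive Y → motive Z → motive X) (X : C) : motive X := by
  induction hn : Module.finrank k (X ⟶ X) using Nat.strong_induction_on generalizing X with
  | _ n ih =>
    by_cases h0 : IsZero X
    · exact zero X h0
    by_cases h1 : ∀ e : X ⟶ X, e ≫ e = e → e = 0 ∨ e = 𝟙 X
    · exact indec X (isIndec_of_idem h0 h1)
    push Not at h1
    obtain ⟨e, he, he0, he1⟩ := h1
    obtain ⟨Y, i, p, hip, hpi⟩ := IsIdempotentComplete.idempotents_split X e he
    obtain ⟨Z, j, q, hjq, hqj⟩ := IsIdempotentComplete.idempotents_split X (𝟙 X - e)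
      (by simp [he])
    have := hfin X
    have hY : Module.finrank k (Y ⟶ Y) < n := by
      rw [← hn]
      by_contra h
      exact he1 (by rw [← hpi]; exact retract_eq_id k hip (not_lt.1 h))
    have hZ : Module.finrank k (Z ⟶ Z) < n := by
      rw [← hn]
      by_contra h
      have := retract_eq_id k hjq (not_lt.1 h)
      rw [hqj] at this
      exact he0 (by simpa using this)
    exact sum X Y Z i p j q (by rw [hpi, hqj]; abel) (ih _ hY Y rfl) (ih _ hZ Z rfl)

end Decomposition

/-! ### Finite dimensional modules -/

section Modules

variable {k : Type w} [Field k] {A : Type u} [Category.{v} A] [Preadditive A] [Linear k A]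

theorem fd_ext {M N : FDModule k A} {f g : M ⟶ N}
    (h : ∀ x (a : M.obj.obj x), f.hom.app x a = g.hom.app x a) : f = g := by
  ext x : 4
  exact LinearMap.ext (h x)

theorem fd_naturality {M N : FDModule k A} (f : M ⟶ N) {x y : A} (g : x ⟶ y) (a : M.obj.obj x) :
    f.hom.app y (M.obj.map g a) = N.obj.map g (f.hom.app x a) :=
  NatTrans.naturality_apply f.hom g a

theorem fd_map_add (M : FDModule k A) {x y : A} (f g : x ⟶ y) (a : M.obj.obj x) :
    M.obj.map (f + g) a = M.obj.map f a + M.obj.map g a := by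
  rw [M.property.1.map_add]
  rfl

theorem fd_map_smul (M : FDModule k A) {x y : A} (c : k) (f : x ⟶ y) (a : M.obj.obj x) :
    M.obj.map (c • f) a = c • M.obj.map f a := by
  rw [M.property.2.1]
  rfl

theorem fd_map_zero (M : FDModule k A) {x y : A} (a : M.obj.obj x) :
    M.obj.map (0 : x ⟶ y) a = 0 := by
  have := fd_map_smul M 0 (0 : x ⟶ y) a
  simpa using this

instance (M : FDModule k A) (x : A) : Module.Finite k (M.obj.obj x) := M.property.2.2.1 x

theorem mono_hom {M N : FDModule k A} (f : M ⟶ N) [Mono f] : Mono f.hom := by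
  refine Preadditive.mono_of_kernel_zero ?_
  have hK : isFDModule k A (kernel f.hom) :=
    (isFDModule k A).prop_of_mono (kernel.ι f.hom) M.property
  let K : FDModule k A := ⟨_, hK⟩
  let ι : K ⟶ M := ObjectProperty.homMk (kernel.ι f.hom)
  have h : ι ≫ f = 0 := by
    ext : 1
    exact kernel.condition f.hom
  have h0 : ι = 0 := by rw [← cancel_mono f, h, zero_comp]
  exact congrArg (fun t => t.hom) h0

theorem epi_hom {M N : FDModule k A} (f : M ⟶ N) [Epi f] : Epi f.hom := by
  refine Preadditive.epi_of_cokernel_zero ?_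
  have hK : isFDModule k A (cokernel f.hom) :=
    (isFDModule k A).prop_of_epi (cokernel.π f.hom) N.property
  let K : FDModule k A := ⟨_, hK⟩
  let π : N ⟶ K := ObjectProperty.homMk (cokernel.π f.hom)
  have h : f ≫ π = 0 := by
    ext : 1
    exact cokernel.condition f.hom
  have h0 : π = 0 := by rw [← cancel_epi f, h, comp_zero]
  exact congrArg (fun t => t.hom) h0

theorem fd_injective {M N : FDModule k A} (f : M ⟶ N) [Mono f] (x : A) :
    Function.Injective (f.hom.app x) := by
  have := mono_hom f
  exact mono_app_injective f.hom x

theorem fd_surjective {M N : FDModule k A} (f : M ⟶ N) [Epi f] (x : A) :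
    Function.Surjective (f.hom.app x) := by
  have := epi_hom f
  exact epi_app_surjective f.hom x

theorem epi_of_surjective {M N : FDModule k A} (f : M ⟶ N)
    (h : ∀ x, Function.Surjective (f.hom.app x)) : Epi f where
  left_cancellation {L} g g' hg := by
    refine fd_ext fun x b => ?_
    obtain ⟨a, rfl⟩ := h x b
    exact congrArg (fun t : M ⟶ L => t.hom.app x a) hg

variable (Q : QuiverOf.{w, v, u, w₁, w₂} k A)

/-- The vertices supporting a module. -/
def vsupp (M : FDModule k A) : Set Q.V := {x | Nontrivial (M.obj.obj (Q.pt x))}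

theorem finite_vsupp (M : FDModule k A) : (vsupp Q M).Finite := by
  refine Set.Finite.of_finite_image
    (f := fun x => (Quotient.mk (isIsomorphicSetoid A) (Q.pt x))) (M.property.2.2.2.subset ?_) ?_
  · rintro _ ⟨x, hx, rfl⟩
    exact ⟨_, ⟨Q.indec x, hx⟩, rfl⟩
  · intro x _ y _ h
    exact Q.eq_of_iso x y (Quotient.exact h)

variable [IsLofd k A]

/-- Induction over decompositions into the objects represented by vertices. -/
theorem vertex_induction {motive : A → Prop}
    (zero : ∀ X, IsZero X → motive X) (vertex : ∀ x : Q.V, motive (Q.pt x))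
    (sum : ∀ (X Y Z : A) (i : Y ⟶ X) (p : X ⟶ Y) (j : Z ⟶ X) (q : X ⟶ Z),
      p ≫ i + q ≫ j = 𝟙 X → motive Y → motive Z → motive X) (X : A) : motive X := by
  have := IsLofd.split (k := k) (A := A)
  refine indec_induction k (fun X => IsLofd.finite_hom X X) zero (fun X hX => ?_) sum X
  obtain ⟨x, ⟨e⟩⟩ := Q.exists_iso X hX
  refine sum X (Q.pt x) (Q.pt x) e.hom e.inv 0 0 (by simp) (vertex x) (vertex x)

theorem fd_zero_of_vertex {M N : FDModule k A} {f : M ⟶ N}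
    (h : ∀ x (a : M.obj.obj (Q.pt x)), f.hom.app _ a = 0) : f = 0 := by
  refine fd_ext fun X => ?_
  change ∀ a : M.obj.obj X, f.hom.app X a = 0
  refine vertex_induction Q (motive := fun X => ∀ a : M.obj.obj X, f.hom.app X a = 0)
    (fun X hX a => ?_) h (fun X Y Z i p j q hs hY hZ a => ?_) X
  · have h1 : M.obj.map (𝟙 X) a = a := by simp
    rw [← h1, hX.eq_of_src (𝟙 X) 0, fd_map_zero, map_zero]
  · have h1 : M.obj.map (𝟙 X) a = a := by simp
    rw [← h1, ← hs, fd_map_add, M.obj.map_comp, M.obj.map_comp]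
    change f.hom.app X (M.obj.map i (M.obj.map p a) + M.obj.map j (M.obj.map q a)) = 0
    rw [map_add, fd_naturality f i, fd_naturality f j, hY, hZ, map_zero, map_zero, add_zero]

theorem fd_surjective_of_vertex {M N : FDModule k A} {f : M ⟶ N}
    (h : ∀ x, Function.Surjective (f.hom.app (Q.pt x))) (X : A) :
    Function.Surjective (f.hom.app X) := by
  refine vertex_induction Q (motive := fun X => Function.Surjective (f.hom.app X))
    (fun X hX b => ⟨0, ?_⟩) h (fun X Y Z i p j q hs hY hZ b => ?_) X
  · have h1 : N.obj.map (𝟙 X) b = b := by simp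
    rw [← h1, hX.eq_of_src (𝟙 X) 0, fd_map_zero, map_zero]
  · have h1 : N.obj.map (𝟙 X) b = b := by simp
    obtain ⟨a, ha⟩ := hY (N.obj.map p b)
    obtain ⟨a', ha'⟩ := hZ (N.obj.map q b)
    refine ⟨M.obj.map i a + M.obj.map j a', ?_⟩
    rw [map_add, fd_naturality, fd_naturality, ha, ha']
    conv_rhs => rw [← h1, ← hs, fd_map_add, N.obj.map_comp, N.obj.map_comp]
    rfl

instance finite_fd_hom (M N : FDModule k A) : Module.Finite k (M ⟶ N) := by
  obtain ⟨Q⟩ := QuiverOf.nonempty k A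
  have := (finite_vsupp Q M).to_subtype
  let F : (M ⟶ N) →ₗ[k] ∀ x : vsupp Q M, (M.obj.obj (Q.pt x) →ₗ[k] N.obj.obj (Q.pt x)) :=
    { toFun := fun f x => (f.hom.app (Q.pt x)).hom
      map_add' := fun f g => rfl
      map_smul' := fun c f => rfl }
  refine Module.Finite.of_injective F ((injective_iff_map_eq_zero F).2 fun f hf => ?_)
  refine fd_zero_of_vertex Q fun x a => ?_
  by_cases hx : Nontrivial (M.obj.obj (Q.pt x))
  · exact LinearMap.congr_fun (congrFun hf ⟨x, hx⟩) a
  · have := not_nontrivial_iff_subsingleton.1 hx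
    rw [Subsingleton.elim a 0, map_zero]

/-- Proper subobjects are contained in maximal ones. -/
theorem exists_coatom (M : FDModule k A) (S : Subobject M) (hS : S ≠ ⊤) :
    ∃ T : Subobject M, IsCoatom T ∧ S ≤ T := by
  classical
  obtain ⟨Q⟩ := QuiverOf.nonempty k A
  have := (finite_vsupp Q M).to_subtype
  let _ := Fintype.ofFinite (vsupp Q M)
  let d : Subobject M → ℕ := fun T =>
    ∑ x : vsupp Q M, Module.finrank k ((T : FDModule k A).obj.obj (Q.pt x))
  have hd : ∀ T T' : Subobject M, T < T' → d T < d T' := by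
    intro T T' h
    have hle : ∀ x, Module.finrank k ((T : FDModule k A).obj.obj (Q.pt x)) ≤
        Module.finrank k ((T' : FDModule k A).obj.obj (Q.pt x)) := fun x =>
      LinearMap.finrank_le_finrank_of_injective
        (f := ((Subobject.ofLE T T' h.le).hom.app (Q.pt x)).hom) (fd_injective _ _)
    refine lt_of_le_of_ne (Finset.sum_le_sum fun x _ => hle x) fun he => ?_
    have he' := (Finset.sum_eq_sum_iff_of_le fun x _ => hle x.1).1 he
    have hsurj : ∀ x, Function.Surjective ((Subobject.ofLE T T' h.le).hom.app (Q.pt x)) := by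
      intro x
      by_cases hx : Nontrivial (M.obj.obj (Q.pt x))
      · exact (LinearMap.injective_iff_surjective_of_finrank_eq_finrank
          (he' ⟨x, hx⟩ (Finset.mem_univ _))).1 (fd_injective _ _)
      · have := not_nontrivial_iff_subsingleton.1 hx
        have := (fd_injective T'.arrow (Q.pt x)).subsingleton
        exact fun b => ⟨0, Subsingleton.elim _ _⟩
    have : Epi (Subobject.ofLE T T' h.le) := epi_of_surjective _ (fd_surjective_of_vertex Q hsurj)
    have : IsIso (Subobject.ofLE T T' h.le) := isIso_of_mono_of_epi _
    refine h.not_ge (Subobject.le_of_comm (inv (Subobject.ofLE T T' h.le)) ?_)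
    rw [IsIso.inv_comp_eq, Subobject.ofLE_arrow]
  have hbd : ∀ T, d T ≤ d ⊤ := fun T => by
    rcases eq_or_lt_of_le (le_top : T ≤ ⊤) with h | h
    · rw [h]
    · exact (hd _ _ h).le
  let p : ℕ → Prop := fun n => ∃ T : Subobject M, T ≠ ⊤ ∧ S ≤ T ∧ d T = n
  obtain ⟨T, hT, hST, hTn⟩ : p (Nat.findGreatest p (d ⊤)) :=
    Nat.findGreatest_spec (P := p) (hbd S) ⟨S, hS, le_rfl, rfl⟩
  refine ⟨T, ⟨hT, fun T' h => ?_⟩, hST⟩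
  by_contra hT'
  have h1 := Nat.le_findGreatest (P := p) (hbd T') ⟨T', hT', hST.trans h.le, rfl⟩
  rw [← hTn] at h1
  exact (hd _ _ h).not_ge h1

theorem epi_of_imageSubobject_eq_top {C : Type u} [Category.{v} C] [Abelian C] {X Y : C}
    (f : X ⟶ Y) (h : imageSubobject f = ⊤) : Epi f := by
  rw [← imageSubobject_arrow_comp f]
  have : IsIso (imageSubobject f).arrow := by
    rw [h]; infer_instance
  infer_instance

/-- A map into an object `Y` that factors through every maximal subobject is radical. -/
theorem isRadical_of_factors {X Y : FDModule k A} (f : X ⟶ Y)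
    (h : ∀ S : Subobject Y, IsCoatom S → S.Factors f) : IsRadical f := by
  refine isRadical_of_isIso fun g => ?_
  suffices Epi (𝟙 Y - g ≫ f) from isIso_of_epi_endo k _
  by_contra hne
  have hS : imageSubobject (𝟙 Y - g ≫ f) ≠ ⊤ := fun h =>
    hne (epi_of_imageSubobject_eq_top _ h)
  obtain ⟨T, hT, hST⟩ := exists_coatom Y _ hS
  have h1 : T.Factors (𝟙 Y - g ≫ f) := Subobject.factors_of_le _ hST
    ((Subobject.factors_iff _ _).2 ⟨factorThruImageSubobject _ ≫ 𝟙 _, by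
      simp ⟩)
  have h2 : T.Factors (g ≫ f) := Subobject.factors_of_factors_right g (h T hT)
  have h3 : T.Factors (𝟙 Y) := by
    have := Subobject.factors_add _ _ h1 h2
    simpa using this
  apply hT.1
  refine top_unique (Subobject.le_of_comm ((⊤ : Subobject Y).arrow ≫ T.factorThru (𝟙 Y) h3) ?_)
  simp

/-- A radical map into a projective object factors through every maximal subobject. -/
theorem factors_of_isRadical {C : Type u} [Category.{v} C] [Abelian C] {X Y : C} [Projective Y]
    (f : X ⟶ Y) (hf : IsRadical f) (S : Subobject Y) (hS : IsCoatom S) : S.Factors f := by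
  by_contra h
  have hlt : S < S ⊔ imageSubobject f := by
    refine lt_of_le_of_ne le_sup_left fun he => h ?_
    have h1 : imageSubobject f ≤ S := by rw [he]; exact le_sup_right
    exact Subobject.factors_of_le _ h1
      (by have := Subobject.factors_comp_arrow (P := imageSubobject f) (factorThruImageSubobject f)
          simpa using this)
  have htop := hS.2 _ hlt
  have hepi : Epi (biprod.desc S.arrow f) := by
    have h1 : S ≤ imageSubobject (biprod.desc S.arrow f) :=
      Subobject.le_of_comm (biprod.inl ≫ factorThruImageSubobject _) (by simp)
    have h2 : imageSubobject f ≤ imageSubobject (biprod.desc S.arrow f) := by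
      have := imageSubobject_comp_le biprod.inr (biprod.desc S.arrow f)
      rwa [biprod.inr_desc] at this
    exact epi_of_imageSubobject_eq_top _ (top_unique (htop ▸ sup_le h1 h2))
  obtain ⟨s, hs⟩ : ∃ s, s ≫ biprod.desc S.arrow f = 𝟙 Y :=
    ⟨Projective.factorThru (𝟙 Y) (biprod.desc S.arrow f), Projective.factorThru_comp _ _⟩
  have h1 : (s ≫ biprod.fst) ≫ S.arrow = 𝟙 Y - (s ≫ biprod.snd) ≫ f := by
    rw [← hs, biprod.desc_eq]
    simp
  have h2 : IsIso (𝟙 Y - (s ≫ biprod.snd) ≫ f) := by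
    have := (hf.comp_left (s ≫ biprod.snd)) (𝟙 Y)
    simpa using this
  have : Epi S.arrow := by
    have h3 : Epi ((s ≫ biprod.fst) ≫ S.arrow) := by rw [h1]; infer_instance
    exact epi_of_epi (s ≫ biprod.fst) _
  have : IsIso S.arrow := isIso_of_mono_of_epi _
  exact hS.1 (Subobject.eq_top_of_isIso_arrow S)

end Modules

/-! ### The modules `A^X ⊗ W` -/

section Tens

variable {k : Type w} [Field k] {A : Type u} [Category.{v} A] [Preadditive A] [Linear k A]

/-- Evaluation of homomorphisms of modules at an element. -/
def evalAt {M N : FDModule k A} {x : A} (a : M.obj.obj x) : (M ⟶ N) →ₗ[k] N.obj.obj x where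
  toFun f := f.hom.app x a
  map_add' _ _ := rfl
  map_smul' _ _ := rfl

theorem fd_sum_apply {M N : FDModule k A} {ι : Type*} (s : Finset ι) (f : ι → (M ⟶ N)) {x : A}
    (a : M.obj.obj x) : (∑ i ∈ s, f i).hom.app x a = ∑ i ∈ s, (f i).hom.app x a :=
  map_sum (evalAt a) f s

variable [IsLofd k A]

/-- The element `f ⊗ w` of the module `A^X ⊗ W`. -/
def tmul {X z : A} {W : ModuleCat.{v} k} {hW : Module.Finite k W} (f : X ⟶ z) (a : W) :
    (tens X W hW).obj.obj z :=
  (f ⊗ₜ[k] a : (X ⟶ z) ⊗[k] W)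

theorem tens_map_tmul {X z z' : A} {W : ModuleCat.{v} k} {hW : Module.Finite k W} (f : X ⟶ z)
    (a : W) (g : z ⟶ z') :
    (tens X W hW).obj.map g (tmul f a) = tmul (f ≫ g) a := rfl

theorem tensMap_tmul {X Y z : A} (α : X ⟶ Y) {W W' : ModuleCat.{v} k}
    (hW : Module.Finite k W) (hW' : Module.Finite k W') (φ : W →ₗ[k] W') (f : Y ⟶ z) (a : W) :
    (tensMap α hW hW' φ).hom.app z (tmul f a) = tmul (α ≫ f) (φ a) := rfl

theorem tens_induction {X z : A} {W : ModuleCat.{v} k} {hW : Module.Finite k W}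
    {motive : (tens X W hW).obj.obj z → Prop} (zero : motive 0)
    (tmul : ∀ (f : X ⟶ z) a, motive (tmul f a))
    (add : ∀ s t, motive s → motive t → motive (s + t)) (t : (tens X W hW).obj.obj z) :
    motive t :=
  TensorProduct.induction_on (motive := motive) t zero tmul add

theorem tens_apply {X : A} {W : ModuleCat.{v} k} {hW : Module.Finite k W} {N : FDModule k A}
    (θ : tens X W hW ⟶ N) {z : A} (f : X ⟶ z) (a : W) :
    θ.hom.app z (tmul f a) = N.obj.map f (θ.hom.app X (tmul (𝟙 X) a)) := by
  rw [← fd_naturality, tens_map_tmul, Category.id_comp]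

/-- The Yoneda lemma: a homomorphism from `A^X ⊗ W` is determined by its values on `1 ⊗ w`. -/
theorem tens_ext {X : A} {W : ModuleCat.{v} k} {hW : Module.Finite k W} {N : FDModule k A}
    {θ θ' : tens X W hW ⟶ N}
    (h : ∀ a : W, θ.hom.app X (tmul (𝟙 X) a) = θ'.hom.app X (tmul (𝟙 X) a)) : θ = θ' := by
  refine fd_ext fun z t => ?_
  induction t using tens_induction with
  | zero => rw [map_zero, map_zero]
  | tmul f a => rw [tens_apply θ f a, tens_apply θ' f a, h]
  | add s t hs ht => rw [map_add, map_add, hs, ht]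

/-- The Yoneda lemma: the homomorphism from `A^X ⊗ W` with prescribed values on `1 ⊗ w`. -/
def tensDesc {X : A} {W : ModuleCat.{v} k} (hW : Module.Finite k W) {N : FDModule k A}
    (φ : W →ₗ[k] N.obj.obj X) : tens X W hW ⟶ N :=
  ObjectProperty.homMk
    { app := fun z => ModuleCat.ofHom (TensorProduct.lift
        (LinearMap.mk₂ k (fun (f : X ⟶ z) (a : W) => (N.obj.map f (φ a) : N.obj.obj z))
          (fun f g a => fd_map_add N f g _) (fun c f a => fd_map_smul N c f _)
          (fun f a b => by rw [map_add, map_add]) (fun c f a => by rw [map_smul, map_smul])))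
      naturality := fun z z' g => by
        ext : 1
        refine TensorProduct.ext' fun f a => ?_
        change N.obj.map (f ≫ g) (φ a) = N.obj.map g (N.obj.map f (φ a))
        rw [N.obj.map_comp]
        rfl }

theorem tensDesc_tmul {X : A} {W : ModuleCat.{v} k} (hW : Module.Finite k W) {N : FDModule k A}
    (φ : W →ₗ[k] N.obj.obj X) {z : A} (f : X ⟶ z) (a : W) :
    (tensDesc hW φ).hom.app z (tmul f a) = N.obj.map f (φ a) :=
  TensorProduct.lift.tmul _ _

theorem tensDesc_one {X : A} {W : ModuleCat.{v} k} (hW : Module.Finite k W) {N : FDModule k A}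
    (φ : W →ₗ[k] N.obj.obj X) (a : W) :
    (tensDesc hW φ).hom.app X (tmul (𝟙 X) a) = φ a := by
  rw [tensDesc_tmul]; simp

/-- The values of a homomorphism on `1 ⊗ w`. -/
def tensVal {X : A} {W : ModuleCat.{v} k} {hW : Module.Finite k W} {N : FDModule k A}
    (θ : tens X W hW ⟶ N) : W →ₗ[k] N.obj.obj X :=
  (θ.hom.app X).hom ∘ₗ (TensorProduct.mk k (X ⟶ X) W (𝟙 X))

theorem tensVal_apply {X : A} {W : ModuleCat.{v} k} {hW : Module.Finite k W} {N : FDModule k A}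
    (θ : tens X W hW ⟶ N) (a : W) : tensVal θ a = θ.hom.app X (tmul (𝟙 X) a) := rfl

instance projective_tens (X : A) (W : ModuleCat.{v} k) (hW : Module.Finite k W) :
    Projective (tens X W hW) where
  factors {N M} θ e _ := by
    obtain ⟨φ, hφ⟩ := Module.projective_lifting_property (e.hom.app X).hom (tensVal θ)
      (fd_surjective e X)
    refine ⟨tensDesc hW φ, tens_ext fun a => ?_⟩
    change e.hom.app X ((tensDesc hW φ).hom.app X (tmul (𝟙 X) a)) = _
    rw [tensDesc_one]
    exact LinearMap.congr_fun hφ a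

theorem isZero_tens (X : A) (W : ModuleCat.{v} k) (hW : Module.Finite k W)
    (h : ¬ Nontrivial W) : IsZero (tens X W hW) := by
  have := not_nontrivial_iff_subsingleton.1 h
  rw [IsZero.iff_id_eq_zero]
  refine tens_ext fun a => ?_
  rw [Subsingleton.elim a 0]
  have : (tmul (𝟙 X) (0 : W) : (tens X W hW).obj.obj X) = 0 := TensorProduct.tmul_zero _ _
  rw [this, map_zero, map_zero]

theorem tensMap_id (X : A) (W : ModuleCat.{v} k) (hW : Module.Finite k W) :
    tensMap (𝟙 X) hW hW LinearMap.id = 𝟙 (tens X W hW) := by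
  refine tens_ext fun a => ?_
  rw [tensMap_tmul, Category.id_comp]
  rfl

theorem tensMap_comp {X Y Z : A} (α : X ⟶ Y) (β : Y ⟶ Z)
    {W W' W'' : ModuleCat.{v} k} (hW : Module.Finite k W) (hW' : Module.Finite k W')
    (hW'' : Module.Finite k W'') (φ : W →ₗ[k] W') (ψ : W' →ₗ[k] W'') :
    tensMap β hW hW' φ ≫ tensMap α hW' hW'' ψ = tensMap (α ≫ β) hW hW'' (ψ ∘ₗ φ) := by
  refine tens_ext fun a => ?_
  change (tensMap α hW' hW'' ψ).hom.app Z ((tensMap β hW hW' φ).hom.app Z (tmul (𝟙 Z) a)) = _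
  rw [tensMap_tmul, tensMap_tmul, tensMap_tmul, Category.assoc]
  rfl

theorem tensMap_sub {X Y : A} (α : X ⟶ Y) {W W' : ModuleCat.{v} k}
    (hW : Module.Finite k W) (hW' : Module.Finite k W') (φ ψ : W →ₗ[k] W') :
    tensMap α hW hW' (φ - ψ) = tensMap α hW hW' φ - tensMap α hW hW' ψ := by
  refine tens_ext fun a => ?_
  exact TensorProduct.tmul_sub _ _ _

theorem tensMap_zero {X Y : A} (α : X ⟶ Y) {W W' : ModuleCat.{v} k}
    (hW : Module.Finite k W) (hW' : Module.Finite k W') :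
    tensMap α hW hW' 0 = 0 := by
  refine tens_ext fun a => ?_
  exact TensorProduct.tmul_zero _ _

/-- If finitely many morphisms `mᵢ` span `A(X, Y)`, then every homomorphism
`A^Y ⊗ W → A^X ⊗ W'` is of the form `∑ᵢ A^{mᵢ} ⊗ φᵢ`. -/
theorem exists_eq_sum_tensMap {X Y : A} {ι : Type*} [Fintype ι] (m : ι → (X ⟶ Y))
    (hm : ⊤ ≤ Submodule.span k (Set.range m)) {W W' : ModuleCat.{v} k}
    (hW : Module.Finite k W) (hW' : Module.Finite k W') (θ : tens Y W hW ⟶ tens X W' hW') :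
    ∃ φ : ι → (W →ₗ[k] W'), θ = ∑ i, tensMap (m i) hW hW' (φ i) := by
  let S : (ι → W') →ₗ[k] (X ⟶ Y) ⊗[k] W' :=
    ∑ i, TensorProduct.mk k (X ⟶ Y) W' (m i) ∘ₗ LinearMap.proj i
  have hS : ∀ c, S c = ∑ i, m i ⊗ₜ[k] c i := fun c => by simp [S]
  have hsurj : Function.Surjective S := by
    rw [← LinearMap.range_eq_top, eq_top_iff]
    rintro t -
    induction t using TensorProduct.induction_on with
    | zero => exact zero_mem _
    | add s t hs ht => exact add_mem hs ht
    | tmul f a =>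
      have hf : f ∈ Submodule.span k (Set.range m) := hm trivial
      induction hf using Submodule.span_induction with
      | mem f hf =>
        obtain ⟨i, rfl⟩ := hf
        classical
        refine ⟨Pi.single i a, ?_⟩
        rw [hS, Finset.sum_eq_single i]
        · simp
        · intro j _ hj
          rw [Pi.single_eq_of_ne hj, TensorProduct.tmul_zero]
        · simp
      | zero => rw [TensorProduct.zero_tmul]; exact zero_mem _
      | add f g _ _ hf hg => rw [TensorProduct.add_tmul]; exact add_mem hf hg
      | smul c f _ hf => rw [← TensorProduct.smul_tmul']; exact Submodule.smul_mem _ _ hf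
  obtain ⟨φ, hφ⟩ := Module.projective_lifting_property S (tensVal θ) hsurj
  refine ⟨fun i => LinearMap.proj i ∘ₗ φ, tens_ext fun a => ?_⟩
  rw [fd_sum_apply, ← tensVal_apply, ← hφ]
  refine (hS (φ a)).trans (Finset.sum_congr rfl fun i _ => ?_)
  rw [tensMap_tmul, Category.comp_id]
  rfl

/-- The expression of a homomorphism in terms of linearly independent morphisms is unique. -/
theorem eq_zero_of_sum_tensMap {X Y : A} {ι : Type*} [Fintype ι] {S : Submodule k (X ⟶ Y)}
    (b : Module.Basis ι k S) {W W' : ModuleCat.{v} k}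
    (hW : Module.Finite k W) (hW' : Module.Finite k W') (φ : ι → (W →ₗ[k] W'))
    (h : ∑ i, tensMap (b i : X ⟶ Y) hW hW' (φ i) = 0) (i : ι) : φ i = 0 := by
  obtain ⟨c, hc⟩ := LinearMap.exists_extend (b.coord i)
  ext a
  have h1 : ∑ j, ((b j : X ⟶ Y) ⊗ₜ[k] φ j a : (X ⟶ Y) ⊗[k] W') = 0 := by
    have := congrArg (fun θ : tens Y W hW ⟶ tens X W' hW' => θ.hom.app Y (tmul (𝟙 Y) a)) h
    simp only [fd_sum_apply, tensMap_tmul, Category.comp_id] at this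
    exact this
  have h2 := congrArg (fun t => TensorProduct.lid k W' (LinearMap.rTensor W' c t)) h1
  simp only [map_sum, LinearMap.rTensor_tmul, TensorProduct.lid_tmul, map_zero] at h2
  have h3 : ∀ j, c (b j : X ⟶ Y) = b.coord i (b j) := fun j => LinearMap.congr_fun hc (b j)
  classical
  simp only [h3, Module.Basis.coord_apply, Module.Basis.repr_self, Finsupp.single_apply] at h2
  simpa using h2

/-- Radical morphisms of `A` induce radical homomorphisms: if `t` is induced by `α`, then `t ≫ g ≫
t` is composed of maps induced by `α ≫ f ≫ α`, which vanish because the radical has square zero. -/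
theorem isRadical_tensMap [HasRadicalSquareZero A] {X Y : A} {α : X ⟶ Y} (hα : IsRadical α)
    {W W' : ModuleCat.{v} k} (hW : Module.Finite k W) (hW' : Module.Finite k W')
    (φ : W →ₗ[k] W') : IsRadical (tensMap α hW hW' φ) := by
  intro g
  refine isIso_one_sub_of_sq ?_
  suffices tensMap α hW hW' φ ≫ g ≫ tensMap α hW hW' φ = 0 by
    simp [reassoc_of% this]
  refine tens_ext fun a => ?_
  change (tensMap α hW hW' φ).hom.app Y (g.hom.app Y
    ((tensMap α hW hW' φ).hom.app Y (tmul (𝟙 Y) a))) = 0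
  rw [tensMap_tmul, Category.comp_id, tens_apply, fd_naturality]
  induction g.hom.app X (tmul (𝟙 X) (φ a)) using tens_induction with
  | zero => rw [map_zero, map_zero]
  | add s t hs ht => rw [map_add, map_add, hs, ht, add_zero]
  | tmul f a =>
    rw [tensMap_tmul, tens_map_tmul, Category.assoc,
      HasRadicalSquareZero.comp_eq_zero α (f ≫ α) hα (hα.comp_left f)]
    exact TensorProduct.zero_tmul _ _

/-- The homomorphism `A^X ⊗ φ` is radical only if it vanishes. -/
theorem eq_zero_of_isRadical_tensMap_id {X : A} (hX : ¬ IsZero X) {W W' : ModuleCat.{v} k}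
    (hW : Module.Finite k W) (hW' : Module.Finite k W') (φ : W →ₗ[k] W')
    (h : IsRadical (tensMap (𝟙 X) hW hW' φ)) : φ = 0 := by
  by_contra hφ
  obtain ⟨a, ha⟩ : ∃ a, φ a ≠ 0 := by
    by_contra hn
    push Not at hn
    exact hφ (LinearMap.ext hn)
  obtain ⟨c, hc⟩ := Module.Projective.exists_dual_ne_zero k ha
  let ψ : W' →ₗ[k] W := (c (φ a))⁻¹ • c.smulRight a
  have hψ : ψ (φ a) = a := by simp [ψ, smul_smul, inv_mul_cancel₀ hc]
  have hi := h (tensMap (𝟙 X) hW' hW ψ)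
  have h0 : (𝟙 (tens X W hW) - tensMap (𝟙 X) hW hW' φ ≫ tensMap (𝟙 X) hW' hW ψ).hom.app X
      (tmul (𝟙 X) a) = 0 := by
    change tmul (𝟙 X) a - (tensMap (𝟙 X) hW' hW ψ).hom.app X
      ((tensMap (𝟙 X) hW hW' φ).hom.app X (tmul (𝟙 X) a)) = 0
    rw [tensMap_tmul, tensMap_tmul, Category.comp_id, Category.comp_id, hψ, sub_self]
  have h1 : (tmul (𝟙 X) a : (tens X W hW).obj.obj X) = 0 := by
    have h2 := fd_injective (𝟙 (tens X W hW) - tensMap (𝟙 X) hW hW' φ ≫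
      tensMap (𝟙 X) hW' hW ψ) X
    exact h2 (h0.trans (map_zero _).symm)
  have h1X : 𝟙 X ≠ 0 := fun h => hX ((IsZero.iff_id_eq_zero X).2 h)
  have ha0 : a ≠ 0 := fun h => ha (by rw [h, map_zero])
  obtain ⟨d, hd⟩ := Module.Projective.exists_dual_ne_zero k h1X
  have h3 := congrArg (fun t => TensorProduct.lid k W (LinearMap.rTensor W d t))
    (show ((𝟙 X : X ⟶ X) ⊗ₜ[k] a : (X ⟶ X) ⊗[k] W) = 0 from h1)
  simp only [LinearMap.rTensor_tmul, TensorProduct.lid_tmul, map_zero, smul_eq_zero] at h3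
  exact h3.elim hd ha0

end Tens

/-! ### Homomorphisms between the modules of the vertices -/

section Vertices

variable {k : Type w} [Field k] {A : Type u} [Category.{v} A] [Preadditive A] [Linear k A]

theorem isRadical_of_not_iso [IsIdempotentComplete A] {X Y : A} [Module.Finite k (X ⟶ X)]
    (hX : IsIndec X) (hY : IsIndec Y) (h : IsEmpty (X ≅ Y)) (f : X ⟶ Y) : IsRadical f := by
  intro g
  rcases isIso_or_isIso_one_sub k hX.idem (f ≫ g) with hi | hi
  · exfalso
    have hr : f ≫ g ≫ inv (f ≫ g) = 𝟙 X := by rw [← Category.assoc, IsIso.hom_inv_id]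
    have hidem : ((g ≫ inv (f ≫ g)) ≫ f) ≫ (g ≫ inv (f ≫ g)) ≫ f = (g ≫ inv (f ≫ g)) ≫ f := by
      simp only [Category.assoc] at hr ⊢
      simp [reassoc_of% hr]
    rcases hY.idem _ hidem with h0 | h1
    · apply hX.1
      rw [IsZero.iff_id_eq_zero]
      have := congrArg (fun t => f ≫ t ≫ g ≫ inv (f ≫ g)) h0
      simpa [hr, reassoc_of% hr] using this
    · exact h.false ⟨f, g ≫ inv (f ≫ g), hr, h1⟩
  · exact hi

/-- Over an algebraically closed field, an endomorphism of an indecomposable object is a scalar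
modulo the radical: the scalar is an eigenvalue. -/
theorem exists_smul_id_add_radical [IsAlgClosed k] [IsIdempotentComplete A] {X : A}
    [Module.Finite k (X ⟶ X)] (hX : IsIndec X) (f : X ⟶ X) :
    ∃ c : k, IsRadical (f - c • 𝟙 X) := by
  have : Module.Finite k (End X) := inferInstanceAs (Module.Finite k (X ⟶ X))
  have : Nontrivial (End X) :=
    ⟨0, 1, fun h => hX.1 ((IsZero.iff_id_eq_zero X).2 (show (1 : End X) = 0 from h.symm))⟩
  obtain ⟨c, hc⟩ := spectrum.nonempty_of_isAlgClosed_of_finiteDimensional k (show End X from f)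
  refine ⟨c, fun g => ?_⟩
  rcases isIso_or_isIso_one_sub k hX.idem ((f - c • 𝟙 X) ≫ g) with hi | hi
  · exfalso
    have : Epi g := epi_of_epi (f - c • 𝟙 X) g
    have := isIso_of_epi_endo k g
    have h1 : IsIso (f - c • 𝟙 X) := IsIso.of_isIso_comp_right _ g
    have h2 : IsUnit (show End X from (f - c • 𝟙 X)) := (isUnit_iff_isIso _).2 h1
    have h3 : (algebraMap k (End X) c - (show End X from f)) =
        -(show End X from (f - c • 𝟙 X)) := by
      rw [Algebra.algebraMap_eq_smul_one]
      exact (neg_sub _ _).symm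
    exact hc (show IsUnit _ from h3 ▸ h2.neg)
  · exact hi

variable (Q : QuiverOf.{w, v, u, w₁, w₂} k A)

theorem span_mor (x y : Q.V) : Submodule.span k (Set.range (Q.mor (x := x) (y := y))) =
    rad k (Q.pt x) (Q.pt y) := by
  have : Set.range (Q.mor (x := x) (y := y)) =
      (rad k (Q.pt x) (Q.pt y)).subtype '' Set.range (Q.basis x y) := by
    rw [← Set.range_comp]; rfl
  rw [this, ← Submodule.map_span, (Q.basis x y).span_eq, Submodule.map_subtype_top]

variable [IsLofd k A]

theorem isRadical_of_ne {x y : Q.V} (h : x ≠ y) (f : Q.pt x ⟶ Q.pt y) : IsRadical f := by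
  have := IsLofd.split (k := k) (A := A)
  have := IsLofd.finite_hom (k := k) (Q.pt x) (Q.pt x)
  exact isRadical_of_not_iso (k := k) (Q.indec x) (Q.indec y)
    ⟨fun e => h (Q.eq_of_iso x y ⟨e⟩)⟩ f

theorem exists_smul_id_add_radical_vertex [IsAlgClosed k] {x : Q.V} (f : Q.pt x ⟶ Q.pt x) :
    ∃ c : k, IsRadical (f - c • 𝟙 (Q.pt x)) := by
  have := IsLofd.split (k := k) (A := A)
  have := IsLofd.finite_hom (k := k) (Q.pt x) (Q.pt x)
  exact exists_smul_id_add_radical (Q.indec x) f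

/-- The homomorphism `∑_α A^α ⊗ φ_α`, the sum being over the arrows `α : x ⟶ y`. -/
def arrSum {x y : Q.V} {W W' : ModuleCat.{v} k} (hW : Module.Finite k W)
    (hW' : Module.Finite k W') (φ : Q.Arr x y → (W →ₗ[k] W')) :
    tens (Q.pt y) W hW ⟶ tens (Q.pt x) W' hW' :=
  letI := Fintype.ofFinite (Q.Arr x y)
  ∑ α : Q.Arr x y, tensMap (Q.mor α) hW hW' (φ α)

variable {Q} {x y : Q.V} {W W' : ModuleCat.{v} k} (hW : Module.Finite k W)
    (hW' : Module.Finite k W')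

theorem isRadical_arrSum [HasRadicalSquareZero A] (φ : Q.Arr x y → (W →ₗ[k] W')) :
    IsRadical (arrSum Q hW hW' φ) :=
  isRadical_sum _ _ fun α _ => isRadical_tensMap (Q.isRadical_mor α) _ _ _

theorem arrSum_sub (φ ψ : Q.Arr x y → (W →ₗ[k] W')) :
    arrSum Q hW hW' (fun α => φ α - ψ α) = arrSum Q hW hW' φ - arrSum Q hW hW' ψ := by
  simp only [arrSum, tensMap_sub, Finset.sum_sub_distrib]

theorem eq_zero_of_arrSum (φ : Q.Arr x y → (W →ₗ[k] W')) (h : arrSum Q hW hW' φ = 0)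
    (α : Q.Arr x y) : φ α = 0 :=
  let := Fintype.ofFinite (Q.Arr x y)
  eq_zero_of_sum_tensMap (Q.basis x y) hW hW' φ h α

theorem exists_eq_arrSum_of_ne (hxy : x ≠ y) (θ : tens (Q.pt y) W hW ⟶ tens (Q.pt x) W' hW') :
    ∃ φ, θ = arrSum Q hW hW' φ := by
  let := Fintype.ofFinite (Q.Arr x y)
  refine exists_eq_sum_tensMap (Q.mor (x := x) (y := y)) ?_ hW hW' θ
  rw [span_mor]
  exact fun f _ => isRadical_of_ne Q hxy f

/-- The homomorphisms `A^x ⊗ W → A^x ⊗ W'` are those of the form `A^x ⊗ φ₀ + ∑_α A^α ⊗ φ_α`, because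
`A(x, x)` is spanned by the identity and the loops at `x`. -/
theorem exists_eq_id_add_arrSum [IsAlgClosed k] {x : Q.V}
    (θ : tens (Q.pt x) W hW ⟶ tens (Q.pt x) W' hW') :
    ∃ φ₀ φ, θ = tensMap (𝟙 _) hW hW' φ₀ + arrSum Q hW hW' φ := by
  let := Fintype.ofFinite (Q.Arr x x)
  obtain ⟨φ, hφ⟩ := exists_eq_sum_tensMap
    (fun i : Option (Q.Arr x x) => i.elim (𝟙 (Q.pt x)) Q.mor) (fun f _ => by
      obtain ⟨c, hc⟩ := exists_smul_id_add_radical_vertex Q f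
      have h1 : f - c • 𝟙 (Q.pt x) ∈ Submodule.span k (Set.range (Q.mor (x := x) (y := x))) := by
        rw [span_mor]; exact hc
      rw [← sub_add_cancel f (c • 𝟙 (Q.pt x))]
      refine add_mem (Submodule.span_mono ?_ h1)
        (Submodule.smul_mem _ _ (Submodule.subset_span ⟨none, rfl⟩))
      rintro _ ⟨α, rfl⟩
      exact ⟨some α, rfl⟩) hW hW' θ
  refine ⟨φ none, fun α => φ (some α), ?_⟩
  rw [hφ, Fintype.sum_option]
  rfl

/-- The radical homomorphisms `A^y ⊗ W → A^x ⊗ W'` are the sums `∑_α A^α ⊗ φ_α`. -/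
theorem exists_eq_arrSum_of_isRadical [IsAlgClosed k] [HasRadicalSquareZero A]
    (θ : tens (Q.pt y) W hW ⟶ tens (Q.pt x) W' hW') (hθ : IsRadical θ) :
    ∃ φ, θ = arrSum Q hW hW' φ := by
  by_cases h : x = y
  · subst h
    obtain ⟨φ₀, φ, rfl⟩ := exists_eq_id_add_arrSum hW hW' θ
    have h1 := hθ.sub (isRadical_arrSum hW hW' φ)
    rw [add_sub_cancel_right] at h1
    rw [eq_zero_of_isRadical_tensMap_id (Q.indec x).1 hW hW' φ₀ h1, tensMap_zero, zero_add]
    exact ⟨φ, rfl⟩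
  · exact exists_eq_arrSum_of_ne hW hW' h θ

end Vertices

/-! ### Direct sums of the modules `A^x ⊗ W(x)` -/

section Sums

variable {k : Type w} [Field k] {A : Type u} [Category.{v} A] [Preadditive A] [Linear k A]
  [IsLofd k A] {Q : QuiverOf.{w, v, u, w₁, w₂} k A}

/-- The vertices with a nonzero space. -/
def nzSet (W : Q.V → ModuleCat.{v} k) : Set Q.V := {x | Nontrivial (W x)}

variable (W : Q.V → ModuleCat.{v} k) (hW : ∀ x, Module.Finite k (W x)) [Finite (nzSet W)]
  (W' : Q.V → ModuleCat.{v} k) (hW' : ∀ x, Module.Finite k (W' x)) [Finite (nzSet W')]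

/-- The module `⨁ₓ A^x ⊗ W(x)`, for a family of spaces of which only finitely many are nonzero. -/
def tsum : FDModule k A := ⨁ fun x : nzSet W => tens (Q.pt x) (W x) (hW x)

open Classical in
/-- The inclusion of a summand. It is defined for all vertices, the summand being zero if
`W(x) = 0`. -/
def tinj (x : Q.V) : tens (Q.pt x) (W x) (hW x) ⟶ tsum W hW :=
  if h : Nontrivial (W x) then
    biproduct.ι (fun x : nzSet W => tens (Q.pt x) (W x) (hW x)) ⟨x, h⟩ else 0

open Classical in
/-- The projection onto a summand. -/
def tproj (x : Q.V) : tsum W hW ⟶ tens (Q.pt x) (W x) (hW x) :=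
  if h : Nontrivial (W x) then
    biproduct.π (fun x : nzSet W => tens (Q.pt x) (W x) (hW x)) ⟨x, h⟩ else 0

theorem tinj_coe (x : nzSet W) : tinj W hW x =
    biproduct.ι (fun x : nzSet W => tens (Q.pt x) (W x) (hW x)) x := dif_pos x.2

theorem tproj_coe (x : nzSet W) : tproj W hW x =
    biproduct.π (fun x : nzSet W => tens (Q.pt x) (W x) (hW x)) x := dif_pos x.2

variable {W hW} in
theorem tsum_hom_ext {N : FDModule k A} {f g : tsum W hW ⟶ N}
    (h : ∀ x, tinj W hW x ≫ f = tinj W hW x ≫ g) : f = g :=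
  biproduct.hom_ext' _ _ fun x => by
    have := h x
    simp only [tinj_coe] at this
    exact this

variable {W hW} in
theorem tsum_hom_ext' {N : FDModule k A} {f g : N ⟶ tsum W hW}
    (h : ∀ x, f ≫ tproj W hW x = g ≫ tproj W hW x) : f = g :=
  biproduct.hom_ext _ _ fun x => by
    have := h x
    simp only [tproj_coe] at this
    exact this

theorem tinj_tproj_self (x : Q.V) : tinj W hW x ≫ tproj W hW x = 𝟙 _ := by
  by_cases h : Nontrivial (W x)
  · rw [tinj_coe W hW ⟨x, h⟩, tproj_coe W hW ⟨x, h⟩]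
    exact biproduct.ι_π_self _ _
  · exact (isZero_tens _ _ _ h).eq_of_src _ _

theorem tinj_tproj_ne {x y : Q.V} (hxy : x ≠ y) : tinj W hW x ≫ tproj W hW y = 0 := by
  by_cases h : Nontrivial (W x)
  · by_cases h' : Nontrivial (W y)
    · rw [tinj_coe W hW ⟨x, h⟩, tproj_coe W hW ⟨y, h'⟩]
      exact biproduct.ι_π_ne _ fun e => hxy (congrArg Subtype.val e)
    · exact (isZero_tens _ _ _ h').eq_of_tgt _ _
  · exact (isZero_tens _ _ _ h).eq_of_src _ _

theorem tsum_total [Fintype (nzSet W)] :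
    ∑ x : nzSet W, tproj W hW x ≫ tinj W hW x = 𝟙 (tsum W hW) := by
  simp only [tinj_coe, tproj_coe]
  exact IsBilimit.total (biproduct.isBilimit _)

/-- The homomorphism from a direct sum with given components. -/
def tdesc {N : FDModule k A} (f : ∀ x, tens (Q.pt x) (W x) (hW x) ⟶ N) : tsum W hW ⟶ N :=
  biproduct.desc fun x => f x

theorem tinj_tdesc {N : FDModule k A} (f : ∀ x, tens (Q.pt x) (W x) (hW x) ⟶ N) (x : Q.V) :
    tinj W hW x ≫ tdesc W hW f = f x := by
  by_cases h : Nontrivial (W x)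
  · rw [tinj_coe W hW ⟨x, h⟩]
    exact biproduct.ι_desc _ _
  · exact (isZero_tens _ _ _ h).eq_of_src _ _

instance projective_tsum : Projective (tsum W hW) where
  factors f e _ :=
    ⟨tdesc W hW fun x => Projective.factorThru (tinj W hW x ≫ f) e, tsum_hom_ext fun x => by
      rw [← Category.assoc, tinj_tdesc, Projective.factorThru_comp]⟩

variable {W hW W' hW'} in
theorem isRadical_tsum (θ : tsum W hW ⟶ tsum W' hW')
    (h : ∀ y x, IsRadical (tinj W hW y ≫ θ ≫ tproj W' hW' x)) : IsRadical θ := by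
  let := Fintype.ofFinite (nzSet W)
  let := Fintype.ofFinite (nzSet W')
  rw [← Category.id_comp θ, ← Category.comp_id (_ ≫ θ), ← tsum_total W hW, ← tsum_total W' hW']
  simp only [Preadditive.sum_comp, Preadditive.comp_sum]
  refine isRadical_sum _ _ fun x _ => isRadical_sum _ _ fun y _ => ?_
  have := ((h y x).comp_left (tproj W hW y)).comp_right (tinj W' hW' x)
  simpa using this

/-- The homomorphism `⨁ₓ A^x ⊗ gₓ`. -/
def tmap (g : ∀ x, W x →ₗ[k] W' x) : tsum W hW ⟶ tsum W' hW' :=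
  tdesc W hW fun x => tensMap (𝟙 _) (hW x) (hW' x) (g x) ≫ tinj W' hW' x

theorem tinj_tmap (g : ∀ x, W x →ₗ[k] W' x) (x : Q.V) :
    tinj W hW x ≫ tmap W hW W' hW' g =
      tensMap (𝟙 _) (hW x) (hW' x) (g x) ≫ tinj W' hW' x := tinj_tdesc ..

theorem tmap_tproj (g : ∀ x, W x →ₗ[k] W' x) (x : Q.V) :
    tmap W hW W' hW' g ≫ tproj W' hW' x =
      tproj W hW x ≫ tensMap (𝟙 _) (hW x) (hW' x) (g x) := by
  refine tsum_hom_ext fun y => ?_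
  rw [← Category.assoc, tinj_tmap, Category.assoc]
  by_cases h : y = x
  · subst h
    rw [tinj_tproj_self, ← Category.assoc, tinj_tproj_self, Category.comp_id, Category.id_comp]
  · rw [tinj_tproj_ne _ _ h, ← Category.assoc, tinj_tproj_ne _ _ h, comp_zero, zero_comp]

/-- The homomorphism `⨁ₓ A^x ⊗ gₓ` is radical only if it vanishes. -/
theorem eq_zero_of_isRadical_tmap (g : ∀ x, W x →ₗ[k] W' x)
    (h : IsRadical (tmap W hW W' hW' g)) (x : Q.V) : g x = 0 := by
  refine eq_zero_of_isRadical_tensMap_id (Q.indec x).1 (hW x) (hW' x) (g x) ?_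
  have := (h.comp_left (tinj W hW x)).comp_right (tproj W' hW' x)
  rwa [tinj_tmap, Category.assoc, tinj_tproj_self, Category.comp_id] at this

/-- Modulo the radical, homomorphisms between direct sums of the modules `A^x` are given by linear
maps. -/
theorem exists_tmap [IsAlgClosed k] [HasRadicalSquareZero A] (θ : tsum W hW ⟶ tsum W' hW') :
    ∃ g, IsRadical (θ - tmap W hW W' hW' g) := by
  choose g φ hg using fun x => exists_eq_id_add_arrSum (Q := Q) (hW x) (hW' x)
    (tinj W hW x ≫ θ ≫ tproj W' hW' x)
  refine ⟨g, isRadical_tsum _ fun y x => ?_⟩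
  rw [Preadditive.sub_comp, Preadditive.comp_sub, tmap_tproj, ← Category.assoc (tinj W hW y)
    (tproj W hW x)]
  by_cases h : y = x
  · subst h
    rw [tinj_tproj_self, Category.id_comp, hg, add_sub_cancel_left]
    exact isRadical_arrSum _ _ _
  · rw [tinj_tproj_ne _ _ h, zero_comp, sub_zero]
    obtain ⟨ψ, hψ⟩ := exists_eq_arrSum_of_ne (Q := Q) (hW y) (hW' x) (Ne.symm h)
      (tinj W hW y ≫ θ ≫ tproj W' hW' x)
    rw [hψ]
    exact isRadical_arrSum _ _ _

end Sums

/-! ### Tops and the structure of projective modules -/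

section Projectives

variable {k : Type w} [Field k] {A : Type u} [Category.{v} A] [Preadditive A] [Linear k A]

instance enoughProjectives_fd [IsLofd k A] : EnoughProjectives (FDModule k A) where
  presentation M := by
    obtain ⟨Q⟩ := QuiverOf.nonempty k A
    have : Finite (nzSet fun x => M.obj.obj (Q.pt x)) := (finite_vsupp Q M).to_subtype
    have hW : ∀ x, Module.Finite k (M.obj.obj (Q.pt x)) := fun x => inferInstance
    let π : tsum _ hW ⟶ M := tdesc _ hW fun x => tensDesc _ LinearMap.id
    have hπ : ∀ x, Function.Surjective (π.hom.app (Q.pt x)) := fun x a => by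
      refine ⟨(tinj _ hW x).hom.app _ (tmul (𝟙 _) a), ?_⟩
      change (tinj _ hW x ≫ π).hom.app _ (tmul (𝟙 _) a) = a
      rw [tinj_tdesc, tensDesc_one, LinearMap.id_apply]
    have := epi_of_surjective π (fd_surjective_of_vertex Q hπ)
    exact ⟨{ p := tsum _ hW, f := π }⟩

variable (Q : QuiverOf.{w, v, u, w₁, w₂} k A)

/-- The radical of `M` at a vertex `x`: the sum of the images of the maps `M(α)` with `α` an arrow
ending in `x`. -/
def radAt (M : FDModule k A) (x : Q.V) : Submodule k (M.obj.obj (Q.pt x)) :=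
  ⨆ (y : Q.V) (α : Q.Arr y x), LinearMap.range (M.obj.map (Q.mor α)).hom

theorem map_mem_radAt (M : FDModule k A) {x y : Q.V} {f : Q.pt y ⟶ Q.pt x} (hf : IsRadical f)
    (a : M.obj.obj (Q.pt y)) : M.obj.map f a ∈ radAt Q M x := by
  have h1 : f ∈ Submodule.span k (Set.range (Q.mor (x := y) (y := x))) := by
    rw [span_mor]; exact hf
  clear hf
  induction h1 using Submodule.span_induction with
  | mem f hf =>
    obtain ⟨α, rfl⟩ := hf
    exact Submodule.mem_iSup_of_mem y (Submodule.mem_iSup_of_mem α ⟨a, rfl⟩)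
  | zero => rw [fd_map_zero]; exact zero_mem _
  | add f g _ _ hf hg => rw [fd_map_add]; exact add_mem hf hg
  | smul c f _ hf => rw [fd_map_smul]; exact Submodule.smul_mem _ _ hf

theorem radAt_induction {M : FDModule k A} {x : Q.V} {motive : M.obj.obj (Q.pt x) → Prop}
    (zero : motive 0)
    (map : ∀ y (α : Q.Arr y x) b, motive (M.obj.map (Q.mor α) b))
    (add : ∀ a b, motive a → motive b → motive (a + b)) (a : M.obj.obj (Q.pt x))
    (ha : a ∈ radAt Q M x) : motive a := by
  refine Submodule.iSup_induction _ (motive := motive) ha (fun y b hb => ?_) zero add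
  refine Submodule.iSup_induction _ (motive := motive) hb (fun α b hb => ?_) zero add
  obtain ⟨c, rfl⟩ := hb
  exact map y α c

theorem apply_mem_radAt {M N : FDModule k A} (f : M ⟶ N) {x : Q.V} {a : M.obj.obj (Q.pt x)}
    (ha : a ∈ radAt Q M x) : f.hom.app _ a ∈ radAt Q N x := by
  refine radAt_induction Q (motive := fun a => f.hom.app _ a ∈ radAt Q N x) ?_ (fun y α b => ?_)
    (fun a b ha hb => ?_) a ha
  · rw [map_zero]; exact zero_mem _
  · rw [fd_naturality]; exact map_mem_radAt Q N (Q.isRadical_mor α) _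
  · rw [map_add]; exact add_mem ha hb

/-- Arrows annihilate the radical of a module, because the radical of `A` has square zero. -/
theorem map_radAt_eq_zero [HasRadicalSquareZero A] {M : FDModule k A} {x y : Q.V}
    (α : Q.Arr x y) {a : M.obj.obj (Q.pt x)} (ha : a ∈ radAt Q M x) :
    M.obj.map (Q.mor α) a = 0 := by
  refine radAt_induction Q (motive := fun a => M.obj.map (Q.mor α) a = 0) (map_zero _)
    (fun z β b => ?_) (fun a b ha hb => ?_) a ha
  · change (M.obj.map (Q.mor β) ≫ M.obj.map (Q.mor α)) b = 0
    rw [← M.obj.map_comp, HasRadicalSquareZero.comp_eq_zero _ _ (Q.isRadical_mor β)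
      (Q.isRadical_mor α), fd_map_zero]
  · rw [map_add, ha, hb, add_zero]

/-- The top of `M` at a vertex. -/
def topAt (M : FDModule k A) (x : Q.V) : ModuleCat.{v} k :=
  ModuleCat.of k (M.obj.obj (Q.pt x) ⧸ radAt Q M x)

instance (M : FDModule k A) (x : Q.V) : Module.Finite k (topAt Q M x) :=
  inferInstanceAs (Module.Finite k (M.obj.obj (Q.pt x) ⧸ radAt Q M x))

theorem nzSet_topAt_subset (M : FDModule k A) : nzSet (topAt Q M) ⊆ vsupp Q M := fun x hx => by
  have : Nontrivial (M.obj.obj (Q.pt x) ⧸ radAt Q M x) := hx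
  exact (Submodule.mkQ_surjective (radAt Q M x)).nontrivial

instance (M : FDModule k A) : Finite (nzSet (topAt Q M)) :=
  ((finite_vsupp Q M).subset (nzSet_topAt_subset Q M)).to_subtype

/-- The projection of `M` onto its top at a vertex. -/
def topMk (M : FDModule k A) (x : Q.V) : M.obj.obj (Q.pt x) →ₗ[k] topAt Q M x :=
  (radAt Q M x).mkQ

theorem topMk_eq_zero {M : FDModule k A} {x : Q.V} {a : M.obj.obj (Q.pt x)} :
    topMk Q M x a = 0 ↔ a ∈ radAt Q M x := Submodule.Quotient.mk_eq_zero _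

/-- A projective module is the direct sum of the modules `A^x ⊗ top(P)ₓ`. Lifting the tops to `P`
gives a map `π` from the direct sum to `P`, which is surjective with radical kernel. It splits, and
the projection onto the kernel takes values in the radical and kills the radical, so it vanishes. -/
theorem nonempty_iso_tsum_topAt [IsLofd k A] [IsAlgClosed k] [HasRadicalSquareZero A]
    (P : FDModule k A) [Projective P] :
    Nonempty (tsum (topAt Q P) (fun _ => inferInstance) ≅ P) := by
  have hW : ∀ x, Module.Finite k (topAt Q P x) := fun _ => inferInstance
  choose s hs using fun x : Q.V =>
    LinearMap.exists_rightInverse_of_surjective (topMk Q P x) (Submodule.range_mkQ _)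
  have hs' : ∀ x a, topMk Q P x (s x a) = a := fun x a => LinearMap.congr_fun (hs x) a
  let T := tsum (topAt Q P) hW
  -- the element `1 ⊗ w` of the summand belonging to `x`
  let ι : ∀ x, topAt Q P x → T.obj.obj (Q.pt x) := fun x a =>
    (tinj (topAt Q P) hW x).hom.app _ (tmul (𝟙 _) a)
  let π : T ⟶ P := tdesc (topAt Q P) hW fun x => tensDesc _ (s x)
  have hπ : ∀ x a, π.hom.app _ (ι x a) = s x a := fun x a => by
    change (tinj (topAt Q P) hW x ≫ π).hom.app _ (tmul (𝟙 _) a) = _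
    rw [tinj_tdesc, tensDesc_one]
  have hdec : ∀ x (a : P.obj.obj (Q.pt x)), a - s x (topMk Q P x a) ∈ radAt Q P x :=
    fun x a => by
      rw [← topMk_eq_zero, map_sub, hs', sub_self]
  -- `π` is surjective because the radical of the radical vanishes
  have hsurj : ∀ x, Function.Surjective (π.hom.app (Q.pt x)) := by
    intro x
    have hmem : ∀ a ∈ radAt Q P x, ∃ t, π.hom.app (Q.pt x) t = a := by
      refine radAt_induction Q ⟨0, map_zero _⟩ (fun y α b => ?_) ?_
      · refine ⟨T.obj.map (Q.mor α) (ι y (topMk Q P y b)), ?_⟩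
        rw [fd_naturality, hπ, ← sub_eq_zero, ← map_sub]
        refine map_radAt_eq_zero Q α ?_
        rw [← neg_sub]
        exact neg_mem (hdec y b)
      · rintro _ _ ⟨t, rfl⟩ ⟨t', rfl⟩
        exact ⟨t + t', map_add _ _ _⟩
    intro a
    obtain ⟨t, ht⟩ := hmem _ (hdec x a)
    refine ⟨t + ι x (topMk Q P x a), ?_⟩
    rw [map_add, ht, hπ, sub_add_cancel]
  have hepi : Epi π := epi_of_surjective _ (fd_surjective_of_vertex Q hsurj)
  -- elements of `T` are of the form `1 ⊗ w` modulo the radical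
  have htens : ∀ x y (t : (tens (Q.pt y) (topAt Q P y) (hW y)).obj.obj (Q.pt x)),
      ∃ a, (tinj (topAt Q P) hW y).hom.app _ t - ι x a ∈ radAt Q T x := by
    intro x y t
    have h0 : ∀ x, ι x 0 = 0 := fun x => map_zero (tensVal (tinj (topAt Q P) hW x))
    induction t using tens_induction with
    | zero => exact ⟨0, by rw [map_zero, h0, sub_zero]; exact zero_mem _⟩
    | tmul f a =>
      rw [tens_apply]
      by_cases hxy : y = x
      · subst hxy
        obtain ⟨c, hc⟩ := exists_smul_id_add_radical_vertex Q f
        refine ⟨c • a, ?_⟩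
        have h1 := map_mem_radAt Q T hc (ι y a)
        have h2 : ι y (c • a) = c • ι y a := map_smul (tensVal (tinj (topAt Q P) hW y)) _ _
        have h3 : T.obj.map f (ι y a) = T.obj.map (f - c • 𝟙 _) (ι y a) + c • ι y a := by
          conv_lhs => rw [← sub_add_cancel f (c • 𝟙 _), fd_map_add, fd_map_smul]
          simp
        rw [h2]
        change T.obj.map f (ι y a) - _ ∈ _
        rwa [h3, add_sub_cancel_right]
      · refine ⟨0, ?_⟩
        rw [h0, sub_zero]
        exact map_mem_radAt Q T (isRadical_of_ne Q hxy f) _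
    | add s t hs ht =>
      obtain ⟨a, ha⟩ := hs
      obtain ⟨b, hb⟩ := ht
      refine ⟨a + b, ?_⟩
      have h2 : ι x (a + b) = ι x a + ι x b :=
        map_add (tensVal (tinj (topAt Q P) hW x)) _ _
      rw [h2, map_add, add_sub_add_comm]
      exact add_mem ha hb
  have htop : ∀ x (t : T.obj.obj (Q.pt x)), ∃ a, topMk Q T x t = topMk Q T x (ι x a) := by
    intro x t
    let := Fintype.ofFinite (nzSet (topAt Q P))
    choose a ha using fun y => htens x y ((tproj (topAt Q P) hW y).hom.app _ t)
    refine ⟨∑ y : nzSet (topAt Q P), a y, ?_⟩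
    have h1 : t = ∑ y : nzSet (topAt Q P), (tinj (topAt Q P) hW y).hom.app _
        ((tproj (topAt Q P) hW y).hom.app _ t) := by
      have := congrArg (fun θ : T ⟶ T => θ.hom.app _ t) (tsum_total (topAt Q P) hW)
      rw [fd_sum_apply] at this
      exact this.symm
    have h2 : ι x (∑ y : nzSet (topAt Q P), a y) = ∑ y : nzSet (topAt Q P), ι x (a y) :=
      map_sum (tensVal (tinj (topAt Q P) hW x)) _ _
    rw [h2, map_sum]
    conv_lhs => rw [h1, map_sum]
    refine Finset.sum_congr rfl fun y _ => ?_
    rw [← sub_eq_zero, ← map_sub, topMk_eq_zero]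
    exact ha y
  -- hence the kernel of `π` is contained in the radical
  have hker : ∀ x (t : T.obj.obj (Q.pt x)), π.hom.app _ t = 0 → t ∈ radAt Q T x := by
    intro x t ht
    obtain ⟨a, ha⟩ := htop x t
    rw [← sub_eq_zero, ← map_sub, topMk_eq_zero] at ha
    have h1 := apply_mem_radAt Q π ha
    rw [map_sub, ht, hπ, zero_sub, neg_mem_iff, ← topMk_eq_zero, hs'] at h1
    have h2 : ι x 0 = 0 := map_zero (tensVal (tinj (topAt Q P) hW x))
    rwa [h1, h2, sub_zero] at ha
  obtain ⟨σ, hσ⟩ : ∃ σ : P ⟶ T, σ ≫ π = 𝟙 P :=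
    ⟨Projective.factorThru (𝟙 P) π, Projective.factorThru_comp _ _⟩
  have he : 𝟙 T - π ≫ σ = 0 := by
    refine fd_zero_of_vertex Q fun x t => ?_
    have hmem : ∀ y (t : T.obj.obj (Q.pt y)), (𝟙 T - π ≫ σ).hom.app _ t ∈ radAt Q T y :=
      fun y t => hker y _ (by
        change ((𝟙 T - π ≫ σ) ≫ π).hom.app _ t = 0
        have : (𝟙 T - π ≫ σ) ≫ π = 0 := by simp [hσ]
        rw [this]; rfl)
    have hidem : (𝟙 T - π ≫ σ) ≫ (𝟙 T - π ≫ σ) = 𝟙 T - π ≫ σ := by simp [reassoc_of% hσ]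
    have hzero : ∀ r ∈ radAt Q T x, (𝟙 T - π ≫ σ).hom.app _ r = 0 := by
      refine radAt_induction Q (map_zero _) (fun y α b => ?_) (fun a b ha hb => ?_)
      · rw [fd_naturality, map_radAt_eq_zero Q α (hmem y b)]
      · rw [map_add, ha, hb, add_zero]
    rw [← hidem]
    exact hzero _ (hmem x t)
  exact ⟨⟨π, σ, (sub_eq_zero.1 he).symm, hσ⟩⟩

end Projectives

/-! ### Matrices of homomorphisms -/

section Matrices

variable {k : Type w} [Field k] {A : Type u} [Category.{v} A] [Preadditive A] [Linear k A]
  [IsLofd k A] {Q : QuiverOf.{w, v, u, w₁, w₂} k A}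

variable {W W' W'' : Q.V → ModuleCat.{v} k} {hW : ∀ x, Module.Finite k (W x)}
  {hW' : ∀ x, Module.Finite k (W' x)} {hW'' : ∀ x, Module.Finite k (W'' x)}
  [Finite (nzSet W)] [Finite (nzSet W')] [Finite (nzSet W'')]

theorem tsum_entry_ext {θ θ' : tsum W hW ⟶ tsum W' hW'}
    (h : ∀ y x, tinj W hW y ≫ θ ≫ tproj W' hW' x = tinj W hW y ≫ θ' ≫ tproj W' hW' x) : θ = θ' :=
  tsum_hom_ext fun y => tsum_hom_ext' fun x => by
    rw [Category.assoc, Category.assoc]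
    exact h y x

/-- Radical maps between direct sums of the modules `A^x ⊗ W` compose to zero. -/
theorem comp_eq_zero_of_isRadical [IsAlgClosed k] [HasRadicalSquareZero A]
    {θ : tsum W hW ⟶ tsum W' hW'} {θ' : tsum W' hW' ⟶ tsum W'' hW''} (h : IsRadical θ)
    (h' : IsRadical θ') : θ ≫ θ' = 0 := by
  let := Fintype.ofFinite (nzSet W')
  refine tsum_entry_ext fun y x => ?_
  rw [← Category.id_comp θ', ← tsum_total W' hW', Preadditive.sum_comp, Preadditive.comp_sum,
    Preadditive.sum_comp, Preadditive.comp_sum, zero_comp, comp_zero]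
  refine Finset.sum_eq_zero fun z _ => ?_
  obtain ⟨φ, hφ⟩ := exists_eq_arrSum_of_isRadical (hW y) (hW' z) _
    ((h.comp_right (tproj W' hW' z)).comp_left (tinj W hW y))
  obtain ⟨ψ, hψ⟩ := exists_eq_arrSum_of_isRadical (hW' z) (hW'' x) _
    ((h'.comp_right (tproj W'' hW'' x)).comp_left (tinj W' hW' z))
  have : tinj W hW y ≫ (θ ≫ (tproj W' hW' z ≫ tinj W' hW' z) ≫ θ') ≫ tproj W'' hW'' x =
    (tinj W hW y ≫ θ ≫ tproj W' hW' z) ≫ tinj W' hW' z ≫ θ' ≫ tproj W'' hW'' x := by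
      simp only [Category.assoc]
  rw [this, hφ, hψ]
  simp only [arrSum, Preadditive.sum_comp, Preadditive.comp_sum]
  exact Finset.sum_eq_zero fun α _ => Finset.sum_eq_zero fun β _ =>
    tensMap_comp_eq_zero _ _ _ _ _ _ _
      (HasRadicalSquareZero.comp_eq_zero _ _ (Q.isRadical_mor _) (Q.isRadical_mor _))

theorem tensMap_arrSum {x y : Q.V} {U U' U'' : ModuleCat.{v} k} (hU : Module.Finite k U)
    (hU' : Module.Finite k U') (hU'' : Module.Finite k U'') (g : U →ₗ[k] U')
    (φ : Q.Arr x y → (U' →ₗ[k] U'')) :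
    tensMap (𝟙 _) hU hU' g ≫ arrSum Q hU' hU'' φ = arrSum Q hU hU'' fun α => φ α ∘ₗ g := by
  simp only [arrSum, Preadditive.comp_sum, tensMap_comp, Category.comp_id]

theorem arrSum_tensMap {x y : Q.V} {U U' U'' : ModuleCat.{v} k} (hU : Module.Finite k U)
    (hU' : Module.Finite k U') (hU'' : Module.Finite k U'') (g : U' →ₗ[k] U'')
    (φ : Q.Arr x y → (U →ₗ[k] U')) :
    arrSum Q hU hU' φ ≫ tensMap (𝟙 _) hU' hU'' g = arrSum Q hU hU'' fun α => g ∘ₗ φ α := by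
  simp only [arrSum, Preadditive.sum_comp, tensMap_comp, Category.id_comp]

/-- Linear maps commute with matrices with entries `∑_α A^α ⊗ φ_α` if and only if they commute with
the linear maps `φ_α`. This is what makes maps of complexes correspond to homomorphisms of
representations. -/
theorem tmap_comm_iff {U U' : Q.V → ModuleCat.{v} k} {hU : ∀ x, Module.Finite k (U x)}
    {hU' : ∀ x, Module.Finite k (U' x)} [Finite (nzSet U)] [Finite (nzSet U')]
    {δ : tsum W hW ⟶ tsum W' hW'} {δ' : tsum U hU ⟶ tsum U' hU'}
    {φ : ∀ y x, Q.Arr x y → (W y →ₗ[k] W' x)} {φ' : ∀ y x, Q.Arr x y → (U y →ₗ[k] U' x)}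
    (hδ : ∀ y x, tinj W hW y ≫ δ ≫ tproj W' hW' x = arrSum Q (hW y) (hW' x) (φ y x))
    (hδ' : ∀ y x, tinj U hU y ≫ δ' ≫ tproj U' hU' x = arrSum Q (hU y) (hU' x) (φ' y x))
    (g : ∀ x, W x →ₗ[k] U x) (g' : ∀ x, W' x →ₗ[k] U' x) :
    tmap W hW U hU g ≫ δ' = δ ≫ tmap W' hW' U' hU' g' ↔
      ∀ y x (α : Q.Arr x y), φ' y x α ∘ₗ g y = g' x ∘ₗ φ y x α := by
  have h1 : ∀ y x, tinj W hW y ≫ (tmap W hW U hU g ≫ δ') ≫ tproj U' hU' x =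
      arrSum Q (hW y) (hU' x) fun α => φ' y x α ∘ₗ g y := fun y x => by
    rw [Category.assoc, ← Category.assoc, tinj_tmap, Category.assoc, hδ', tensMap_arrSum]
  have h2 : ∀ y x, tinj W hW y ≫ (δ ≫ tmap W' hW' U' hU' g') ≫ tproj U' hU' x =
      arrSum Q (hW y) (hU' x) fun α => g' x ∘ₗ φ y x α := fun y x => by
    rw [Category.assoc, tmap_tproj, ← Category.assoc δ, ← Category.assoc, hδ, arrSum_tensMap]
  refine ⟨fun h y x α => ?_, fun h => tsum_entry_ext fun y x => ?_⟩
  · have h3 := h1 y x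
    rw [h, h2, ← sub_eq_zero, ← arrSum_sub] at h3
    exact (sub_eq_zero.1 (eq_zero_of_arrSum _ _ _ h3 α)).symm
  · rw [h1, h2]
    simp only [h]

theorem tmap_id : tmap W hW W hW (fun _ => LinearMap.id) = 𝟙 _ :=
  tsum_hom_ext fun x => by rw [tinj_tmap, tensMap_id, Category.id_comp, Category.comp_id]

theorem tmap_comp (g : ∀ x, W x →ₗ[k] W' x) (g' : ∀ x, W' x →ₗ[k] W'' x) :
    tmap W hW W' hW' g ≫ tmap W' hW' W'' hW'' g' = tmap W hW W'' hW'' fun x => g' x ∘ₗ g x :=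
  tsum_hom_ext fun x => by
    rw [← Category.assoc, tinj_tmap, Category.assoc, tinj_tmap, tinj_tmap, ← Category.assoc,
      tensMap_comp, Category.comp_id]

theorem tmap_sub (g g' : ∀ x, W x →ₗ[k] W' x) :
    tmap W hW W' hW' (fun x => g x - g' x) = tmap W hW W' hW' g - tmap W hW W' hW' g' :=
  tsum_hom_ext fun x => by
    rw [Preadditive.comp_sub, tinj_tmap, tinj_tmap, tinj_tmap, tensMap_sub, Preadditive.sub_comp]

end Matrices

/-! ### Representations of the unrolled quiver and the functor `F` -/

namespace QuiverOf

variable {k : Type w} [Field k] {A : Type u} [Category.{v} A] [Preadditive A] [Linear k A]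

section Rep

variable {Q : QuiverOf.{w, v, u, w₁, w₂} k A}

/-- The linear map `M(x, n) → M'(x, n)` of a homomorphism of representations. -/
def FDRep.app {M M' : FDRep.{w, v, u, w₁, w₂} Q} (g : M ⟶ M') (n : ℤ) (x : Q.V) :
    M.sp x n →ₗ[k] M'.sp x n :=
  (g.hom.app ((Paths.of Q.Box).obj (x, n))).hom

theorem FDRep.lin_app {M M' : FDRep.{w, v, u, w₁, w₂} Q} (g : M ⟶ M') {x y : Q.V}
    (α : Q.Arr x y) (n m : ℤ) (h : m = n - 1) :
    M'.lin α n m h ∘ₗ FDRep.app g n y = FDRep.app g m x ∘ₗ M.lin α n m h :=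
  (congrArg ModuleCat.Hom.hom
    (g.hom.naturality ((Paths.of Q.Box).map (Q.boxArr α n m h)))).symm

theorem FDRep.app_id (M : FDRep.{w, v, u, w₁, w₂} Q) (n : ℤ) :
    FDRep.app (𝟙 M) n = fun _ => LinearMap.id := rfl

theorem FDRep.app_comp {M M' M'' : FDRep.{w, v, u, w₁, w₂} Q} (g : M ⟶ M') (g' : M' ⟶ M'')
    (n : ℤ) : FDRep.app (g ≫ g') n = fun x => FDRep.app g' n x ∘ₗ FDRep.app g n x := rfl

theorem FDRep.app_sub {M M' : FDRep.{w, v, u, w₁, w₂} Q} (g g' : M ⟶ M')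
    (n : ℤ) : FDRep.app (g - g') n = fun x => FDRep.app g n x - FDRep.app g' n x := rfl

theorem FDRep.hom_ext {M M' : FDRep.{w, v, u, w₁, w₂} Q} {g g' : M ⟶ M'}
    (h : ∀ n x, FDRep.app g n x = FDRep.app g' n x) : g = g' := by
  refine InducedCategory.hom_ext (NatTrans.ext (funext fun p => ModuleCat.hom_ext ?_))
  exact h p.2 p.1

/-- A homomorphism of representations from linear maps which commute with those of the arrows. -/
theorem FDRep.exists_hom {M M' : FDRep.{w, v, u, w₁, w₂} Q}
    (g : ∀ n x, M.sp x n →ₗ[k] M'.sp x n)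
    (hg : ∀ {x y : Q.V} (α : Q.Arr x y) (n m : ℤ) (h : m = n - 1),
      M'.lin α n m h ∘ₗ g n y = g m x ∘ₗ M.lin α n m h) :
    ∃ f : M ⟶ M', ∀ n x, FDRep.app f n x = g n x := by
  let app : ∀ p : Paths Q.Box, M.obj.obj p ⟶ M'.obj.obj p := fun p =>
    ModuleCat.ofHom (g p.2 p.1)
  have nat : ∀ {p p' : Paths Q.Box} (f : p ⟶ p'),
      M.obj.map f ≫ app p' = app p ≫ M'.obj.map f := by
    refine Paths.induction (fun {p p'} f => M.obj.map f ≫ app p' = app p ≫ M'.obj.map f)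
      (fun {p} => ?_) (fun {p q r} f a hf => ?_)
    · rw [M.obj.map_id, M'.obj.map_id, Category.id_comp, Category.comp_id]
    · have h1 : M.obj.map ((Paths.of Q.Box).map a) ≫ app ((Paths.of Q.Box).obj r) =
          app ((Paths.of Q.Box).obj q) ≫ M'.obj.map ((Paths.of Q.Box).map a) := by
        obtain ⟨y, n⟩ := q
        obtain ⟨x, m⟩ := r
        exact ModuleCat.hom_ext (hg a.1 n m a.2).symm
      rw [M.obj.map_comp, M'.obj.map_comp, Category.assoc, h1, reassoc_of% hf]
  exact ⟨ObjectProperty.homMk { app := app, naturality := fun _ _ f => nat f }, fun n x => rfl⟩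

/-- The representation with prescribed spaces and linear maps. -/
def mkRep (W : ℤ → Q.V → ModuleCat.{v} k) (hW : ∀ n x, Module.Finite k (W n x))
    (hfin : {p : Q.V × ℤ | Nontrivial (W p.2 p.1)}.Finite)
    (φ : ∀ (n m : ℤ) (_ : m = n - 1) (y x : Q.V), Q.Arr x y → (W n y →ₗ[k] W m x)) :
    FDRep.{w, v, u, w₁, w₂} Q where
  obj := Paths.lift (V := Q.Box)
    { obj := fun p => W (show Q.V × ℤ from p).2 (show Q.V × ℤ from p).1
      map := fun a => ModuleCat.ofHom (φ _ _ a.2 _ _ a.1) }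
  property := ⟨fun p => hW (show Q.V × ℤ from p).2 (show Q.V × ℤ from p).1, hfin⟩

end Rep

section FFunctor

variable [IsLofd k A] {Q : QuiverOf.{w, v, u, w₁, w₂} k A}

instance (M : FDRep.{w, v, u, w₁, w₂} Q) (n : ℤ) : Finite (nzSet fun x => M.sp x n) :=
  finite_supp M n

/-- The module `⨁ₓ A^x ⊗ M(x, n)`, as a special case of `tsum`. -/
abbrev FSum (M : FDRep.{w, v, u, w₁, w₂} Q) (n : ℤ) : FDModule k A :=
  tsum (fun x => M.sp x n) (fun x => M.finite_sp x n)

/-- The differential of `F(M)` as a homomorphism between direct sums of the form `tsum`. -/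
def FDiff (M : FDRep.{w, v, u, w₁, w₂} Q) (n m : ℤ) (h : m = n - 1) : FSum M n ⟶ FSum M m :=
  FD M n m h

/-- The entries of the differential of `F(M)`. For vertices outside the supports both sides are maps
from or to a zero module. -/
theorem FDiff_entry (M : FDRep.{w, v, u, w₁, w₂} Q) (n m : ℤ) (h : m = n - 1) (y x : Q.V) :
    tinj (fun x => M.sp x n) (fun x => M.finite_sp x n) y ≫ FDiff M n m h ≫
      tproj (fun x => M.sp x m) (fun x => M.finite_sp x m) x =
    arrSum Q (M.finite_sp y n) (M.finite_sp x m) fun α => M.lin α n m h := by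
  by_cases hy : Nontrivial (M.sp y n)
  · by_cases hx : Nontrivial (M.sp x m)
    · rw [tinj_coe (fun x => M.sp x n) _ ⟨y, hy⟩, tproj_coe (fun x => M.sp x m) _ ⟨x, hx⟩]
      refine (biproduct.ι_desc_assoc (fun y : supp M n => biproduct.lift fun x : supp M m =>
        FComp M n m h y x) ⟨y, hy⟩ _).trans ?_
      exact biproduct.lift_π (fun x : supp M m => FComp M n m h y x) ⟨x, hx⟩
    · exact (isZero_tens _ _ _ hx).eq_of_tgt _ _
  · exact (isZero_tens _ _ _ hy).eq_of_src _ _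

/-- The homomorphism `⨁ₓ A^x ⊗ g(x, n)`. -/
def FSumMap {M M' : FDRep.{w, v, u, w₁, w₂} Q} (g : M ⟶ M') (n : ℤ) : FSum M n ⟶ FSum M' n :=
  tmap _ _ _ _ (FDRep.app g n)

theorem FSumMap_comm {M M' : FDRep.{w, v, u, w₁, w₂} Q} (g : M ⟶ M') (n m : ℤ) (h : m = n - 1) :
    FSumMap g n ≫ FDiff M' n m h = FDiff M n m h ≫ FSumMap g m :=
  (tmap_comm_iff (FDiff_entry M n m h) (FDiff_entry M' n m h) _ _).2
      fun _ _ α => FDRep.lin_app g α _ _ _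

theorem FSumMap_id (M : FDRep.{w, v, u, w₁, w₂} Q) (n : ℤ) : FSumMap (𝟙 M) n = 𝟙 _ := by
  rw [FSumMap, FDRep.app_id, tmap_id]

theorem FSumMap_comp {M M' M'' : FDRep.{w, v, u, w₁, w₂} Q} (g : M ⟶ M') (g' : M' ⟶ M'') (n : ℤ) :
    FSumMap (g ≫ g') n = FSumMap g n ≫ FSumMap g' n := by
  simp only [FSumMap, FDRep.app_comp, tmap_comp]

theorem FSumMap_sub {M M' : FDRep.{w, v, u, w₁, w₂} Q} (g g' : M ⟶ M') (n : ℤ) :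
    FSumMap (g - g') n = FSumMap g n - FSumMap g' n := by
  simp only [FSumMap, FDRep.app_sub, tmap_sub]

variable [HasRadicalSquareZero A]

theorem isRadical_FDiff (M : FDRep.{w, v, u, w₁, w₂} Q) (n m : ℤ)
    (h : m = n - 1) : IsRadical (FDiff M n m h) :=
  isRadical_tsum _ fun y x => by
    rw [FDiff_entry]
    exact isRadical_arrSum _ _ _

theorem F_d (M : FDRep.{w, v, u, w₁, w₂} Q) (i j : ℤ) (h : i + 1 = j) :
    (F M).d i j = FDiff M (-i) (-j) (by omega) := dif_pos h

theorem isRadical_F_d (M : FDRep.{w, v, u, w₁, w₂} Q) (i j : ℤ) : IsRadical ((F M).d i j) := by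
  by_cases h : i + 1 = j
  · rw [F_d M i j h]
    exact isRadical_FDiff M (-i) (-j) (by omega)
  · rw [(F M).shape i j h]
    exact isRadical_zero _ _

instance projective_F (M : FDRep.{w, v, u, w₁, w₂} Q) (i : ℤ) : Projective ((F M).X i) :=
  projective_tsum (fun x => M.sp x (-i)) (fun x => M.finite_sp x (-i))

/-- The homomorphism of complexes `F(g)`. -/
def FMap {M M' : FDRep.{w, v, u, w₁, w₂} Q} (g : M ⟶ M') : F M ⟶ F M' where
  f i := FSumMap g (-i)
  comm' i j h := by
    rw [F_d M i j h, F_d M' i j h]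
    exact FSumMap_comm ..

theorem FMap_id (M : FDRep.{w, v, u, w₁, w₂} Q) : FMap (𝟙 M) = 𝟙 (F M) :=
  HomologicalComplex.hom_ext _ _ fun i => FSumMap_id M (-i)

theorem FMap_comp {M M' M'' : FDRep.{w, v, u, w₁, w₂} Q} (g : M ⟶ M') (g' : M' ⟶ M'') :
    FMap (g ≫ g') = FMap g ≫ FMap g' :=
  HomologicalComplex.hom_ext _ _ fun i => FSumMap_comp g g' (-i)

theorem FMap_sub {M M' : FDRep.{w, v, u, w₁, w₂} Q} (g g' : M ⟶ M') :
    FMap (g - g') = FMap g - FMap g' :=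
  HomologicalComplex.hom_ext _ _ fun i => FSumMap_sub g g' (-i)

/-- The functor `F` is faithful modulo the radical. -/
theorem eq_zero_of_isRadical_FMap {M M' : FDRep.{w, v, u, w₁, w₂} Q} (g : M ⟶ M')
    (h : ∀ i, IsRadical ((FMap g).f i)) : g = 0 := by
  refine FDRep.hom_ext fun n x => ?_
  obtain ⟨i, rfl⟩ : ∃ i : ℤ, n = -i := ⟨-n, by omega⟩
  exact eq_zero_of_isRadical_tmap _ (fun x => M.finite_sp x _) _ (fun x => M'.finite_sp x _)
    _ (h i) x

/-- A family indexed by `-i` is a family indexed by `n`. It serves to pass between the degrees `i`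
of a cochain complex and the degrees `n = -i` of `F(M)`. -/
theorem exists_reindex_neg {P : ℤ → Sort*} (g : ∀ i, P (-i)) :
    ∃ G : ∀ n, P n, ∀ i, G (-i) = g i := by
  refine ⟨fun n => cast (congrArg P (neg_neg n)) (g (-n)), fun i => ?_⟩
  rw [cast_eq_iff_heq]
  exact congr_arg_heq g (neg_neg i)

/-- The functor `F` is full modulo the radical: the linear maps that represent a map of complexes
modulo the radical commute with the differentials, because radical maps are annihilated by them. -/
theorem exists_FMap [IsAlgClosed k] {M M' : FDRep.{w, v, u, w₁, w₂} Q} (s : F M ⟶ F M') :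
    ∃ g : M ⟶ M', ∀ i, IsRadical ((s - FMap g).f i) := by
  let t : ∀ i, FSum M (-i) ⟶ FSum M' (-i) := s.f
  choose g hg using fun i => exists_tmap _ _ _ _ (t i)
  obtain ⟨G, hG⟩ := exists_reindex_neg (P := fun n => ∀ x, M.sp x n →ₗ[k] M'.sp x n) g
  obtain ⟨f, hf⟩ := FDRep.exists_hom G fun {x y} α n m h => by
    obtain ⟨i, rfl⟩ : ∃ i : ℤ, n = -i := ⟨-n, by omega⟩
    obtain ⟨j, rfl⟩ : ∃ i : ℤ, m = -i := ⟨-m, by omega⟩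
    rw [hG, hG]
    refine (tmap_comm_iff (FDiff_entry M (-i) (-j) h) (FDiff_entry M' (-i) (-j) h) _ _).1 ?_ y x α
    have h1 : t i ≫ FDiff M' (-i) (-j) h = FDiff M (-i) (-j) h ≫ t j := by
      have := s.comm i j
      rwa [F_d M i j (by omega), F_d M' i j (by omega)] at this
    have h2 := comp_eq_zero_of_isRadical (hg i) (isRadical_FDiff M' (-i) (-j) h)
    have h3 := comp_eq_zero_of_isRadical (isRadical_FDiff M (-i) (-j) h) (hg j)
    rw [Preadditive.sub_comp, sub_eq_zero] at h2
    rw [Preadditive.comp_sub, sub_eq_zero] at h3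
    exact h2.symm.trans (h1.trans h3)
  refine ⟨f, fun i => ?_⟩
  have h1 : FSumMap f (-i) = tmap _ _ _ _ (g i) := by
    rw [← hG, FSumMap]
    congr 1
    exact funext fun x => hf _ _
  have h2 : IsRadical (t i - FSumMap f (-i)) := by
    rw [h1]
    exact hg i
  exact h2

/-- Every bounded complex of projective modules with radical differentials is of the form
`F(M)`, where the spaces `M(x, n)` are the tops of its terms and the maps `M(α, n)` are the
coefficients of its differentials. -/
theorem exists_iso_F [IsAlgClosed k] (Q : QuiverOf.{w, v, u, w₁, w₂} k A)
    (P : CochainComplex (FDModule k A) ℤ) (hP : IsBoundedCx P)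
    (hproj : ∀ i, Projective (P.X i)) (hrad : ∀ i j, IsRadical (P.d i j)) :
    ∃ M : FDRep.{w, v, u, w₁, w₂} Q, Nonempty (F M ≅ P) := by
  let W : ℤ → Q.V → ModuleCat.{v} k := fun n => topAt Q (P.X (-n))
  have hW : ∀ n x, Module.Finite k (W n x) := fun n x => inferInstance
  have : ∀ n, Finite (nzSet (W n)) := fun n => inferInstance
  have e : ∀ n, tsum (W n) (hW n) ≅ P.X (-n) := fun n => (nonempty_iso_tsum_topAt Q _).some
  have hfin : {p : Q.V × ℤ | Nontrivial (W p.2 p.1)}.Finite := by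
    obtain ⟨⟨a, ha⟩, b, hb⟩ := hP
    refine ((Set.finite_Icc (-b) (-a)).biUnion fun n _ =>
      ((Set.toFinite (nzSet (W n))).image fun x => (x, n))).subset ?_
    rintro ⟨x, n⟩ hx
    have h1 : ¬ IsZero (P.X (-n)) := fun h => by
      have h2 : Nontrivial ((P.X (-n)).obj.obj (Q.pt x)) := nzSet_topAt_subset Q _ hx
      obtain ⟨a, ha⟩ := exists_ne (0 : (P.X (-n)).obj.obj (Q.pt x))
      exact ha (congrArg (fun θ : P.X (-n) ⟶ P.X (-n) => θ.hom.app (Q.pt x) a)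
        ((IsZero.iff_id_eq_zero _).1 h))
    refine Set.mem_biUnion (x := n) ⟨?_, ?_⟩ ⟨x, hx, rfl⟩
    · by_contra hn
      exact h1 (P.isZero_of_isStrictlyLE b _ (by omega))
    · by_contra hn
      exact h1 (P.isZero_of_isStrictlyGE a _ (by omega))
  let δ : ∀ n m, tsum (W n) (hW n) ⟶ tsum (W m) (hW m) := fun n m =>
    (e n).hom ≫ P.d (-n) (-m) ≫ (e m).inv
  have hδ : ∀ n m, IsRadical (δ n m) := fun n m =>
    ((hrad _ _).comp_right _).comp_left _
  choose φ hφ using fun n m y x => exists_eq_arrSum_of_isRadical (hW n y) (hW m x) _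
    (((hδ n m).comp_right (tproj (W m) (hW m) x)).comp_left (tinj (W n) (hW n) y))
  let M := mkRep W hW hfin fun n m _ => φ n m
  have hM : ∀ n m h, FDiff M n m h = δ n m := fun n m h => by
    refine tsum_entry_ext fun y x => ?_
    rw [FDiff_entry]
    refine Eq.trans ?_ (hφ n m y x).symm
    congr 1
  refine ⟨M, ⟨HomologicalComplex.Hom.isoOfComponents
    (fun i => e (-i) ≪≫ P.XIsoOfEq (neg_neg i)) fun i j hij => ?_⟩⟩
  have h1 : (e (-i) ≪≫ P.XIsoOfEq (neg_neg i)).hom ≫ P.d i j =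
      δ (-i) (-j) ≫ (e (-j) ≪≫ P.XIsoOfEq (neg_neg j)).hom := by simp [δ]
  have h2 : (F M).d i j = δ (-i) (-j) := (F_d M i j hij).trans (hM _ _ _)
  exact h1.trans (congrArg (fun t => t ≫ (e (-j) ≪≫ P.XIsoOfEq (neg_neg j)).hom) h2.symm)

end FFunctor
end QuiverOf

/-! ### The truncation of a complex with a kernel added -/

section Trunc

variable {k : Type w} [Field k] {A : Type u} [Category.{v} A] [Preadditive A] [Linear k A]
  (K : CochainComplex (FDModule k A) ℤ) (p : ℤ)

/-- The complex `truncAt K p`, before its extension to a complex indexed by `ℤ`. -/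
def truncAug : CochainComplex (FDModule k A) ℕ :=
  CochainComplex.augment (K.restriction (ComplexShape.embeddingUpIntGE p))
    (kernel.ι ((K.restriction (ComplexShape.embeddingUpIntGE p)).d 0 1)) (kernel.condition _)

theorem truncAt_eq :
    truncAt K p = (truncAug K p).extend (ComplexShape.embeddingUpIntGE (p - 1)) := rfl

/-- The positive terms of `truncAug K p`. -/
def truncAugXIso (n : ℕ) (i : ℤ) (h : p + n = i) : (truncAug K p).X (n + 1) ≅ K.X i :=
  K.XIsoOfEq h

theorem truncAugXIso_d (n : ℕ) (i j : ℤ) (hi : p + n = i) (hj : p + (n + 1 : ℕ) = j) :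
    (truncAugXIso K p n i hi).hom ≫ K.d i j =
      (truncAug K p).d (n + 1) (n + 1 + 1) ≫ (truncAugXIso K p (n + 1) j hj).hom :=
  (K.XIsoOfEq_hom_comp_d hi j).trans (K.d_comp_XIsoOfEq_hom hj _).symm

theorem exists_truncAug_kernel : ∃ κ : (truncAug K p).X 0 ≅ kernel (K.d p (p + 1)),
    (truncAug K p).d 0 1 ≫ (truncAugXIso K p 0 p (by simp)).hom = κ.hom ≫ kernel.ι _ := by
  have h0 : p + ((0 : ℕ) : ℤ) = p := by simp
  have h1 : p + ((1 : ℕ) : ℤ) = p + 1 := by simp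
  refine ⟨kernel.mapIso ((K.restriction (ComplexShape.embeddingUpIntGE p)).d 0 1) (K.d p (p + 1))
      (K.XIsoOfEq h0) (K.XIsoOfEq h1) ?_, ?_⟩
  · exact (K.d_comp_XIsoOfEq_hom h1 _).trans (K.XIsoOfEq_hom_comp_d h0 _).symm
  · exact (kernel.lift_ι _ _ _).symm

/-- The terms of `truncAt K p` in degrees `i ≥ p`. -/
def truncXIso (n : ℕ) (i : ℤ) (h : p + n = i) : (truncAt K p).X i ≅ K.X i :=
  (truncAug K p).extendXIso (ComplexShape.embeddingUpIntGE (p - 1)) (i := n + 1)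
    (by simp only [ComplexShape.embeddingUpIntGE_f]; push_cast; omega) ≪≫ truncAugXIso K p n i h

theorem truncXIso_d (n : ℕ) (i j : ℤ) (hi : p + n = i) (hj : p + (n + 1 : ℕ) = j) :
    (truncXIso K p n i hi).hom ≫ K.d i j =
      (truncAt K p).d i j ≫ (truncXIso K p (n + 1) j hj).hom := by
  have h1 := (truncAug K p).extend_d_eq (ComplexShape.embeddingUpIntGE (p - 1))
    (i := n + 1) (j := n + 1 + 1) (i' := i) (j' := j)
    (by simp only [ComplexShape.embeddingUpIntGE_f]; push_cast; omega)
    (by simp only [ComplexShape.embeddingUpIntGE_f]; push_cast; omega)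
  simp only [truncXIso, truncAt_eq, h1, Iso.trans_hom, Category.assoc, Iso.inv_hom_id_assoc]
  rw [truncAugXIso_d K p n i j hi hj]

/-- The term of `truncAt K p` in degree `p - 1`. -/
theorem exists_truncXIso_kernel :
    ∃ κ : (truncAt K p).X (p - 1) ≅ kernel (K.d p (p + 1)),
      (truncAt K p).d (p - 1) p ≫ (truncXIso K p 0 p (by simp)).hom = κ.hom ≫ kernel.ι _ := by
  have hi : (ComplexShape.embeddingUpIntGE (p - 1)).f 0 = p - 1 := by
    simp only [ComplexShape.embeddingUpIntGE_f]; push_cast; omega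
  have hj : (ComplexShape.embeddingUpIntGE (p - 1)).f 1 = p := by
    simp only [ComplexShape.embeddingUpIntGE_f]; push_cast; omega
  obtain ⟨κ, hκ⟩ := exists_truncAug_kernel K p
  refine ⟨(truncAug K p).extendXIso _ hi ≪≫ κ, ?_⟩
  simp only [truncXIso, truncAt_eq, (truncAug K p).extend_d_eq _ hi hj, Iso.trans_hom,
    Category.assoc]
  rw [← hκ]
  simp

instance : (truncAt K p).IsStrictlyGE (p - 1) := by
  unfold truncAt; infer_instance

theorem exactAt_truncAt (i : ℤ) (hi : i ≤ p) : (truncAt K p).ExactAt i := by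
  obtain ⟨κ, hκ⟩ := exists_truncXIso_kernel K p
  set τ := truncXIso K p 0 p (by simp) with hτ
  have hd : (truncAt K p).d (p - 1) p = κ.hom ≫ kernel.ι (K.d p (p + 1)) ≫ τ.inv := by
    rw [← Category.assoc, ← hκ, Category.assoc, Iso.hom_inv_id, Category.comp_id]
  have hmono : Mono ((truncAt K p).d (p - 1) p) := by
    rw [hd]; infer_instance
  rcases lt_trichotomy i (p - 1) with h | h | h
  · exact (HomologicalComplex.exactAt_iff _ _).2 (ShortComplex.exact_of_isZero_X₂ _
      ((truncAt K p).isZero_of_isStrictlyGE (p - 1) i h))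
  · subst h
    rw [HomologicalComplex.exactAt_iff' _ (p - 1 - 1) (p - 1) p (by simp) (by simp)]
    rw [ShortComplex.exact_iff_mono]
    · exact hmono
    · exact ((truncAt K p).isZero_of_isStrictlyGE (p - 1) _ (by omega)).eq_of_src _ _
  · obtain rfl : i = p := by omega
    rw [HomologicalComplex.exactAt_iff' _ (i - 1) i (i + 1) (by simp) (by simp)]
    have : Mono ((truncAt K i).sc' (i - 1) i (i + 1)).f := hmono
    have lift : ∀ {X : FDModule k A} (x : X ⟶ (truncAt K i).X i)
        (_ : x ≫ (truncAt K i).d i (i + 1) = 0),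
        { l : X ⟶ (truncAt K i).X (i - 1) // l ≫ (truncAt K i).d (i - 1) i = x } := by
      intro X x hx
      have h1 : (x ≫ τ.hom) ≫ K.d i (i + 1) = 0 := by
        rw [Category.assoc, hτ, truncXIso_d K i 0 i (i + 1) (by simp) (by simp),
          ← Category.assoc, hx, zero_comp]
      refine ⟨kernel.lift _ _ h1 ≫ κ.inv, ?_⟩
      rw [hd]
      simp
    exact ShortComplex.exact_of_f_is_kernel _ (KernelFork.IsLimit.ofι' _ _ lift)

/-- The canonical morphism to the truncation. -/
theorem exists_toTruncAt (hK : K.IsStrictlyGE p) :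
    ∃ j : K ⟶ truncAt K p, ∀ i, p ≤ i → IsIso (j.f i) := by
  classical
  refine ⟨{ f := fun i => if h : p ≤ i then (truncXIso K p (i - p).toNat i (by omega)).inv else 0,
            comm' := fun i j hij => ?_ }, fun i hi => ?_⟩
  · obtain rfl : i + 1 = j := hij
    by_cases h : p ≤ i
    · rw [dif_pos h, dif_pos (by omega)]
      obtain ⟨n, hn⟩ : ∃ n : ℕ, (i - p).toNat = n := ⟨_, rfl⟩
      have hn' : (i + 1 - p).toNat = n + 1 := by omega
      simp only [hn, hn']
      rw [Iso.inv_comp_eq, ← Category.assoc, Iso.eq_comp_inv, truncXIso_d]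
    · exact (K.isZero_of_isStrictlyGE p i (by omega)).eq_of_src _ _
  · dsimp only
    rw [dif_pos hi]
    infer_instance

end Trunc

/-! ### The lowest degree of a complex -/

section Bottom

variable {k : Type w} [Field k] {A : Type u} [Category.{v} A] [Preadditive A] [Linear k A]

/-- The degree `bottom K` is characterized by the fact that `K` is nonzero in this degree and
vanishes below it. -/
theorem bottom_eq {K : CochainComplex (FDModule k A) ℤ} {p : ℤ} (hK : K.IsStrictlyGE p)
    (hp : ¬ IsZero (K.X p)) : bottom K = p := by
  refine IsGreatest.csSup_eq ⟨hK, fun q hq => ?_⟩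
  by_contra h
  have : K.IsStrictlyGE q := hq
  exact hp (K.isZero_of_isStrictlyGE q p (by omega))

theorem bottom_spec {K : CochainComplex (FDModule k A) ℤ} (hK : IsBoundedCx K) (h0 : ¬ IsZero K) :
    K.IsStrictlyGE (bottom K) ∧ ¬ IsZero (K.X (bottom K)) := by
  obtain ⟨⟨a, ha⟩, -⟩ := hK
  obtain ⟨i, hi⟩ : ∃ i, ¬ IsZero (K.X i) := by
    by_contra! h
    refine h0 ((IsZero.iff_id_eq_zero _).2 (HomologicalComplex.hom_ext _ _ fun i => ?_))
    exact (h i).eq_of_src _ _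
  obtain ⟨p, hp, hmin⟩ := Int.exists_least_of_bdd (P := fun i => ¬ IsZero (K.X i))
    ⟨a, fun i hi => by
      by_contra h
      exact hi (K.isZero_of_isStrictlyGE a i (by omega))⟩ ⟨i, hi⟩
  have hge : K.IsStrictlyGE p := by
    rw [CochainComplex.isStrictlyGE_iff]
    intro i hi
    by_contra h
    have := hmin i h
    omega
  rw [bottom_eq hge hp]
  exact ⟨hge, hp⟩

end Bottom

/-! ### Full subcategories, brutal truncations and acyclic complexes -/

section Generalities

/-- A full subcategory closed under retracts inherits the splitting of idempotents. -/
theorem isIdempotentComplete_fullSubcategory {C : Type u} [Category.{v} C]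
    [IsIdempotentComplete C] (P : ObjectProperty C)
    (hP : ∀ {X Y : C} (i : Y ⟶ X) (p : X ⟶ Y), i ≫ p = 𝟙 Y → P X → P Y) :
    IsIdempotentComplete P.FullSubcategory where
  idempotents_split X e he := by
    obtain ⟨Y, i, p, hip, hpi⟩ := IsIdempotentComplete.idempotents_split X.obj e.hom
      (congrArg InducedCategory.Hom.hom he)
    exact ⟨⟨Y, hP i p hip X.property⟩, ObjectProperty.homMk i, ObjectProperty.homMk p,
      InducedCategory.hom_ext hip, InducedCategory.hom_ext hpi⟩

theorem IsIndec.idem_fullSubcategory {C : Type u} [Category.{v} C] [Preadditive C]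
    {P : ObjectProperty C} [IsIdempotentComplete P.FullSubcategory] {X : P.FullSubcategory}
    (hX : IsIndec X) (e : X.obj ⟶ X.obj) (he : e ≫ e = e) : e = 0 ∨ e = 𝟙 X.obj :=
  (hX.idem (ObjectProperty.homMk e) (InducedCategory.hom_ext he)).imp
    (congrArg InducedCategory.Hom.hom) (congrArg InducedCategory.Hom.hom)

theorem isZero_of_isZero_obj {C : Type u} [Category.{v} C] [Preadditive C]
    {P : ObjectProperty C} {X : P.FullSubcategory} : IsZero X ↔ IsZero X.obj := by
  rw [IsZero.iff_id_eq_zero, IsZero.iff_id_eq_zero]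
  exact ⟨congrArg InducedCategory.Hom.hom, fun h => InducedCategory.hom_ext h⟩

variable {C : Type u} [Category.{v} C] [Abelian C]

theorem isStrictlyLE_brutal (P : CochainComplex C ℤ) (q b : ℤ) [P.IsStrictlyLE b] :
    (brutal P q).IsStrictlyLE b := by
  rw [CochainComplex.isStrictlyLE_iff]
  intro i hi
  have : Mono ((brutalι P q).f i) := inferInstanceAs (Mono (kernel.ι _))
  exact (P.isZero_of_isStrictlyLE b i hi).of_mono ((brutalι P q).f i)

instance projective_brutal (P : CochainComplex C ℤ) (q i : ℤ) [Projective (P.X i)] :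
    Projective ((brutal P q).X i) := by
  by_cases h : q < i
  · have := isIso_brutalι P q i h
    exact Projective.of_iso (asIso ((brutalι P q).f i)).symm inferInstance
  · exact Projective.of_iso (isZero_brutal P q i (by omega)).isoZero.symm inferInstance

theorem isRadical_d_brutal (P : CochainComplex C ℤ) (q : ℤ) (hP : ∀ i j, IsRadical (P.d i j))
    (i j : ℤ) : IsRadical ((brutal P q).d i j) := by
  by_cases h : i + 1 = j
  · by_cases hi : q < i
    · have := isIso_brutalι P q i hi
      have := isIso_brutalι P q j (by omega)
      exact isRadical_d_of_isIso' (brutalι P q) _ _ (hP _ _)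
    · rw [(isZero_brutal P q i (by omega)).eq_of_src ((brutal P q).d i j) 0]
      exact isRadical_zero _ _
  · rw [(brutal P q).shape i j h]
    exact isRadical_zero _ _

variable [HasDerivedCategory.{w₃} C]

open DerivedCategory

theorem isZero_Q_obj_iff {K : CochainComplex C ℤ} : IsZero (Q.obj K) ↔ K.Acyclic := by
  have h0 : IsZero (0 : CochainComplex C ℤ) := isZero_zero _
  have hex : ∀ i, (0 : CochainComplex C ℤ).ExactAt i := fun i =>
    (HomologicalComplex.exactAt_iff _ _).2 (ShortComplex.exact_of_isZero_X₂ _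
      ((HomologicalComplex.eval C _ i).map_isZero h0))
  have h1 : QuasiIso (0 : K ⟶ 0) ↔ K.Acyclic := by
    refine ⟨fun h i => (quasiIsoAt_iff_exactAt' 0 i (hex i)).1 inferInstance,
      fun h => ⟨fun i => (quasiIsoAt_iff_exactAt' 0 i (hex i)).2 (h i)⟩⟩
  have hQ : IsZero (Q.obj (0 : CochainComplex C ℤ)) := Q.map_isZero h0
  rw [← h1, ← isIso_Q_map_iff_quasiIso]
  refine ⟨fun h => ⟨0, h.eq_of_src _ _, hQ.eq_of_src _ _⟩, fun h => ?_⟩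
  exact hQ.of_iso (asIso (Q.map (0 : K ⟶ 0)))

end Generalities

/-! ### Complexes of modules and the bounded derived category -/

section Modules

variable {k : Type w} [Field k] {A : Type u} [Category.{v} A] [Preadditive A] [Linear k A]

/-- A complex of projectives is minimal if and only if its differentials are radical morphisms. -/
theorem isMinimalCx_iff [IsLofd k A] {K : CochainComplex (FDModule k A) ℤ}
    (hK : ∀ i, Projective (K.X i)) :
    IsMinimalCx K ↔ ∀ i j, IsRadical (K.d i j) :=
  ⟨fun h i j => isRadical_of_factors _ (h i j), fun h i j S hS =>
    have := hK j
    factors_of_isRadical _ (h i j) S hS⟩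

theorem IsBoundedCx.of_retract {K L : CochainComplex (FDModule k A) ℤ} (hK : IsBoundedCx K)
    (i : L ⟶ K) (p : K ⟶ L) (h : i ≫ p = 𝟙 L) : IsBoundedCx L := by
  obtain ⟨⟨a, ha⟩, b, hb⟩ := hK
  have hz : ∀ n, IsZero (K.X n) → IsZero (L.X n) := fun n hn => by
    rw [IsZero.iff_id_eq_zero, ← HomologicalComplex.id_f, ← h, HomologicalComplex.comp_f,
      hn.eq_of_tgt (i.f n) 0, zero_comp]
  refine ⟨⟨a, ?_⟩, b, ?_⟩
  · rw [CochainComplex.isStrictlyGE_iff]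
    exact fun n hn => hz n (K.isZero_of_isStrictlyGE a n hn)
  · rw [CochainComplex.isStrictlyLE_iff]
    exact fun n hn => hz n (K.isZero_of_isStrictlyLE b n hn)

instance isIdempotentComplete_pmin [IsLofd k A] : IsIdempotentComplete (PMin k A) :=
  isIdempotentComplete_fullSubcategory _ fun {K L} i p h ⟨h1, h2, h3⟩ => by
    have hL : ∀ n, Projective (L.X n) := fun n => by
      have hn : i.f n ≫ p.f n = 𝟙 _ := by
        rw [← HomologicalComplex.comp_f, h, HomologicalComplex.id_f]
      have := h2 n
      exact Retract.projective ⟨i.f n, p.f n, hn⟩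
    refine ⟨h1.of_retract i p h, hL, (isMinimalCx_iff hL).2 fun m n => ?_⟩
    have h4 : L.d m n = i.f m ≫ K.d m n ≫ p.f n := by
      rw [← p.comm, ← Category.assoc, ← HomologicalComplex.comp_f, h, HomologicalComplex.id_f,
        Category.id_comp]
    rw [h4]
    exact (((isMinimalCx_iff h2).1 h3 m n).comp_right _).comp_left _

theorem finite_hom_of_isBoundedCx [IsLofd k A] {K : CochainComplex (FDModule k A) ℤ}
    (hK : IsBoundedCx K) : Module.Finite k (K ⟶ K) := by
  obtain ⟨⟨a, ha⟩, b, hb⟩ := hK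
  let φ : (K ⟶ K) →ₗ[k] (∀ i : Set.Icc a b, K.X i ⟶ K.X i) :=
    { toFun := fun f i => f.f i, map_add' := fun _ _ => rfl, map_smul' := fun _ _ => rfl }
  refine Module.Finite.of_injective φ fun f g h => ?_
  ext n : 1
  by_cases h1 : n < a
  · exact (K.isZero_of_isStrictlyGE a n h1).eq_of_src _ _
  · by_cases h2 : b < n
    · exact (K.isZero_of_isStrictlyLE b n h2).eq_of_src _ _
    · exact congrFun h ⟨n, by omega, by omega⟩

theorem isKProjective_of_isBoundedCx {K : CochainComplex (FDModule k A) ℤ} {b : ℤ}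
    (hK : K.IsStrictlyLE b) (h : ∀ i, Projective (K.X i)) : K.IsKProjective :=
  CochainComplex.isKProjective_of_projective K b

variable [HasDerivedCategory.{w₃} (FDModule k A)]

open DerivedCategory

/-- The bounded derived category is a full subcategory of the derived category. -/
theorem nonempty_toDb_iso_iff {K L : CochainComplex (FDModule k A) ℤ} {hK : IsBoundedCx K}
    {hL : IsBoundedCx L} : Nonempty (toDb K hK ≅ toDb L hL) ↔ Nonempty (Q.obj K ≅ Q.obj L) :=
  ⟨fun ⟨e⟩ => ⟨(ObjectProperty.ι _).mapIso e⟩, fun ⟨e⟩ => ⟨ObjectProperty.isoMk _ e⟩⟩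

theorem isIndec_toDb {K : CochainComplex (FDModule k A) ℤ} (hK : IsBoundedCx K)
    (h0 : ¬ K.Acyclic) (h : ∀ e : Q.obj K ⟶ Q.obj K, e ≫ e = e → e = 0 ∨ e = 𝟙 _) :
    IsIndec (toDb K hK) := by
  refine isIndec_of_idem (fun hz => h0 (isZero_Q_obj_iff.1 (isZero_of_isZero_obj.1 hz)))
    fun e he => ?_
  exact (h e.hom (congrArg InducedCategory.Hom.hom he)).imp
    (fun h => InducedCategory.hom_ext h) (fun h => InducedCategory.hom_ext h)

/-- Idempotent endomorphisms of complexes become trivial in the derived category if the complex is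
indecomposable there. Only these idempotents are considered because they split already in the
category of complexes, so that splitting of idempotents in the derived category is not needed. -/
theorem Q_map_idem {K : CochainComplex (FDModule k A) ℤ} {hK : IsBoundedCx K}
    (hX : IsIndec (toDb K hK)) (e : K ⟶ K) (he : e ≫ e = e) : Q.map e = 0 ∨ Q.map e = 𝟙 _ := by
  obtain ⟨Y, i, p, hip, hpi⟩ := IsIdempotentComplete.idempotents_split K e he
  obtain ⟨Z, j, q, hjq, hqj⟩ := IsIdempotentComplete.idempotents_split K (𝟙 K - e) (by simp [he])
  have key := hX.eq_zero_or_of_split (e := ObjectProperty.homMk (Q.map e))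
    (e' := ObjectProperty.homMk (Q.map (𝟙 K - e)))
    (Y := toDb Y (hK.of_retract i p hip)) (Z := toDb Z (hK.of_retract j q hjq))
    (InducedCategory.hom_ext (by
      change Q.map e + Q.map (𝟙 K - e) = 𝟙 _
      rw [← Functor.map_add, add_sub_cancel, Q.map_id]))
    (i := ObjectProperty.homMk (Q.map i)) (p := ObjectProperty.homMk (Q.map p))
    (j := ObjectProperty.homMk (Q.map j)) (q := ObjectProperty.homMk (Q.map q))
    (InducedCategory.hom_ext (by
      change Q.map i ≫ Q.map p = 𝟙 _
      rw [← Q.map_comp, hip, Q.map_id]))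
    (InducedCategory.hom_ext (by
      change Q.map p ≫ Q.map i = Q.map e
      rw [← Q.map_comp, hpi]))
    (InducedCategory.hom_ext (by
      change Q.map j ≫ Q.map q = 𝟙 _
      rw [← Q.map_comp, hjq, Q.map_id]))
    (InducedCategory.hom_ext (by
      change Q.map q ≫ Q.map j = Q.map (𝟙 K - e)
      rw [← Q.map_comp, hqj]))
  rcases key with h | h
  · exact Or.inl (congrArg (fun t : toDb K hK ⟶ toDb K hK => t.hom) h)
  right
  have h1 : Q.map (𝟙 K - e) = 0 :=
    congrArg (fun t : toDb K hK ⟶ toDb K hK => t.hom) h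
  rw [Functor.map_sub, Q.map_id, sub_eq_zero] at h1
  exact h1.symm

/-- Every object of the bounded derived category has a minimal projective resolution, which is exact
in sufficiently low degrees. -/
theorem exists_minRes_toDb [IsLofd k A] (X : Db k A) :
    ∃ P : CochainComplex (FDModule k A) ℤ, (∃ b, P.IsStrictlyLE b) ∧
      (∀ i, Projective (P.X i)) ∧ (∀ i j, IsRadical (P.d i j)) ∧
      (∃ a, ∀ i < a, P.ExactAt i) ∧ Nonempty (X.obj ≅ Q.obj P) := by
  obtain ⟨⟨a, ha⟩, b, hb⟩ := X.property
  obtain ⟨K, hK, hK', ⟨e⟩⟩ := exists_iso_Q_obj_of_isGE_of_isLE X.obj a b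
  obtain ⟨P, f, h1, h2, h3, h4⟩ := exists_minRes (exists_projectiveCover k) K b
  refine ⟨P, ⟨b, h1⟩, h2, h3, ⟨a, fun i hi => ?_⟩, ⟨e ≪≫ (asIso (Q.map f)).symm⟩⟩
  have hex : K.ExactAt i := (HomologicalComplex.exactAt_iff _ _).2
    (ShortComplex.exact_of_isZero_X₂ _ (K.isZero_of_isStrictlyGE a i hi))
  exact (quasiIsoAt_iff_exactAt' f i hex).1 inferInstance

end Modules

/-! ### The complexes `F(M)` in the derived category -/

open DerivedCategory

section Representations

variable {k : Type w} [Field k] {A : Type u} [Category.{v} A] [Preadditive A] [Linear k A]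

namespace QuiverOf

instance isIdempotentComplete_fdRep (Q : QuiverOf.{w, v, u, w₁, w₂} k A) :
    IsIdempotentComplete (FDRep.{w, v, u, w₁, w₂} Q) :=
  isIdempotentComplete_fullSubcategory _ fun {M N} i p h ⟨h1, h2⟩ => by
    have hinj : ∀ x, Function.Injective (i.app x) := fun x => by
      have h3 : i.app x ≫ p.app x = 𝟙 _ := by rw [← NatTrans.comp_app, h, NatTrans.id_app]
      have : Mono (i.app x) := SplitMono.mono ⟨p.app x, h3⟩
      exact (ModuleCat.mono_iff_injective _).1 inferInstance
    refine ⟨fun x => ?_, h2.subset fun x hx => ?_⟩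
    · have := h1 x
      exact Module.Finite.of_injective (i.app x).hom (hinj x)
    · have : Nontrivial (N.obj x) := hx
      exact (hinj x).nontrivial

variable [IsLofd k A] [HasRadicalSquareZero A] {Q : QuiverOf.{w, v, u, w₁, w₂} k A}

instance isKProjective_F (M : FDRep.{w, v, u, w₁, w₂} Q) : (F M).IsKProjective := by
  obtain ⟨-, b, hb⟩ := isBoundedCx_F M
  exact isKProjective_of_isBoundedCx hb fun i => inferInstance

theorem not_acyclic_F {M : FDRep.{w, v, u, w₁, w₂} Q} (hM : ¬ IsZero M) : ¬ (F M).Acyclic :=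
  fun h => hM <| (IsZero.iff_id_eq_zero _).2 <| eq_zero_of_isRadical_FMap _ fun i => by
    rw [(isZero_of_acyclic (isRadical_F_d M) h i).eq_of_src ((FMap (𝟙 M)).f i) 0]
    exact isRadical_zero _ _

/-- Full and faithful modulo the radical, `F` reflects isomorphism of objects. -/
theorem nonempty_iso_of_F_iso [IsAlgClosed k] {M M' : FDRep.{w, v, u, w₁, w₂} Q}
    (f : F M ≅ F M') : Nonempty (M ≅ M') := by
  have key : ∀ {M M' : FDRep.{w, v, u, w₁, w₂} Q} (s : F M ⟶ F M') (t : F M' ⟶ F M)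
      (g : M ⟶ M') (g' : M' ⟶ M), s ≫ t = 𝟙 _ → (∀ i, IsRadical ((s - FMap g).f i)) →
      (∀ i, IsRadical ((t - FMap g').f i)) → g ≫ g' = 𝟙 _ := by
    intro M M' s t g g' h hs ht
    rw [← sub_eq_zero]
    refine eq_zero_of_isRadical_FMap _ fun i => ?_
    have h1 : FMap (g ≫ g' - 𝟙 M) = -((s - FMap g) ≫ t + FMap g ≫ (t - FMap g')) := by
      rw [FMap_sub, FMap_comp, FMap_id, ← h, Preadditive.sub_comp, Preadditive.comp_sub]
      abel
    rw [h1]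
    exact (((hs i).comp_right _).add ((ht i).comp_left _)).neg
  obtain ⟨g, hg⟩ := exists_FMap f.hom
  obtain ⟨g', hg'⟩ := exists_FMap f.inv
  exact ⟨⟨g, g', key _ _ _ _ f.hom_inv_id hg hg', key _ _ _ _ f.inv_hom_id hg' hg⟩⟩

variable [HasDerivedCategory.{w₃} (FDModule k A)]

/-- An idempotent of `F(M)` in the derived category is represented by a map that is, modulo the
radical, `F` of an idempotent of `M`. -/
theorem isIndec_FDb [IsAlgClosed k] {M : FDRep.{w, v, u, w₁, w₂} Q} (hM : IsIndec M) :
    IsIndec (FDb M) := by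
  refine isIndec_toDb _ (not_acyclic_F hM.1) fun e he => ?_
  obtain ⟨s, rfl⟩ := exists_Q_map_eq e
  obtain ⟨h⟩ := homotopy_of_Q_map_eq (f := s ≫ s) (g := s) (by rw [DerivedCategory.Q.map_comp, he])
  obtain ⟨g, hg⟩ := exists_FMap s
  -- the idempotent of the derived category lifts to an idempotent endomorphism of `M`
  have hgg : g ≫ g = g := by
    rw [← sub_eq_zero]
    refine eq_zero_of_isRadical_FMap _ fun i => ?_
    have h1 : FMap (g ≫ g - g) =
        (s ≫ s - s) + (s - FMap g) - ((s - FMap g) ≫ s + FMap g ≫ (s - FMap g)) := by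
      rw [FMap_sub, FMap_comp, Preadditive.sub_comp, Preadditive.comp_sub]
      abel
    rw [h1]
    exact ((isRadical_of_homotopy h i (isRadical_F_d M _ _) (isRadical_F_d M _ _)).add
      (hg i)).sub (((hg i).comp_right _).add ((hg i).comp_left _))
  have hiso : ∀ (t : F M ⟶ F M), (∀ i, IsRadical ((t - 𝟙 _).f i)) → IsIso t := fun t ht =>
    isIso_of_isIso_f t fun i => (ht i).isIso_of_sub (f := (𝟙 (F M) : F M ⟶ F M).f i)
  rcases hM.idem g hgg with h0 | h1
  · left
    have h2 : FMap g = 0 := by rw [h0, ← sub_self g, FMap_sub, sub_self]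
    have := hiso (𝟙 _ - s) fun i => by
      have := (hg i).neg
      rw [h2, sub_zero] at this
      rw [sub_sub_cancel_left]
      exact this
    have h3 : IsIso (𝟙 (DerivedCategory.Q.obj (F M)) - DerivedCategory.Q.map s) := by
      rw [← DerivedCategory.Q.map_id, ← Functor.map_sub]
      infer_instance
    have := eq_id_of_idem_of_isIso
      (e := 𝟙 (DerivedCategory.Q.obj (F M)) - DerivedCategory.Q.map s) (by simp [he])
    simpa using this
  · right
    have := hiso s fun i => by
      rw [← FMap_id, ← h1]
      exact hg i
    exact eq_id_of_idem_of_isIso he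

/-- If `F(M)` is indecomposable then so is `M`, because `F` is faithful even after passage to the
derived category: a null-homotopic map `F(g)` is radical. -/
theorem isIndec_of_FDb {M : FDRep.{w, v, u, w₁, w₂} Q} (hM : IsIndec (FDb M)) : IsIndec M := by
  have h0 : FMap (0 : M ⟶ M) = 0 := by rw [← sub_self (𝟙 M), FMap_sub, sub_self]
  have hzero : ∀ g : M ⟶ M, DerivedCategory.Q.map (FMap g) = 0 → g = 0 := fun g hg => by
    obtain ⟨h⟩ := homotopy_of_Q_map_eq (f := FMap g) (g := 0) (by rw [hg, Functor.map_zero])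
    refine eq_zero_of_isRadical_FMap _ fun i => ?_
    have := isRadical_of_homotopy h i (isRadical_F_d M _ _) (isRadical_F_d M _ _)
    rwa [HomologicalComplex.zero_f, sub_zero] at this
  refine isIndec_of_idem (fun hz => hM.1 ?_) fun e he => ?_
  · refine isZero_of_isZero_obj.2 ((IsZero.iff_id_eq_zero _).2 ?_)
    change 𝟙 (DerivedCategory.Q.obj (F M)) = 0
    rw [← DerivedCategory.Q.map_id, ← FMap_id, (IsZero.iff_id_eq_zero _).1 hz, h0, Functor.map_zero]
  · refine (Q_map_idem hM (FMap e) (by rw [← FMap_comp, he])).imp (hzero e) fun h => ?_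
    rw [← sub_eq_zero]
    refine hzero _ ?_
    rw [FMap_sub, FMap_id, Functor.map_sub, h, DerivedCategory.Q.map_id, sub_self]

theorem nonempty_iso_of_FDb_iso [IsAlgClosed k] {M M' : FDRep.{w, v, u, w₁, w₂} Q}
    (h : Nonempty (FDb M ≅ FDb M')) : Nonempty (M ≅ M') := by
  obtain ⟨e⟩ := nonempty_toDb_iso_iff.1 h
  obtain ⟨f, -⟩ := exists_iso_of_Q_iso (isRadical_F_d M) (isRadical_F_d M') e
  exact nonempty_iso_of_F_iso f

end QuiverOf
end Representations

/-! ### The complexes `β(N)` in the derived category -/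

section Truncations

variable {k : Type w} [Field k] {A : Type u} [Category.{v} A] [Preadditive A] [Linear k A]
  [IsLofd k A]

/-- If `β(N)` were acyclic, its minimal projective resolution would be zero, hence bounded. -/
theorem not_acyclic_of_xBar {N : PMin k A} (hN : XBar N) : ¬ (beta N.obj).Acyclic := by
  obtain ⟨-, P, ⟨⟨b, hb⟩, hP, hm, f, _⟩, hPb⟩ := hN
  intro h
  have := isKProjective_of_isBoundedCx hb hP
  refine hPb ⟨⟨0, ?_⟩, b, hb⟩
  rw [CochainComplex.isStrictlyGE_iff]
  exact fun i _ => isZero_of_acyclic ((isMinimalCx_iff hP).1 hm)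
    (fun i => (quasiIsoAt_iff_exactAt' f i (h i)).1 inferInstance) i

variable [HasDerivedCategory.{w₃} (FDModule k A)]

theorem nonempty_betaDb_iso_of_xRel {N N' : PMin k A} (h : XRel N N') :
    Nonempty (betaDb N ≅ betaDb N') := by
  obtain ⟨P, P', ⟨-, -, -, f, _⟩, ⟨-, -, -, f', _⟩, ⟨e⟩⟩ := h
  refine nonempty_toDb_iso_iff.2 ⟨(asIso (Q.map f)).symm ≪≫ ?_ ≪≫ asIso (Q.map f')⟩
  exact ⟨Q.map e.hom, Q.map e.inv, by
    rw [← Q.map_comp, Q_map_eq_of_homotopy e.homotopyHomInvId, Q.map_id], by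
    rw [← Q.map_comp, Q_map_eq_of_homotopy e.homotopyInvHomId, Q.map_id]⟩

/-- Isomorphic objects of the derived category have isomorphic minimal projective resolutions. -/
theorem nonempty_iso_minProjResolution {P K P' K' : CochainComplex (FDModule k A) ℤ}
    (h : IsMinProjResolution P K) (h' : IsMinProjResolution P' K')
    (e : Nonempty (Q.obj K ≅ Q.obj K')) : Nonempty (P ≅ P') := by
  obtain ⟨⟨b, hb⟩, hP, hm, f, _⟩ := h
  obtain ⟨⟨b', hb'⟩, hP', hm', f', _⟩ := h'
  obtain ⟨e⟩ := e
  have := isKProjective_of_isBoundedCx hb hP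
  have := isKProjective_of_isBoundedCx hb' hP'
  obtain ⟨s, -⟩ := exists_iso_of_Q_iso ((isMinimalCx_iff hP).1 hm) ((isMinimalCx_iff hP').1 hm')
    (asIso (Q.map f) ≪≫ e ≪≫ (asIso (Q.map f')).symm)
  exact ⟨s⟩

theorem xRel_of_betaDb_iso {N N' : PMin k A} (hN : XBar N) (hN' : XBar N')
    (h : Nonempty (betaDb N ≅ betaDb N')) : XRel N N' := by
  obtain ⟨-, P, hP, -⟩ := hN
  obtain ⟨-, P', hP', -⟩ := hN'
  obtain ⟨s⟩ := nonempty_iso_minProjResolution hP hP' (nonempty_toDb_iso_iff.1 h)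
  exact ⟨P, P', hP, hP', ⟨HomotopyEquiv.ofIso s⟩⟩

theorem isIndec_betaDb {N : PMin k A} (hN : XBar N) : IsIndec (betaDb N) := by
  have hac := not_acyclic_of_xBar hN
  obtain ⟨hind, P, ⟨⟨b, hb⟩, hP, hm, f, _⟩, hPb⟩ := hN
  obtain ⟨hNb, hNp, hNm⟩ := N.property
  refine isIndec_toDb _ hac fun e he => ?_
  obtain ⟨hge, -⟩ := bottom_spec hNb fun h => hind.1 (isZero_of_isZero_obj.2 h)
  obtain ⟨q, hq⟩ : ∃ q, bottom N.obj = q + 1 := ⟨bottom N.obj - 1, by omega⟩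
  obtain ⟨j, hj⟩ : ∃ j : N.obj ⟶ beta N.obj, ∀ i, bottom N.obj ≤ i → IsIso (j.f i) :=
    exists_toTruncAt N.obj _ hge
  have hloc : ∀ θ : N.obj ⟶ N.obj, IsIso θ ∨ IsIso (𝟙 N.obj - θ) := fun θ =>
    have := finite_hom_of_isBoundedCx hNb
    isIso_or_isIso_one_sub k hind.idem_fullSubcategory θ
  obtain ⟨b', hb'⟩ := hNb.2
  have := isKProjective_of_isBoundedCx hb' hNp
  have := isKProjective_of_isBoundedCx hb hP
  have := isKProjective_of_isBoundedCx (isStrictlyLE_brutal P q b) fun i => inferInstance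
  have := hge
  exact idem_of_local (B := beta N.obj) q
    (fun i hi => N.obj.isZero_of_isStrictlyGE (bottom N.obj) i (by omega))
    (fun i hi => exactAt_truncAt N.obj (bottom N.obj) i (by omega)) ((isMinimalCx_iff hNp).1 hNm)
    ((isMinimalCx_iff hP).1 hm) j (fun i hi => hj i (by omega)) hloc hac f e he

/-- An indecomposable object with an unbounded minimal projective resolution is of the form
`β(N)`: let `N` be the brutal truncation of the resolution in the degrees `≥ p`, where the
resolution is exact in degrees `≤ p` and nonzero in degree `p`. -/
theorem exists_xBar {X : Db k A} (hX : IsIndec X) {P : CochainComplex (FDModule k A) ℤ}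
    (hPb : ∃ b, P.IsStrictlyLE b) (hPp : ∀ i, Projective (P.X i))
    (hPr : ∀ i j, IsRadical (P.d i j)) (hPex : ∃ a, ∀ i < a, P.ExactAt i)
    (e : Nonempty (X.obj ≅ Q.obj P)) (hP : ¬ IsBoundedCx P) :
    ∃ N : PMin k A, XBar N ∧ Nonempty (X ≅ betaDb N) := by
  obtain ⟨a, ha⟩ := hPex
  obtain ⟨b, hb⟩ := hPb
  obtain ⟨e⟩ := e
  obtain ⟨p, hp, hp0⟩ : ∃ p < a, ¬ IsZero (P.X p) := by
    by_contra! h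
    exact hP ⟨⟨a, (CochainComplex.isStrictlyGE_iff _ _).2 h⟩, b, hb⟩
  obtain ⟨q, rfl⟩ : ∃ q, p = q + 1 := ⟨p - 1, by omega⟩
  have hPex : ∀ i ≤ q + 1, P.ExactAt i := fun i hi => ha i (by omega)
  have hNb := isStrictlyLE_brutal P q b
  have hNz := isZero_brutal P q
  have hNge : (brutal P q).IsStrictlyGE (q + 1) :=
    (CochainComplex.isStrictlyGE_iff _ _).2 fun i hi => hNz i (by omega)
  have hNp : ∀ i, Projective ((brutal P q).X i) := fun i => inferInstance
  have hι := isIso_brutalι P q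
  have hN0 : ¬ IsZero ((brutal P q).X (q + 1)) := fun h =>
    have := hι (q + 1) (by omega)
    hp0 (h.of_iso (asIso ((brutalι P q).f (q + 1))).symm)
  have hbot : bottom (brutal P q) = q + 1 := bottom_eq hNge hN0
  let N : PMin k A := ⟨brutal P q, ⟨⟨_, hNge⟩, _, hNb⟩, hNp,
    (isMinimalCx_iff hNp).2 (isRadical_d_brutal P q hPr)⟩
  -- a variable with an equation, which keeps the definition of `beta` folded below
  obtain ⟨B, hB⟩ : ∃ B, B = beta N.obj := ⟨_, rfl⟩
  have hBt : B = truncAt (brutal P q) (q + 1) := by rw [hB, beta, hbot]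
  have hBb : IsBoundedCx B := hB ▸ isBoundedCx_truncAt N.property.1 _
  obtain ⟨j, hj⟩ : ∃ j : brutal P q ⟶ B, ∀ i, q < i → IsIso (j.f i) := by
    rw [hBt]
    exact exists_toTruncAt _ _ hNge
  have hBex : ∀ i ≤ q + 1, B.ExactAt i := by
    rw [hBt]
    exact exactAt_truncAt _ _
  have hBz : ∀ i < q, IsZero (B.X i) := fun i hi => by
    rw [hBt]
    exact (truncAt (brutal P q) (q + 1)).isZero_of_isStrictlyGE (q + 1 - 1) i (by omega)
  -- the inclusion of `N` into `B` extends to a map `P ⟶ B`, a minimal resolution of `B`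
  obtain ⟨f, hf⟩ := exists_extension q hNz hBz hBex (brutalι P q) hι j
  have hfi : ∀ i, q < i → IsIso (f.f i) := fun i hi => by
    have h1 : (brutalι P q).f i ≫ f.f i = j.f i := by rw [← HomologicalComplex.comp_f, hf]
    have := hι i hi
    have := hj i hi
    have h2 : IsIso ((brutalι P q).f i ≫ f.f i) := by rw [h1]; infer_instance
    exact IsIso.of_isIso_comp_left ((brutalι P q).f i) (f.f i)
  have hqi : QuasiIso f := quasiIso_of_agree f q hfi hPex hBex
  have hXB' : X.obj ≅ Q.obj B := e ≪≫ asIso (Q.map f)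
  have hXB : X ≅ toDb B hBb := ObjectProperty.isoMk _ hXB'
  have hindB : IsIndec (toDb B hBb) := hX.of_iso hXB
  have := isKProjective_of_isBoundedCx hb hPp
  -- `P^q` maps onto `B^q`, so a map `P^{q+1} ⟶ B^q` lifts to `P^q`, whose differential is radical
  have hBr : IsRadical (B.d q (q + 1)) := by
    have := hfi (q + 1) (by omega)
    have hm := mono_d_of_exactAt q hBz (hBex q (by omega))
    have hepi : Epi (f.f q) := by
      have h1 := (P.exactAt_iff_exact_up_to_refinements q (q + 1) (q + 1 + 1)
        (by simp) (by simp)).1 (hPex (q + 1) le_rfl)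
      have h0 : (B.d q (q + 1) ≫ inv (f.f (q + 1))) ≫ P.d (q + 1) (q + 1 + 1) = 0 := by
        have := hfi (q + 1 + 1) (by omega)
        rw [← cancel_mono (f.f (q + 1 + 1)), Category.assoc, Category.assoc, ← f.comm,
          IsIso.inv_hom_id_assoc, B.d_comp_d, zero_comp]
      obtain ⟨Y, π, _, y, hy⟩ := h1 (B.d q (q + 1) ≫ inv (f.f (q + 1))) h0
      have h2 : y ≫ f.f q = π := by
        rw [← cancel_mono (B.d q (q + 1)), Category.assoc, f.comm]
        have h3 : π ≫ B.d q (q + 1) ≫ inv (f.f (q + 1)) = y ≫ P.d q (q + 1) := hy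
        rw [← cancel_mono (inv (f.f (q + 1)))]
        simpa using h3.symm
      have : Epi (y ≫ f.f q) := by rw [h2]; infer_instance
      exact epi_of_epi y _
    have hproj : Projective (B.X (q + 1)) :=
      Projective.of_iso (asIso (f.f (q + 1))) (hPp (q + 1))
    refine isRadical_of_isIso fun g => ?_
    have h1 : IsRadical (f.f q ≫ B.d q (q + 1)) := by
      rw [f.comm]
      exact (hPr _ _).comp_right _
    have h2 := (h1.comp_left (Projective.factorThru g (f.f q))) (𝟙 _)
    rwa [Category.comp_id, Projective.factorThru_comp_assoc] at h2
  have hNind : IsIndec N := by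
    refine isIndec_of_idem (fun h => hN0 ?_) fun ε hε => ?_
    · exact (HomologicalComplex.eval _ _ (q + 1)).map_isZero (isZero_of_isZero_obj.1 h)
    obtain ⟨ε, rfl⟩ : ∃ ε' : brutal P q ⟶ brutal P q, ε = ObjectProperty.homMk ε' :=
      ⟨ε.hom, rfl⟩
    replace hε : ε ≫ ε = ε := congrArg (fun t : N ⟶ N => t.hom) hε
    -- idempotents of `N` extend to `B`
    obtain ⟨φ, hφ⟩ := exists_extension q hNz hBz hBex j hj (ε ≫ j)
    have hφφ : φ ≫ φ = φ := extension_unique q hBz (hBex q (by omega)) j hj (by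
      rw [reassoc_of% hφ, hφ, reassoc_of% hε])
    -- an endomorphism of `N` is invertible if it extends to one of `B` that is trivial in the
    -- derived category
    have key : ∀ (ψ : B ⟶ B) (θ : brutal P q ⟶ brutal P q), j ≫ ψ = θ ≫ j → Q.map ψ = 𝟙 _ →
        IsIso θ := by
      intro ψ θ h hψ
      have : QuasiIso ψ := by
        rw [← isIso_Q_map_iff_quasiIso, hψ]
        infer_instance
      refine isIso_of_isIso_f θ fun i => ?_
      by_cases hi : q < i
      · have := isIso_f_of_quasiIso q hPr f hfi hBr ψ i hi
        have := hj i hi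
        have h1 : θ.f i ≫ j.f i = j.f i ≫ ψ.f i := by
          rw [← HomologicalComplex.comp_f, ← h, HomologicalComplex.comp_f]
        have h2 : IsIso (θ.f i ≫ j.f i) := by rw [h1]; infer_instance
        exact IsIso.of_isIso_comp_right (θ.f i) (j.f i)
      · exact ⟨0, (hNz i (by omega)).eq_of_src _ _, (hNz i (by omega)).eq_of_src _ _⟩
    rcases Q_map_idem hindB φ hφφ with h | h
    · left
      have := key (𝟙 B - φ) (𝟙 _ - ε) (by simp [Preadditive.sub_comp, Preadditive.comp_sub, hφ])
        (by rw [Functor.map_sub, h, Q.map_id, sub_zero])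
      have h1 := eq_id_of_idem_of_isIso (e := 𝟙 (brutal P q) - ε) (by simp [hε])
      exact InducedCategory.hom_ext (by simpa using h1)
    · right
      have := key φ ε hφ h
      exact InducedCategory.hom_ext (eq_id_of_idem_of_isIso (e := ε) hε)
  refine ⟨N, ⟨hNind, P, ⟨⟨b, hb⟩, hPp, (isMinimalCx_iff hPp).2 hPr, ?_⟩, hP⟩, ?_⟩
  · rw [← hB]
    exact ⟨f, hqi⟩
  · subst hB
    exact ⟨hXB⟩

end Truncations

end RadSq

theorem theorem4p1 {k : Type w} [Field k] [IsAlgClosed k]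
    {A : Type u} [Category.{v} A] [Preadditive A] [Linear k A]
    [RadSq.IsLofd k A] [RadSq.HasRadicalSquareZero A]
    [HasDerivedCategory.{w₃} (RadSq.FDModule k A)]
    (Q : RadSq.QuiverOf.{w, v, u, w₁, w₂} k A)
    (𝒳 : Set (RadSq.PMin k A)) (h𝒳 : RadSq.IsRepresentatives 𝒳) :
    -- the listed objects are indecomposable
    (∀ M : Q.FDRep, RadSq.IsIndec M → RadSq.IsIndec (RadSq.FDb M)) ∧
    (∀ N ∈ 𝒳, RadSq.IsIndec (RadSq.betaDb N)) ∧
    -- the list is exhaustive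
    (∀ X : RadSq.Db k A, RadSq.IsIndec X →
      (∃ M : Q.FDRep, RadSq.IsIndec M ∧ Nonempty (X ≅ RadSq.FDb M)) ∨
      (∃ N ∈ 𝒳, Nonempty (X ≅ RadSq.betaDb N))) ∧
    -- the listed objects are pairwise non-isomorphic
    (∀ M M' : Q.FDRep, RadSq.IsIndec M → RadSq.IsIndec M' →
      Nonempty (RadSq.FDb M ≅ RadSq.FDb M') → Nonempty (M ≅ M')) ∧
    (∀ N ∈ 𝒳, ∀ N' ∈ 𝒳, Nonempty (RadSq.betaDb N ≅ RadSq.betaDb N') → N = N') ∧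
    (∀ M : Q.FDRep, RadSq.IsIndec M → ∀ N ∈ 𝒳,
      IsEmpty (RadSq.FDb M ≅ RadSq.betaDb N)) := by
  refine ⟨fun M hM => RadSq.QuiverOf.isIndec_FDb hM,
    fun N hN => RadSq.isIndec_betaDb (h𝒳.1 N hN), fun X hX => ?_,
    fun M M' _ _ h => RadSq.QuiverOf.nonempty_iso_of_FDb_iso h, fun N hN N' hN' h => ?_,
    fun M _ N hN => ⟨fun e => ?_⟩⟩
  · obtain ⟨P, hPb, hPp, hPr, hPex, hXP⟩ := RadSq.exists_minRes_toDb X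
    by_cases hP : RadSq.IsBoundedCx P
    · left
      obtain ⟨M, ⟨f⟩⟩ := RadSq.QuiverOf.exists_iso_F Q P hP hPp hPr
      have hXM : X ≅ RadSq.FDb M :=
        ObjectProperty.isoMk _ (hXP.some ≪≫ DerivedCategory.Q.mapIso f.symm)
      exact ⟨M, RadSq.QuiverOf.isIndec_of_FDb (hX.of_iso hXM), ⟨hXM⟩⟩
    · right
      obtain ⟨N, hN, ⟨e⟩⟩ := RadSq.exists_xBar hX hPb hPp hPr hPex hXP hP
      obtain ⟨N', ⟨hN', hr⟩, -⟩ := h𝒳.2 N hN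
      obtain ⟨e'⟩ := RadSq.nonempty_betaDb_iso_of_xRel hr
      exact ⟨N', hN', ⟨e ≪≫ e'⟩⟩
  · have hX := h𝒳.1 N hN
    exact (h𝒳.2 N hX).unique ⟨hN, RadSq.xRel_of_betaDb_iso hX hX ⟨Iso.refl _⟩⟩
      ⟨hN', RadSq.xRel_of_betaDb_iso hX (h𝒳.1 N' hN') h⟩
  -- `F(M)` is its own minimal projective resolution and bounded, that of `β(N)` is not bounded
  · obtain ⟨-, P, hP, hPb⟩ := h𝒳.1 N hN
    have hF : RadSq.IsMinProjResolution (RadSq.QuiverOf.F M) (RadSq.QuiverOf.F M) :=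
      ⟨(RadSq.QuiverOf.isBoundedCx_F M).2, fun i => inferInstance,
        (RadSq.isMinimalCx_iff fun i => inferInstance).2 (RadSq.QuiverOf.isRadical_F_d M),
        𝟙 _, inferInstance⟩
    obtain ⟨s⟩ := RadSq.nonempty_iso_minProjResolution hF hP (RadSq.nonempty_toDb_iso_iff.1 ⟨e⟩)
    exact hPb ((RadSq.QuiverOf.isBoundedCx_F M).of_retract s.inv s.hom s.inv_hom_id)
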